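/- **Setting.** Fix $z_0\in(0,1)$, $y_0\in\mathbb R$, $\varepsilon\in(0,1)$ and $1<\underline\beta<\overline\beta<2$. For a function $S$ on $[0,1]$ and $n\ge 1$ let $$y_k=S(k/n)\,y_{k-1}+\xi_k,\qquad 1\le k\le n,$$ with the given non-random initial value $y_0$ and i.i.d. $\xi_k\sim\mathcal N(0,1)$; $\mathbf E_S$ is the expectation under the law of $(y_1,\dots,y_n)$. For $L,L^*>0$ and $\beta=1+\alpha\in[\underline\beta,\overline\beta]$ let $\mathcal H^{(\beta)}(\varepsilon,L,L^*)$ be the set of $S\in C^1([0,1])$ with $\sup_{[0,1]}|S|\le 1-\varepsilon$, $\sup_{[0,1]}|\dot S|\le L$ and $\sup_{x\in[0,1],\,x\ne z_0}|\dot S(x)-\dot S(z_0)|/|x-z_0|^{\alpha}\le L^*$. Put $d_n=n/\ln n$ and $N(\beta)=d_n^{\beta/(2\beta+1)}$. An estimator $\tilde S_n$ of $S(z_0)$ is a measurable function of $(y_1,\dots,y_n)$; its adaptive risk is $$\mathcal R_{a,n}(\tilde S_n)=\sup_{\beta\in[\underline\beta,\overline\beta]}\ \sup_{S\in\mathcal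 H^{(\beta)}(\varepsilon,L,L^*)}N(\beta)\,\mathbf E_S|\tilde S_n-S(z_0)|\in[0,\infty].$$ **Sequential estimator.** Let $[\cdot]$ be the integral part, $Q$ the indicator function of $[-1,1]$, $\alpha\in(0,1)$, and let $h>0$ be a bandwidth. All definitions are meant for $n$ large. Put $u_j=(j/n-z_0)/h$, $A_{k,m}=\sum_{j=k+1}^mQ(u_j)y_{j-1}^2$, $\tilde\epsilon=h^\alpha/\ln n$, $\nu=[nz_0-nh]+1+[\tilde\epsilon nh]+1$, $\hat S_\nu=A_{0,\nu}^{-1}\sum_{j=1}^{\nu}Q(u_j)y_{j-1}y_j$, $\tilde S_\nu=\min(\max(\hat S_\nu,-1+\varepsilon),1-\varepsilon)$, $H=\dfrac{2(1-\tilde\epsilon)}{1-\tilde S_\nu^2}\,nh$ and $\tau=\inf\{\nu+1\le k\le n:A_{\nu,k}\ge H\}$ ($\inf\emptyset=n$). Let $\varkappa$ be defined by $A_{\nu,\tau-1}+\varkappa\,Q(u_\tau)y_{\tau-1}^2=H$ if $A_{\nu,\tau}\ge H$, and $\varkappa=1$ otherwise. Set $$S^*_{h,\alpha}=\frac1H\Big(\sum_{j=\nu+1}^{\tau-1}Q(u_j)y_{j-1}y_j+\varkappa\,Q(u_\tau)y_{\tau-1}y_\tau\Big)\mathbf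 1_{\{A_{\nu,n}\ge H\}}.$$ **Adaptive procedure.** Let $m=[\ln d_n]+1$ and, for $0\le k\le m$, $\beta_k=\underline\beta+\frac km(\overline\beta-\underline\beta)$, $N_k=N(\beta_k)$, $\check h_k=d_n^{-1/(2\beta_k+1)}$ and $\check S_k=S^*_{\check h_k,\,\beta_k-1}$. Fix a threshold $$\lambda>\lambda_*=4\sqrt2\left(\frac{\overline\beta-\underline\beta}{(2\underline\beta+1)(2\overline\beta+1)}\right)^{1/2},$$ which does not depend on $L$ or $L^*$. Set $\check\omega_k=\max_{0\le j\le k}\big(|\check S_j-\check S_k|-\lambda/N_j\big)$, $\check k=\max\{0\le k\le m:\check\omega_k\le\lambda/N_k\}$ and $\hat S_{a,n}=\check S_{\check k}$. **Theorem.** $\hat S_{a,n}$ is an estimator (a measurable function of the observations), and for every such $\lambda$ and all $L,L^*>0$, $$\limsup_{n\to\infty}\mathcal R_{a,n}(\hat S_{a,n})<\infty .$$ Moreover the rate is optimal: for every $L>0$ there is $L^*_0>0$ such that for all $L^*>L^*_0$ $$\liminf_{n\to\infty}\ \inf_{\tilde S_n}\ \mathcal R_{a,n}(\tilde S_n)>0,$$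 where the infimum is over all estimators. -/

import Mathlib

open MeasureTheory ProbabilityTheory Filter

namespace SeqAR

noncomputable section

/-! ### The Gaussian model `y_k = S(k/n) y_{k-1} + ξ_k` -/

/-- The autoregression started at `y 0 = y₀` and driven by the noise `ξ`.  The `k`-th innovation
is stored as `ξ (k - 1)`. -/
def arPath (n : ℕ) (S : ℝ → ℝ) (y₀ : ℝ) (ξ : ℕ → ℝ) : ℕ → ℝ
  | 0 => y₀
  | k + 1 => S (((k + 1 : ℕ) : ℝ) / n) * arPath n S y₀ ξ k + ξ k

/-- The observation vector `(y_1, …, y_n)`, with `y_{i+1}` at index `i`. -/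
def observations (n : ℕ) (S : ℝ → ℝ) (y₀ : ℝ) (ξ : ℕ → ℝ) : Fin n → ℝ :=
  fun i => arPath n S y₀ ξ ((i : ℕ) + 1)

/-- The law of a sequence of independent standard Gaussian variables. -/
def noiseLaw : Measure (ℕ → ℝ) := Measure.infinitePi (fun _ : ℕ => gaussianReal 0 1)

/-- The law `P_S` of the observations `(y_1, …, y_n)` in the Gaussian model. -/
def obsLaw (n : ℕ) (S : ℝ → ℝ) (y₀ : ℝ) : Measure (Fin n → ℝ) :=
  noiseLaw.map (observations n S y₀)

lemma measurable_observations (n : ℕ) (S : ℝ → ℝ) (y₀ : ℝ) :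
    Measurable (observations n S y₀) := by
  have h : ∀ k : ℕ, Measurable (fun ξ : ℕ → ℝ => arPath n S y₀ ξ k) := by
    intro k
    induction k with
    | zero => exact measurable_const
    | succ k ih => exact (ih.const_mul _).add (measurable_pi_apply k)
  exact measurable_pi_lambda _ fun i => h _

instance (n : ℕ) (S : ℝ → ℝ) (y₀ : ℝ) : IsProbabilityMeasure (obsLaw n S y₀) := by
  have : IsProbabilityMeasure noiseLaw := by unfold noiseLaw; infer_instance
  exact Measure.isProbabilityMeasure_map (measurable_observations n S y₀).aemeasurable

/-! ### Function classes -/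

/-- The stability set: continuously differentiable functions on `[0, 1]` (with one-sided
derivatives at the end points) such that `‖S‖ ≤ 1 - ε` and `‖S'‖ ≤ L` in the sup norm on `[0, 1]`.
Only the values of `S` on `[0, 1]` matter. -/
def stableSet (ε L : ℝ) : Set (ℝ → ℝ) :=
  {S | ContDiffOn ℝ 1 S (Set.Icc 0 1) ∧
    (∀ x ∈ Set.Icc (0 : ℝ) 1, |S x| ≤ 1 - ε) ∧
    ∀ x ∈ Set.Icc (0 : ℝ) 1, |derivWithin S (Set.Icc 0 1) x| ≤ L}

/-- The strong stable local Hölder class of regularity `β = 1 + α` at the point `z₀`. -/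
def holderClass (z₀ ε L Lstar β : ℝ) : Set (ℝ → ℝ) :=
  {S | S ∈ stableSet ε L ∧
    ∀ x ∈ Set.Icc (0 : ℝ) 1, x ≠ z₀ →
      |derivWithin S (Set.Icc 0 1) x - derivWithin S (Set.Icc 0 1) z₀| / |x - z₀| ^ (β - 1)
        ≤ Lstar}

/-! ### Rates and the adaptive risk -/

/-- `d_n = n / ln n`. -/
def dn (n : ℕ) : ℝ := n / Real.log n

/-- The rate `N(β) = d_n ^ (β / (2β + 1))`. -/
def rate (n : ℕ) (β : ℝ) : ℝ := dn n ^ (β / (2 * β + 1))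

/-- The adaptive risk of the estimator `T` of `S(z₀)`; the expectation is a Lebesgue integral with
values in `[0, ∞]`, so that boundedness of the risk includes integrability. -/
def adaptiveRisk (z₀ y₀ ε L Lstar βlow βup : ℝ) (n : ℕ) (T : (Fin n → ℝ) → ℝ) : ENNReal :=
  ⨆ β ∈ Set.Icc βlow βup, ⨆ S ∈ holderClass z₀ ε L Lstar β,
    ENNReal.ofReal (rate n β) * ∫⁻ y, ENNReal.ofReal |T y - S z₀| ∂(obsLaw n S y₀)

/-! ### The sequential kernel estimator

In this part `y : ℕ → ℝ` is a path `y_0, y_1, …` (of which only `y_0, …, y_n` are used once `n` is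
large), `h` is the bandwidth and `α` the Hölder exponent of the derivative. Integral parts of
positive numbers are taken with `⌊·⌋₊`. -/

/-- The kernel: the indicator function of `[-1, 1]`. -/
def kernelQ (u : ℝ) : ℝ := Set.indicator (Set.Icc (-1) 1) (fun _ => (1 : ℝ)) u

/-- `Q(u_j)` with `u_j = (j/n - z₀)/h`. -/
def weight (n : ℕ) (z₀ h : ℝ) (j : ℕ) : ℝ := kernelQ (((j : ℝ) / n - z₀) / h)

/-- `A_{k,m} = ∑_{j=k+1}^m Q(u_j) y_{j-1}²`. -/
def sumA (n : ℕ) (z₀ h : ℝ) (y : ℕ → ℝ) (k m : ℕ) : ℝ :=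
  ∑ j ∈ Finset.Ioc k m, weight n z₀ h j * y (j - 1) ^ 2

/-- `ε̃ = h^α / ln n`. -/
def epsTilde (n : ℕ) (h α : ℝ) : ℝ := h ^ α / Real.log n

/-- `ν = k_* + ι` with `k_* = [n z₀ - n h] + 1` and `ι = [ε̃ n h] + 1`. -/
def nu (n : ℕ) (z₀ h α : ℝ) : ℕ :=
  (⌊n * z₀ - n * h⌋₊ + 1) + (⌊epsTilde n h α * n * h⌋₊ + 1)

/-- The kernel estimator of `S(z₀)` based on the first `ν` observations. -/
def pilot (n : ℕ) (z₀ h α : ℝ) (y : ℕ → ℝ) : ℝ :=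
  (∑ j ∈ Finset.Ioc 0 (nu n z₀ h α), weight n z₀ h j * y (j - 1) * y j) /
    sumA n z₀ h y 0 (nu n z₀ h α)

/-- The pilot estimator projected into `[-1 + ε, 1 - ε]`. -/
def pilotProj (n : ℕ) (z₀ ε h α : ℝ) (y : ℕ → ℝ) : ℝ :=
  min (max (pilot n z₀ h α y) (-1 + ε)) (1 - ε)

/-- The threshold `H = φ n h` with `φ = 2 (1 - ε̃) / (1 - S̃²)`, `S̃` the projected pilot. -/
def thresholdH (n : ℕ) (z₀ ε h α : ℝ) (y : ℕ → ℝ) : ℝ :=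
  2 * (1 - epsTilde n h α) / (1 - pilotProj n z₀ ε h α y ^ 2) * n * h

open Classical in
/-- The stopping time `τ = inf {k ≥ ν + 1 : A_{ν,k} ≥ H}` over `k ≤ n`, with `inf ∅ = n`. -/
def tau (n : ℕ) (z₀ ε h α : ℝ) (y : ℕ → ℝ) : ℕ :=
  if ∃ k, nu n z₀ h α + 1 ≤ k ∧ k ≤ n ∧
      thresholdH n z₀ ε h α y ≤ sumA n z₀ h y (nu n z₀ h α) k then
    sInf {k | nu n z₀ h α + 1 ≤ k ∧ k ≤ n ∧
      thresholdH n z₀ ε h α y ≤ sumA n z₀ h y (nu n z₀ h α) k}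
  else n

open Classical in
/-- The correcting coefficient: the solution `ϰ` of
`A_{ν,τ-1} + ϰ Q(u_τ) y_{τ-1}² = H` if `A_{ν,τ} ≥ H`, and `1` otherwise. -/
def correction (n : ℕ) (z₀ ε h α : ℝ) (y : ℕ → ℝ) : ℝ :=
  if thresholdH n z₀ ε h α y ≤ sumA n z₀ h y (nu n z₀ h α) (tau n z₀ ε h α y) then
    (thresholdH n z₀ ε h α y - sumA n z₀ h y (nu n z₀ h α) (tau n z₀ ε h α y - 1)) /
      (weight n z₀ h (tau n z₀ ε h α y) * y (tau n z₀ ε h α y - 1) ^ 2)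
  else 1

open Classical in
/-- The truncated sequential kernel estimator `S*_h` of `S(z₀)`. -/
def seqEst (n : ℕ) (z₀ ε h α : ℝ) (y : ℕ → ℝ) : ℝ :=
  if thresholdH n z₀ ε h α y ≤ sumA n z₀ h y (nu n z₀ h α) n then
    (1 / thresholdH n z₀ ε h α y) *
      ((∑ j ∈ Finset.Ioc (nu n z₀ h α) (tau n z₀ ε h α y - 1),
          weight n z₀ h j * y (j - 1) * y j) +
        correction n z₀ ε h α y * weight n z₀ h (tau n z₀ ε h α y) *
          y (tau n z₀ ε h α y - 1) * y (tau n z₀ ε h α y))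
  else 0

/-! ### The adaptive procedure -/

/-- The bandwidth `ȟ(β) = (1/d_n) ^ (1/(2β + 1))`. -/
def bandwidth (n : ℕ) (β : ℝ) : ℝ := (1 / dn n) ^ (1 / (2 * β + 1))

/-- `m = [ln d_n] + 1`. -/
def gridSize (n : ℕ) : ℕ := ⌊Real.log (dn n)⌋₊ + 1

/-- `β_k = β_low + (k/m) (β_up - β_low)`; the associated exponent is `α_k = β_k - 1`. -/
def gridBeta (n : ℕ) (βlow βup : ℝ) (k : ℕ) : ℝ :=
  βlow + (k : ℝ) / (gridSize n : ℝ) * (βup - βlow)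

/-- The sequential estimator `Š_k` at the `k`-th grid point. -/
def gridEst (n : ℕ) (z₀ ε βlow βup : ℝ) (y : ℕ → ℝ) (k : ℕ) : ℝ :=
  seqEst n z₀ ε (bandwidth n (gridBeta n βlow βup k)) (gridBeta n βlow βup k - 1) y

/-- `ω̌_k = max_{0 ≤ j ≤ k} (|Š_j - Š_k| - lam / N_j)`. -/
def omega (n : ℕ) (z₀ ε βlow βup lam : ℝ) (y : ℕ → ℝ) (k : ℕ) : ℝ :=
  (Finset.range (k + 1)).sup' Finset.nonempty_range_add_one fun j =>
    |gridEst n z₀ ε βlow βup y j - gridEst n z₀ ε βlow βup y k| -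
      lam / rate n (gridBeta n βlow βup j)

open Classical in
/-- The selected index `ǩ = max {0 ≤ k ≤ m : ω̌_k ≤ lam / N_k}`. The set contains `0` when
`lam > 0`, because `ω̌_0 = -lam / N_0`. -/
def selectedIndex (n : ℕ) (z₀ ε βlow βup lam : ℝ) (y : ℕ → ℝ) : ℕ :=
  Nat.findGreatest
    (fun k => omega n z₀ ε βlow βup lam y k ≤ lam / rate n (gridBeta n βlow βup k)) (gridSize n)

/-- The path `y_0, y_1, …, y_n` made of the initial value and the observations (and continued by
`0`, which is immaterial). -/
def pathOf (n : ℕ) (y₀ : ℝ) (y : Fin n → ℝ) : ℕ → ℝ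
  | 0 => y₀
  | k + 1 => if hk : k < n then y ⟨k, hk⟩ else 0

/-- The adaptive estimator `Ŝ_{a,n}` as a function of the observations. -/
def adaptiveEst (z₀ y₀ ε βlow βup lam : ℝ) (n : ℕ) (y : Fin n → ℝ) : ℝ :=
  gridEst n z₀ ε βlow βup (pathOf n y₀ y)
    (selectedIndex n z₀ ε βlow βup lam (pathOf n y₀ y))

/-- The lower bound `4 √2 ((β_up - β_low) / ((2β_low + 1)(2β_up + 1)))^{1/2}` for the threshold. -/
def lamStar (βlow βup : ℝ) : ℝ :=
  4 * Real.sqrt 2 * Real.sqrt ((βup - βlow) / ((2 * βlow + 1) * (2 * βup + 1)))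

end

end SeqAR

namespace SeqAR

noncomputable section

/-! ### Sequences of independent standard Gaussian variables -/

/-! Upper bound, fixed bandwidth. Stopping the sums exactly at level `H` turns the sequential
estimator into a weighted average, and its error splits into a bias and a predictable transform of
the innovations (`seqEst_sub_eq`). The quadratic variation of the transform is at most 1/H ≤ 1/(nh)
on every path, so the exponential martingale (`lintegral_exp_predictable`) yields Gaussian tails. At
the chosen bandwidth nh = N(β)² ln n, so a stochastic error of size λ/(2N(β)) has probability at
most 2n^(-λ²/8).

For the bias, S is expanded to first order at z₀. The Taylor remainder contributes O(h^β). The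
linear term would be of order h, and it is here that the construction matters: by the ergodic
identity `sum_weighted_sq_eq` the squares y_{j-1}² average to 1/(1 - S(z₀)²), the pilot recovers
this value up to order ε̃, hence H is reached with A_{ν,n} - H = O(ε̃nh), and the nearly symmetric
window cancels the linear term up to O(hε̃) = O(h^β / ln n) (`Admissible.abs_seqEst_sub_le`). All
this holds on a good event whose complement has probability O(h² ln n). That is enough, because
N(β)h² ln n = h^(2-β) ln n is small when β < 2.

Upper bound, adaptation. This is Lepski's argument. For the true regularity β a grid point β_k
slightly below β is chosen, at distance of order 1/ln d_n: near enough that N(β) and N(β_k) are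
comparable, yet far enough, unless k = 0, that the biases of all estimators up to k are at most λ/2
relative to their rates. If the selected index is at least k, the selection rule ties the selected
estimator to the k-th one. Otherwise one of the first k + 1 estimators has an exceptional stochastic
error, or is outside its good event, and comparison with index 0 costs at most the factor
N(βup)/N(βlow) = d_n^δ, where δ = (βup - βlow)/((2βlow + 1)(2βup + 1)). This loss enters squared, so
d_n^(2δ) n^(-λ²/8) ln n must vanish; the assumption λ² > 32δ gives this with room to spare. The
pieces meet in `rate_mul_lintegral_le`.

Lower bound. Two hypotheses are compared: S = 0, regarded as an element of the class of regularity
βup, and a bump of height c h^βlow of regularity βlow. Its energy is of order c² ln n, so for small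
c the likelihood ratio costs less than the gain d_n^δ between the two rates (`measure_lt_logLik_le`,
`two_point_lower_bound`). An estimator accurate at 0 to the faster rate therefore misses the bump at
the slower rate. -/

instance : IsProbabilityMeasure noiseLaw := by unfold noiseLaw; infer_instance

lemma map_eval_noiseLaw (k : ℕ) :
    noiseLaw.map (fun ξ : ℕ → ℝ => ξ k) = gaussianReal 0 1 :=
  Measure.infinitePi_map_eval (fun _ : ℕ => gaussianReal 0 1) k

lemma iIndepFun_noiseLaw : iIndepFun (fun (k : ℕ) (ξ : ℕ → ℝ) => ξ k) noiseLaw :=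
  iIndepFun_infinitePi (P := fun _ : ℕ => gaussianReal 0 1) (X := fun _ x => x)
    (fun _ => measurable_id)

/-- The `k`-th coordinate may be integrated first when the rest of the integrand only depends on
the previous coordinates. -/
theorem lintegral_noiseLaw_coord (k : ℕ) (Φ : (ℕ → ℝ) → ℝ → ENNReal)
    (hΦ : Measurable (Function.uncurry Φ))
    (hdep : ∀ x, DependsOn (fun ξ => Φ ξ x) (Set.Iio k)) :
    ∫⁻ ξ, Φ ξ (ξ k) ∂noiseLaw = ∫⁻ ξ, ∫⁻ x, Φ ξ x ∂(gaussianReal 0 1) ∂noiseLaw := by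
  classical
  let r : (ℕ → ℝ) → (Finset.range k → ℝ) := fun ξ i => ξ i
  -- Padding the first `k` coordinates by zero does not change `Φ`, so `Φ` factors through finitely
  -- many coordinates, which are independent of the `k`-th one.
  let e : (Finset.range k → ℝ) → (ℕ → ℝ) := fun v i =>
    if hi : i ∈ Finset.range k then v ⟨i, hi⟩ else 0
  have hr : Measurable r := by fun_prop
  have he : Measurable e := by
    refine measurable_pi_lambda _ fun i => ?_
    by_cases hi : i ∈ Finset.range k
    · simp only [e, hi, dif_pos]; fun_prop
    · simp only [e, hi, dif_neg, not_false_eq_true]; fun_prop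
  have hΨ : Measurable (fun p : (Finset.range k → ℝ) × ℝ => Φ (e p.1) p.2) :=
    hΦ.comp ((he.comp measurable_fst).prodMk measurable_snd)
  have heq : ∀ ξ x, Φ ξ x = Φ (e (r ξ)) x := by
    intro ξ x
    refine hdep x fun i hi => ?_
    simp only [e, r]
    rw [dif_pos (Finset.mem_range.2 hi)]
  have hind : IndepFun r (fun ξ : ℕ → ℝ => ξ k) noiseLaw := by
    have h := iIndepFun_noiseLaw.indepFun_finset (Finset.range k) {k} (by simp)
      (fun i => measurable_pi_apply i)
    exact h.comp (φ := id) (ψ := fun v : (({k} : Finset ℕ) → ℝ) => v ⟨k, by simp⟩)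
      measurable_id (measurable_pi_apply _)
  have hmap := (indepFun_iff_map_prod_eq_prod_map_map hr.aemeasurable
    (measurable_pi_apply k).aemeasurable).1 hind
  rw [map_eval_noiseLaw] at hmap
  calc ∫⁻ ξ, Φ ξ (ξ k) ∂noiseLaw = ∫⁻ ξ, Φ (e (r ξ)) (ξ k) ∂noiseLaw :=
        lintegral_congr fun ξ => heq ξ _
    _ = ∫⁻ p, Φ (e p.1) p.2 ∂(noiseLaw.map (fun ξ => (r ξ, ξ k))) :=
        (lintegral_map hΨ (hr.prodMk (measurable_pi_apply k))).symm
    _ = ∫⁻ v, ∫⁻ x, Φ (e v) x ∂(gaussianReal 0 1) ∂(noiseLaw.map r) := by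
        rw [hmap]; exact lintegral_prod _ hΨ.aemeasurable
    _ = ∫⁻ ξ, ∫⁻ x, Φ (e (r ξ)) x ∂(gaussianReal 0 1) ∂noiseLaw :=
        lintegral_map hΨ.lintegral_prod_right' hr
    _ = _ := lintegral_congr fun ξ => lintegral_congr fun x => (heq ξ x).symm

/-! ### Exponential martingale, tail and moment bounds. -/

/-- The Gaussian translation formula. -/
theorem lintegral_gaussianReal_shift (f : ℝ → ENNReal) (hf : Measurable f) (a : ℝ) :
    ∫⁻ x, f x ∂(gaussianReal 0 1) =
      ∫⁻ x, f (a + x) * ENNReal.ofReal (Real.exp (-(a * x + a ^ 2 / 2))) ∂(gaussianReal 0 1) := by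
  rw [gaussianReal_of_var_ne_zero 0 one_ne_zero,
    lintegral_withDensity_eq_lintegral_mul _ (measurable_gaussianPDF 0 1) hf,
    lintegral_withDensity_eq_lintegral_mul _ (measurable_gaussianPDF 0 1) (by fun_prop),
    ← lintegral_add_left_eq_self _ a]
  refine lintegral_congr fun x => ?_
  simp only [Pi.mul_apply, gaussianPDF, gaussianPDFReal]
  rw [mul_left_comm, mul_comm, ← ENNReal.ofReal_mul (by positivity)]
  congr 2
  have e : Real.exp (-(a + x - 0) ^ 2 / (2 * ((1 : NNReal) : ℝ))) =
      Real.exp (-(x - 0) ^ 2 / (2 * ((1 : NNReal) : ℝ))) *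
        Real.exp (-(a * x + a ^ 2 / 2)) := by
    rw [← Real.exp_add]
    congr 1
    push_cast
    ring
  rw [e, ← mul_assoc]

lemma lintegral_gaussianReal_exp (a : ℝ) :
    ∫⁻ x, ENNReal.ofReal (Real.exp (a * x - a ^ 2 / 2)) ∂(gaussianReal 0 1) = 1 := by
  have h := lintegral_gaussianReal_shift (fun _ => 1) measurable_const (-a)
  simp only [lintegral_const, measure_univ, mul_one, one_mul] at h
  rw [h]
  refine lintegral_congr fun x => ?_
  congr 2
  ring

/-- The exponential martingale of a predictable sequence. -/
theorem lintegral_exp_predictable (a : ℕ → (ℕ → ℝ) → ℝ) (n : ℕ)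
    (ha : ∀ i < n, Measurable (a i)) (hdep : ∀ i < n, DependsOn (a i) (Set.Iio i)) :
    ∫⁻ ξ, ENNReal.ofReal
      (Real.exp (∑ i ∈ Finset.range n, (a i ξ * ξ i - a i ξ ^ 2 / 2))) ∂noiseLaw = 1 := by
  induction n with
  | zero => simp
  | succ n ih =>
    have ih' := ih (fun i hi => ha i (by omega)) (fun i hi => hdep i (by omega))
    have hm : Measurable (a n) := ha n (by omega)
    have hsum : Measurable fun ξ : ℕ → ℝ =>
        ∑ i ∈ Finset.range n, (a i ξ * ξ i - a i ξ ^ 2 / 2) := by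
      refine Finset.measurable_sum _ fun i hi => ?_
      have := ha i (by have := Finset.mem_range.1 hi; omega)
      fun_prop
    -- Given the past, the last factor has mean one, so integrating the newest innovation first
    -- removes it.
    have key := lintegral_noiseLaw_coord n (fun ξ x => ENNReal.ofReal
      (Real.exp (∑ i ∈ Finset.range n, (a i ξ * ξ i - a i ξ ^ 2 / 2))) *
        ENNReal.ofReal (Real.exp (a n ξ * x - a n ξ ^ 2 / 2)))
      (by
        have h1 : Measurable fun p : (ℕ → ℝ) × ℝ =>
            ∑ i ∈ Finset.range n, (a i p.1 * p.1 i - a i p.1 ^ 2 / 2) := hsum.comp measurable_fst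
        have h2 : Measurable fun p : (ℕ → ℝ) × ℝ => a n p.1 := hm.comp measurable_fst
        unfold Function.uncurry
        fun_prop)
      (by
        intro x ξ η h
        have h1 : a n ξ = a n η := hdep n (by omega) h
        have h2 : ∑ i ∈ Finset.range n, (a i ξ * ξ i - a i ξ ^ 2 / 2) =
            ∑ i ∈ Finset.range n, (a i η * η i - a i η ^ 2 / 2) := by
          refine Finset.sum_congr rfl fun i hi => ?_
          have hi' := Finset.mem_range.1 hi
          have h3 : a i ξ = a i η :=
            hdep i (by omega) fun j hj => h j (lt_trans hj hi')
          rw [h3, h i hi']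
        simp only [h1, h2])
    calc _ = ∫⁻ ξ, ENNReal.ofReal
          (Real.exp (∑ i ∈ Finset.range n, (a i ξ * ξ i - a i ξ ^ 2 / 2))) *
          ENNReal.ofReal (Real.exp (a n ξ * ξ n - a n ξ ^ 2 / 2)) ∂noiseLaw := by
          refine lintegral_congr fun ξ => ?_
          rw [Finset.sum_range_succ, Real.exp_add, ENNReal.ofReal_mul (Real.exp_nonneg _)]
      _ = _ := key
      _ = ∫⁻ ξ, ENNReal.ofReal
          (Real.exp (∑ i ∈ Finset.range n, (a i ξ * ξ i - a i ξ ^ 2 / 2))) ∂noiseLaw := by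
          refine lintegral_congr fun ξ => ?_
          rw [lintegral_const_mul _ (by fun_prop), lintegral_gaussianReal_exp, mul_one]
      _ = 1 := ih'

/-- One-sided sub-Gaussian bound for a predictable transform on the event where its quadratic
variation is bounded. -/
theorem measure_predictable_ge_le (a : ℕ → (ℕ → ℝ) → ℝ) (n : ℕ)
    (ha : ∀ i < n, Measurable (a i)) (hdep : ∀ i < n, DependsOn (a i) (Set.Iio i))
    (x v t : ℝ) (ht : 0 ≤ t) :
    noiseLaw {ξ | x ≤ ∑ i ∈ Finset.range n, a i ξ * ξ i ∧
        ∑ i ∈ Finset.range n, a i ξ ^ 2 ≤ v} ≤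
      ENNReal.ofReal (Real.exp (t ^ 2 * v / 2 - t * x)) := by
  have h1 := lintegral_exp_predictable (fun i ξ => t * a i ξ) n
    (fun i hi => (ha i hi).const_mul t)
    (fun i hi ξ η h => by simp only [hdep i hi h])
  set f : (ℕ → ℝ) → ENNReal := fun ξ => ENNReal.ofReal
    (Real.exp (∑ i ∈ Finset.range n, (t * a i ξ * ξ i - (t * a i ξ) ^ 2 / 2))) with hf
  have hsub : {ξ | x ≤ ∑ i ∈ Finset.range n, a i ξ * ξ i ∧
        ∑ i ∈ Finset.range n, a i ξ ^ 2 ≤ v} ⊆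
      {ξ | ENNReal.ofReal (Real.exp (t * x - t ^ 2 * v / 2)) ≤ f ξ} := by
    rintro ξ ⟨hx, hv⟩
    simp only [hf, Set.mem_ofPred_eq]
    refine ENNReal.ofReal_le_ofReal (Real.exp_le_exp.2 ?_)
    have : ∑ i ∈ Finset.range n, (t * a i ξ * ξ i - (t * a i ξ) ^ 2 / 2) =
        t * (∑ i ∈ Finset.range n, a i ξ * ξ i) -
          t ^ 2 * (∑ i ∈ Finset.range n, a i ξ ^ 2) / 2 := by
      rw [Finset.sum_sub_distrib, Finset.mul_sum, Finset.mul_sum, Finset.sum_div]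
      congr 1 <;> exact Finset.sum_congr rfl fun i _ => by ring
    rw [this]
    have := mul_le_mul_of_nonneg_left hx ht
    have := mul_le_mul_of_nonneg_left hv (sq_nonneg t)
    linarith
  have hfm : Measurable f := by
    have : Measurable fun ξ : ℕ → ℝ =>
        ∑ i ∈ Finset.range n, (t * a i ξ * ξ i - (t * a i ξ) ^ 2 / 2) := by
      refine Finset.measurable_sum _ fun i hi => ?_
      have := ha i (Finset.mem_range.1 hi)
      fun_prop
    fun_prop
  refine (measure_mono hsub).trans ?_
  have := meas_ge_le_lintegral_div (μ := noiseLaw) hfm.aemeasurable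
    (ε := ENNReal.ofReal (Real.exp (t * x - t ^ 2 * v / 2)))
    (by simp [Real.exp_pos]) ENNReal.ofReal_ne_top
  refine this.trans ?_
  rw [h1, ← ENNReal.ofReal_one, ← ENNReal.ofReal_div_of_pos (Real.exp_pos _), one_div,
    ← Real.exp_neg]
  refine ENNReal.ofReal_le_ofReal (Real.exp_le_exp.2 ?_)
  linarith

/-- Two-sided sub-Gaussian bound for a predictable transform with bounded quadratic variation. -/
theorem measure_abs_predictable_ge_le (a : ℕ → (ℕ → ℝ) → ℝ) (n : ℕ)
    (ha : ∀ i < n, Measurable (a i)) (hdep : ∀ i < n, DependsOn (a i) (Set.Iio i))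
    (x v : ℝ) (hx : 0 ≤ x) (hv : 0 < v)
    (hav : ∀ ξ, ∑ i ∈ Finset.range n, a i ξ ^ 2 ≤ v) :
    noiseLaw {ξ | x ≤ |∑ i ∈ Finset.range n, a i ξ * ξ i|} ≤
      ENNReal.ofReal (2 * Real.exp (-(x ^ 2 / (2 * v)))) := by
  -- The exponent t²v/2 - tx is minimal at t = x/v.
  have e : (x / v) ^ 2 * v / 2 - x / v * x = -(x ^ 2 / (2 * v)) := by field_simp; ring
  have h1 := measure_predictable_ge_le a n ha hdep x v (x / v) (by positivity)
  have h2 := measure_predictable_ge_le (fun i ξ => -a i ξ) n (fun i hi => (ha i hi).neg)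
    (fun i hi ξ η h => by simp only [hdep i hi h]) x v (x / v) (by positivity)
  rw [e] at h1 h2
  have hsub : {ξ | x ≤ |∑ i ∈ Finset.range n, a i ξ * ξ i|} ⊆
      {ξ | x ≤ ∑ i ∈ Finset.range n, a i ξ * ξ i ∧ ∑ i ∈ Finset.range n, a i ξ ^ 2 ≤ v} ∪
      {ξ | x ≤ ∑ i ∈ Finset.range n, -a i ξ * ξ i ∧
        ∑ i ∈ Finset.range n, (-a i ξ) ^ 2 ≤ v} := by
    intro ξ hξ
    have hξ' : x ≤ |∑ i ∈ Finset.range n, a i ξ * ξ i| := hξ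
    rcases le_abs.1 hξ' with h | h
    · exact Or.inl ⟨h, hav ξ⟩
    · refine Or.inr ⟨?_, ?_⟩
      · simpa [Finset.sum_neg_distrib] using h
      · simpa using hav ξ
  refine (measure_mono hsub).trans ((measure_union_le _ _).trans ((add_le_add h1 h2).trans ?_))
  rw [← ENNReal.ofReal_add (Real.exp_nonneg _) (Real.exp_nonneg _), ← two_mul]

/-- Second moment of a predictable transform with bounded quadratic variation. -/
theorem lintegral_predictable_sq_le (a : ℕ → (ℕ → ℝ) → ℝ) (n : ℕ)
    (ha : ∀ i < n, Measurable (a i)) (hdep : ∀ i < n, DependsOn (a i) (Set.Iio i))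
    (v : ℝ) (hv : 0 < v) (hav : ∀ ξ, ∑ i ∈ Finset.range n, a i ξ ^ 2 ≤ v) :
    ∫⁻ ξ, ENNReal.ofReal ((∑ i ∈ Finset.range n, a i ξ * ξ i) ^ 2) ∂noiseLaw ≤
      ENNReal.ofReal (8 * v) := by
  set s := Real.sqrt v with hs
  have hs0 : 0 < s := Real.sqrt_pos.2 hv
  have hss : s ^ 2 = v := Real.sq_sqrt hv.le
  have h1 := lintegral_exp_predictable (fun i ξ => s⁻¹ * a i ξ) n
    (fun i hi => (ha i hi).const_mul _) (fun i hi ξ η h => by simp only [hdep i hi h])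
  have h2 := lintegral_exp_predictable (fun i ξ => -s⁻¹ * a i ξ) n
    (fun i hi => (ha i hi).const_mul _) (fun i hi ξ η h => by simp only [hdep i hi h])
  set f : (ℕ → ℝ) → ℝ := fun ξ =>
    ∑ i ∈ Finset.range n, (s⁻¹ * a i ξ * ξ i - (s⁻¹ * a i ξ) ^ 2 / 2) with hf
  set g : (ℕ → ℝ) → ℝ := fun ξ =>
    ∑ i ∈ Finset.range n, (-s⁻¹ * a i ξ * ξ i - (-s⁻¹ * a i ξ) ^ 2 / 2) with hg
  have hfm : Measurable f := by
    refine Finset.measurable_sum _ fun i hi => ?_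
    have := ha i (Finset.mem_range.1 hi)
    fun_prop
  -- The square is dominated by the two exponential martingales with parameters ±1/√v, through w² ≤
  -- 4 exp(w - 1/2); here 1/2 bounds half of the normalised quadratic variation. Each martingale has
  -- mean one, whence the constant 8. No integrability or orthogonality of the increments has to be
  -- shown.
  have hpt : ∀ ξ, (∑ i ∈ Finset.range n, a i ξ * ξ i) ^ 2 ≤
      4 * v * (Real.exp (f ξ) + Real.exp (g ξ)) := by
    intro ξ
    set M := ∑ i ∈ Finset.range n, a i ξ * ξ i with hM
    set Q := ∑ i ∈ Finset.range n, a i ξ ^ 2 with hQ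
    have e1 : f ξ = s⁻¹ * M - (s⁻¹) ^ 2 * Q / 2 := by
      rw [hf, hM, hQ]
      simp only
      rw [Finset.sum_sub_distrib, Finset.mul_sum, Finset.mul_sum, Finset.sum_div]
      congr 1 <;> exact Finset.sum_congr rfl fun i _ => by ring
    have e2 : g ξ = -(s⁻¹ * M) - (s⁻¹) ^ 2 * Q / 2 := by
      rw [hg, hM, hQ]
      simp only
      rw [Finset.sum_sub_distrib, Finset.mul_sum, Finset.mul_sum, Finset.sum_div,
        ← Finset.sum_neg_distrib]
      congr 1 <;> exact Finset.sum_congr rfl fun i _ => by ring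
    have hq : (s⁻¹) ^ 2 * Q / 2 ≤ 1 / 2 := by
      have : (s⁻¹) ^ 2 * Q ≤ (s⁻¹) ^ 2 * s ^ 2 :=
        mul_le_mul_of_nonneg_left (hss ▸ hav ξ) (sq_nonneg _)
      have h3 : (s⁻¹) ^ 2 * s ^ 2 = 1 := by field_simp
      linarith
    set u := s⁻¹ * M with hu
    have hMu : M ^ 2 = v * u ^ 2 := by rw [hu, ← hss]; field_simp
    have h5 : ∀ w : ℝ, 0 ≤ w → w ^ 2 ≤ 4 * Real.exp (w - 1 / 2) := by
      intro w hw
      have h6 := Real.quadratic_le_exp_of_nonneg hw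
      have h7 : Real.exp w = Real.exp (w - 1 / 2) * Real.exp (1 / 2) := by
        rw [← Real.exp_add]; congr 1; ring
      have h8 : Real.exp (1 / 2 : ℝ) ≤ 2 := by
        have := Real.exp_one_lt_d9
        have h9 : Real.exp 1 = Real.exp (1 / 2 : ℝ) ^ 2 := by
          rw [← Real.exp_nat_mul]; norm_num
        nlinarith [Real.exp_nonneg (1 / 2 : ℝ)]
      nlinarith [Real.exp_nonneg (w - 1 / 2)]
    rw [hMu]
    have h6 : u ^ 2 ≤ 4 * (Real.exp (f ξ) + Real.exp (g ξ)) := by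
      rcases le_total 0 u with h | h
      · have := h5 u h
        have h7 : Real.exp (u - 1 / 2) ≤ Real.exp (f ξ) := Real.exp_le_exp.2 (by linarith)
        have := Real.exp_nonneg (g ξ)
        linarith
      · have := h5 (-u) (by linarith)
        have h7 : Real.exp (-u - 1 / 2) ≤ Real.exp (g ξ) := Real.exp_le_exp.2 (by linarith)
        have := Real.exp_nonneg (f ξ)
        nlinarith
    nlinarith
  calc _ ≤ ∫⁻ ξ, ENNReal.ofReal (4 * v) *
        (ENNReal.ofReal (Real.exp (f ξ)) + ENNReal.ofReal (Real.exp (g ξ))) ∂noiseLaw := by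
        refine lintegral_mono fun ξ => ?_
        simp only
        rw [← ENNReal.ofReal_add (Real.exp_nonneg _) (Real.exp_nonneg _),
          ← ENNReal.ofReal_mul (by positivity)]
        exact ENNReal.ofReal_le_ofReal (hpt ξ)
    _ = ENNReal.ofReal (4 * v) * (1 + 1) := by
        rw [lintegral_const_mul' _ _ ENNReal.ofReal_ne_top,
          lintegral_add_left (by fun_prop)]
        rw [h1, h2]
    _ = ENNReal.ofReal (8 * v) := by
        rw [one_add_one_eq_two, mul_comm, ← ENNReal.ofReal_ofNat 2,
          ← ENNReal.ofReal_mul (by norm_num)]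
        congr 1; ring

/-- Chebyshev's inequality for weighted sums of centred squares. -/
theorem exists_measure_sum_sq_sub_one_ge_le : ∃ κ : ℝ, 0 < κ ∧
    ∀ (s : Finset ℕ) (v : ℕ → ℝ), (∀ i ∈ s, |v i| ≤ 1) → ∀ x : ℝ, 0 < x →
      noiseLaw {ξ | x ≤ |∑ i ∈ s, v i * (ξ i ^ 2 - 1)|} ≤
        ENNReal.ofReal (κ * s.card / x ^ 2) := by
  have hL4 : MemLp (fun x : ℝ => x) 4 (gaussianReal 0 1) :=
    memLp_id_gaussianReal' 4 (by norm_num)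
  have hL2 : MemLp (fun x : ℝ => x ^ 2 - 1) 2 (gaussianReal 0 1) := by
    have h : MemLp (fun x : ℝ => x ^ 2) 2 (gaussianReal 0 1) := by
      have := hL4.mul' (r := 2) hL4 (hpqr := ⟨by
        rw [← two_mul, show (4 : ENNReal) = 2 * 2 by norm_num,
          ENNReal.mul_inv (by simp) (by simp), ← mul_assoc,
          ENNReal.mul_inv_cancel (by simp) (by simp), one_mul]⟩)
      simpa [sq] using this
    exact h.sub (memLp_const 1)
  have hmean : ∫ x : ℝ, (x ^ 2 - 1) ∂(gaussianReal 0 1) = 0 := by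
    have hv := variance_fun_id_gaussianReal (μ := 0) (v := 1)
    have h2 : MemLp (fun x : ℝ => x) 2 (gaussianReal 0 1) :=
      memLp_id_gaussianReal' 2 (by norm_num)
    rw [variance_eq_integral (by fun_prop)] at hv
    have hi := integral_id_gaussianReal (μ := 0) (v := 1)
    rw [hi] at hv
    rw [integral_sub (by simpa using h2.integrable_sq) (integrable_const _)]
    have hv' : ∫ x : ℝ, x ^ 2 ∂(gaussianReal 0 1) = 1 := by simpa using hv
    simp [hv']
  set c : ℝ := Var[fun x : ℝ => x ^ 2 - 1; gaussianReal 0 1] with hc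
  have hc0 : 0 ≤ c := variance_nonneg _ _
  -- Adding 1 makes the constant positive without computing the variance of a squared Gaussian.
  refine ⟨c + 1, by linarith, fun s v hv x hx => ?_⟩
  have hmp : ∀ i : ℕ, MeasurePreserving (fun ξ : ℕ → ℝ => ξ i) noiseLaw (gaussianReal 0 1) :=
    fun i => ⟨measurable_pi_apply i, map_eval_noiseLaw i⟩
  have hX2 : ∀ i, MemLp (fun ξ : ℕ → ℝ => v i * (ξ i ^ 2 - 1)) 2 noiseLaw := fun i =>
    (hL2.comp_measurePreserving (hmp i)).const_mul (v i)
  have hXm : ∀ i, ∫ ξ : ℕ → ℝ, v i * (ξ i ^ 2 - 1) ∂noiseLaw = 0 := by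
    intro i
    rw [integral_const_mul]
    have := integral_map (μ := noiseLaw) (φ := fun ξ : ℕ → ℝ => ξ i)
      (measurable_pi_apply i).aemeasurable (f := fun x : ℝ => x ^ 2 - 1)
      (by fun_prop)
    rw [map_eval_noiseLaw, hmean] at this
    rw [← this, mul_zero]
  have hXv : ∀ i ∈ s, Var[fun ξ : ℕ → ℝ => v i * (ξ i ^ 2 - 1); noiseLaw] ≤ c := by
    intro i hi
    rw [variance_const_mul]
    have : Var[fun ξ : ℕ → ℝ => ξ i ^ 2 - 1; noiseLaw] = c := by
      have hm : AEMeasurable (fun x : ℝ => x ^ 2 - 1) (noiseLaw.map fun ξ : ℕ → ℝ => ξ i) := by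
        fun_prop
      rw [hc, ← map_eval_noiseLaw i, variance_map hm (measurable_pi_apply i).aemeasurable]
      rfl
    rw [this]
    have h1 : v i ^ 2 ≤ 1 := by rw [sq_le_one_iff_abs_le_one]; exact hv i hi
    nlinarith
  have hvar : Var[∑ i ∈ s, fun ξ : ℕ → ℝ => v i * (ξ i ^ 2 - 1); noiseLaw] ≤ c * s.card := by
    rw [IndepFun.variance_sum (fun i _ => hX2 i)]
    · calc _ ≤ ∑ i ∈ s, c := Finset.sum_le_sum hXv
        _ = c * s.card := by rw [Finset.sum_const, nsmul_eq_mul, mul_comm]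
    · intro i _ j _ hij
      exact (iIndepFun_noiseLaw.indepFun hij).comp (φ := fun x => v i * (x ^ 2 - 1))
        (ψ := fun x => v j * (x ^ 2 - 1)) (by fun_prop) (by fun_prop)
  have hsumL2 : MemLp (∑ i ∈ s, fun ξ : ℕ → ℝ => v i * (ξ i ^ 2 - 1)) 2 noiseLaw :=
    memLp_finsetSum' _ fun i _ => hX2 i
  have hmean0 : ∫ ξ, (∑ i ∈ s, fun ξ : ℕ → ℝ => v i * (ξ i ^ 2 - 1)) ξ ∂noiseLaw = 0 := by
    simp only [Finset.sum_apply]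
    rw [integral_finsetSum _ fun i _ => (hX2 i).integrable (by norm_num)]
    exact Finset.sum_eq_zero fun i _ => hXm i
  have key := meas_ge_le_variance_div_sq hsumL2 hx
  rw [hmean0] at key
  simp only [Finset.sum_apply, sub_zero] at key
  refine key.trans (ENNReal.ofReal_le_ofReal ?_)
  gcongr
  refine hvar.trans ?_
  gcongr
  linarith

/-! ### Change of measure -/

/-- The path driven by the noise `ξ`, shifted so that `y_{k+1}` has index `k`. -/
def shiftedPath (n : ℕ) (S : ℝ → ℝ) (y₀ : ℝ) (ξ : ℕ → ℝ) : ℕ → ℝ :=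
  fun k => arPath n S y₀ ξ (k + 1)

lemma arPath_succ (n : ℕ) (S : ℝ → ℝ) (y₀ : ℝ) (ξ : ℕ → ℝ) (k : ℕ) :
    arPath n S y₀ ξ (k + 1) = S (((k + 1 : ℕ) : ℝ) / n) * arPath n S y₀ ξ k + ξ k := rfl

lemma measurable_arPath (n : ℕ) (S : ℝ → ℝ) (y₀ : ℝ) (k : ℕ) :
    Measurable fun ξ : ℕ → ℝ => arPath n S y₀ ξ k := by
  induction k with
  | zero => exact measurable_const
  | succ k ih => exact (ih.const_mul _).add (measurable_pi_apply k)

lemma dependsOn_arPath (n : ℕ) (S : ℝ → ℝ) (y₀ : ℝ) (k : ℕ) :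
    DependsOn (fun ξ : ℕ → ℝ => arPath n S y₀ ξ k) (Set.Iio k) := by
  induction k with
  | zero => intro ξ η _; rfl
  | succ k ih =>
    intro ξ η h
    have h1 : arPath n S y₀ ξ k = arPath n S y₀ η k :=
      ih fun i hi => h i (lt_trans hi (Nat.lt_succ_self k))
    simp only [arPath_succ, h1, h k (Set.mem_Iio.2 (Nat.lt_succ_self k))]

/-- The logarithm of the likelihood ratio of the autoregression with respect to pure noise. -/
def logLik (n : ℕ) (S : ℝ → ℝ) (y₀ : ℝ) (ξ : ℕ → ℝ) (m : ℕ) : ℝ :=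
  ∑ k ∈ Finset.range m, (S (((k + 1 : ℕ) : ℝ) / n) * arPath n S y₀ ξ k * ξ k +
    (S (((k + 1 : ℕ) : ℝ) / n) * arPath n S y₀ ξ k) ^ 2 / 2)

lemma measurable_logLik (n : ℕ) (S : ℝ → ℝ) (y₀ : ℝ) (m : ℕ) :
    Measurable fun ξ : ℕ → ℝ => logLik n S y₀ ξ m := by
  unfold logLik
  refine Finset.measurable_sum _ fun k _ => ?_
  have := measurable_arPath n S y₀ k
  fun_prop

lemma dependsOn_logLik (n : ℕ) (S : ℝ → ℝ) (y₀ : ℝ) (m : ℕ) :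
    DependsOn (fun ξ : ℕ → ℝ => logLik n S y₀ ξ m) (Set.Iio m) := by
  intro ξ η h
  refine Finset.sum_congr rfl fun k hk => ?_
  have hk' := Finset.mem_range.1 hk
  have h1 : arPath n S y₀ ξ k = arPath n S y₀ η k :=
    dependsOn_arPath n S y₀ k fun i hi => h i (lt_trans hi hk')
  rw [h1, h k hk']

/-- Change of measure between pure noise and the autoregression. -/
theorem lintegral_noiseLaw_eq_shiftedPath (n : ℕ) (S : ℝ → ℝ) (y₀ : ℝ) (m : ℕ)
    (F : (ℕ → ℝ) → ENNReal) (hF : Measurable F) (hdep : DependsOn F (Set.Iio m)) :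
    ∫⁻ ξ, F ξ ∂noiseLaw = ∫⁻ ξ, F (shiftedPath n S y₀ ξ) *
      ENNReal.ofReal (Real.exp (-logLik n S y₀ ξ m)) ∂noiseLaw := by
  have hshift : Measurable fun ξ : ℕ → ℝ => shiftedPath n S y₀ ξ :=
    measurable_pi_lambda _ fun k => measurable_arPath n S y₀ (k + 1)
  induction m generalizing F with
  | zero =>
    refine lintegral_congr fun ξ => ?_
    rw [show F ξ = F (shiftedPath n S y₀ ξ) from hdep fun i hi => by simp at hi]
    simp [logLik]
  | succ m ih =>
    have hupd : Measurable fun p : (ℕ → ℝ) × ℝ => Function.update p.1 m p.2 := by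
      refine measurable_pi_lambda _ fun i => ?_
      by_cases hi : i = m
      · subst hi; simpa using measurable_snd
      · simp only [Function.update_of_ne hi]; fun_prop
    have hFu : Measurable fun p : (ℕ → ℝ) × ℝ => F (Function.update p.1 m p.2) := hF.comp hupd
    -- Averaging out coordinate `m` leaves a functional of the first `m` coordinates, to which the
    -- induction hypothesis applies.
    set G : (ℕ → ℝ) → ENNReal := fun ξ =>
      ∫⁻ x, F (Function.update ξ m x) ∂(gaussianReal 0 1) with hG
    have hGm : Measurable G := hFu.lintegral_prod_right'
    have hdepu : ∀ x, DependsOn (fun ξ => F (Function.update ξ m x)) (Set.Iio m) := by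
      intro x ξ η h
      refine hdep fun i hi => ?_
      by_cases him : i = m
      · subst him; simp
      · have : i < m := lt_of_le_of_ne (Nat.lt_succ_iff.1 hi) him
        simp [Function.update_of_ne him, h i this]
    have hGdep : DependsOn G (Set.Iio m) := fun ξ η h =>
      lintegral_congr fun x => hdepu x h
    have e1 : ∫⁻ ξ, F ξ ∂noiseLaw = ∫⁻ ξ, G ξ ∂noiseLaw := by
      rw [hG, ← lintegral_noiseLaw_coord m (fun ξ x => F (Function.update ξ m x)) hFu hdepu]
      refine lintegral_congr fun ξ => ?_
      rw [Function.update_eq_self]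
    rw [e1, ih G hGm hGdep]
    set a : (ℕ → ℝ) → ℝ := fun ξ => S (((m + 1 : ℕ) : ℝ) / n) * arPath n S y₀ ξ m with ha
    have ham : Measurable a := (measurable_arPath n S y₀ m).const_mul _
    have hadep : DependsOn a (Set.Iio m) := fun ξ η h => by
      simp only [ha, dependsOn_arPath n S y₀ m h]
    have hlm := measurable_logLik n S y₀ m
    have e2 : ∀ ξ : ℕ → ℝ, F (shiftedPath n S y₀ ξ) =
        F (Function.update (shiftedPath n S y₀ ξ) m (a ξ + ξ m)) := by
      intro ξ
      congr 1
      exact (Function.update_eq_self m (shiftedPath n S y₀ ξ)).symm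
    -- The innovation is translated by the predictable drift `a ξ`, which turns it into the next
    -- observation. The Gaussian density factor is the new term of `logLik`; its quadratic part has
    -- sign + because the expression is written in the noise ξ and not in the observation.
    have key := lintegral_noiseLaw_coord m (fun ξ x =>
      F (Function.update (shiftedPath n S y₀ ξ) m (a ξ + x)) *
        ENNReal.ofReal (Real.exp (-(a ξ * x + a ξ ^ 2 / 2))) *
        ENNReal.ofReal (Real.exp (-logLik n S y₀ ξ m)))
      (by
        have h1 : Measurable fun p : (ℕ → ℝ) × ℝ =>
            F (Function.update (shiftedPath n S y₀ p.1) m (a p.1 + p.2)) :=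
          hFu.comp ((hshift.comp measurable_fst).prodMk
            ((ham.comp measurable_fst).add measurable_snd))
        have h2 : Measurable fun p : (ℕ → ℝ) × ℝ => a p.1 := ham.comp measurable_fst
        have h3 : Measurable fun p : (ℕ → ℝ) × ℝ => logLik n S y₀ p.1 m :=
          hlm.comp measurable_fst
        unfold Function.uncurry
        fun_prop)
      (by
        intro x ξ η h
        have h1 := dependsOn_logLik n S y₀ m h
        have h2 := hadep h
        have h3 : F (Function.update (shiftedPath n S y₀ ξ) m (a η + x)) =
            F (Function.update (shiftedPath n S y₀ η) m (a η + x)) := by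
          refine hdepu _ fun i hi => ?_
          exact dependsOn_arPath n S y₀ (i + 1) fun j hj =>
            h j (lt_of_lt_of_le hj (Nat.succ_le_iff.2 hi))
        simp only at h1
        simp only [h1, h2, h3])
    calc ∫⁻ ξ, G (shiftedPath n S y₀ ξ) *
          ENNReal.ofReal (Real.exp (-logLik n S y₀ ξ m)) ∂noiseLaw
        = ∫⁻ ξ, ∫⁻ x, F (Function.update (shiftedPath n S y₀ ξ) m (a ξ + x)) *
        ENNReal.ofReal (Real.exp (-(a ξ * x + a ξ ^ 2 / 2))) *
        ENNReal.ofReal (Real.exp (-logLik n S y₀ ξ m)) ∂(gaussianReal 0 1) ∂noiseLaw := by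
          refine lintegral_congr fun ξ => ?_
          have hfx : Measurable fun x => F (Function.update (shiftedPath n S y₀ ξ) m x) :=
            hFu.comp (measurable_const.prodMk measurable_id)
          have hfx' : Measurable fun x =>
              F (Function.update (shiftedPath n S y₀ ξ) m (a ξ + x)) :=
            hfx.comp (measurable_const.add measurable_id)
          rw [lintegral_mul_const _ (by fun_prop)]
          congr 1
          exact lintegral_gaussianReal_shift _ hfx (a ξ)
      _ = _ := key.symm
      _ = _ := by
          refine lintegral_congr fun ξ => ?_
          rw [e2 ξ, mul_assoc, ← ENNReal.ofReal_mul (Real.exp_nonneg _), ← Real.exp_add]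
          congr 3
          simp only [logLik, Finset.sum_range_succ, ha]
          ring

/-! ### Measurability of the estimators -/

/-- A countable index makes (ω, k) ↦ f k ω jointly measurable. This serves both the stopping time
and the selected grid index. -/
lemma measurable_eval_random_index {Ω : Type*} [MeasurableSpace Ω] {f : ℕ → Ω → ℝ} {T : Ω → ℕ}
    (hf : ∀ k, Measurable (f k)) (hT : Measurable T) : Measurable fun ω => f (T ω) ω :=
  (measurable_from_prod_countable_left (f := fun p : Ω × ℕ => f p.2 p.1) hf).comp
    (measurable_id.prodMk hT)

lemma measurable_sumA (n : ℕ) (z₀ h : ℝ) (k m : ℕ) :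
    Measurable fun y : ℕ → ℝ => sumA n z₀ h y k m := by
  unfold sumA
  fun_prop

lemma measurable_pilotProj (n : ℕ) (z₀ ε h α : ℝ) :
    Measurable fun y : ℕ → ℝ => pilotProj n z₀ ε h α y := by
  have := measurable_sumA n z₀ h 0 (nu n z₀ h α)
  unfold pilotProj pilot
  fun_prop

lemma measurable_thresholdH (n : ℕ) (z₀ ε h α : ℝ) :
    Measurable fun y : ℕ → ℝ => thresholdH n z₀ ε h α y := by
  have := measurable_pilotProj n z₀ ε h α
  unfold thresholdH
  fun_prop

lemma measurableSet_thresholdH_le_sumA (n : ℕ) (z₀ ε h α : ℝ) (k m : ℕ) :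
    MeasurableSet {y : ℕ → ℝ | thresholdH n z₀ ε h α y ≤ sumA n z₀ h y k m} :=
  measurableSet_le (measurable_thresholdH n z₀ ε h α) (measurable_sumA n z₀ h k m)

lemma measurable_tau (n : ℕ) (z₀ ε h α : ℝ) :
    Measurable fun y : ℕ → ℝ => tau n z₀ ε h α y := by
  classical
  let P : (ℕ → ℝ) → ℕ → Prop := fun y k => nu n z₀ h α + 1 ≤ k ∧ k ≤ n ∧
      thresholdH n z₀ ε h α y ≤ sumA n z₀ h y (nu n z₀ h α) k
  have hP : ∀ k, MeasurableSet {y | P y k} := fun k =>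
    (MeasurableSet.const _).inter ((MeasurableSet.const _).inter
      (measurableSet_thresholdH_le_sumA n z₀ ε h α _ k))
  have hE : MeasurableSet {y | ∃ k, P y k} := by
    have : {y | ∃ k, P y k} = ⋃ k, {y | P y k} := by ext; simp
    rw [this]
    exact MeasurableSet.iUnion hP
  -- The convention inf ∅ = n becomes an extra alternative, so the stopping time is a `Nat.find`
  -- that always succeeds.
  let R : (ℕ → ℝ) → ℕ → Prop := fun y k => P y k ∨ (¬ (∃ j, P y j) ∧ k = n)
  have hR : ∀ y, ∃ k, R y k := by
    intro y
    by_cases hj : ∃ j, P y j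
    · exact hj.imp fun k hk => Or.inl hk
    · exact ⟨n, Or.inr ⟨hj, rfl⟩⟩
  have hRm : ∀ k, MeasurableSet {y | R y k} := fun k =>
    (hP k).union (hE.compl.inter (MeasurableSet.const _))
  have heq : (fun y : ℕ → ℝ => tau n z₀ ε h α y) = fun y => Nat.find (hR y) := by
    funext y
    by_cases hj : ∃ j, P y j
    · have h1 : tau n z₀ ε h α y = sInf {k | P y k} := if_pos hj
      have hne : {k | P y k}.Nonempty := hj
      rw [h1]
      refine le_antisymm (Nat.sInf_le ?_) (Nat.find_min' _ (Or.inl (Nat.sInf_mem hne)))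
      exact (Nat.find_spec (hR y)).resolve_right fun h' => h'.1 hj
    · have h1 : tau n z₀ ε h α y = n := if_neg hj
      rw [h1]
      rcases Nat.find_spec (hR y) with h2 | h2
      · exact absurd ⟨_, h2⟩ hj
      · exact h2.2.symm
  rw [heq]
  exact measurable_find hR hRm

lemma measurable_correction (n : ℕ) (z₀ ε h α : ℝ) :
    Measurable fun y : ℕ → ℝ => correction n z₀ ε h α y := by
  have hτ := measurable_tau n z₀ ε h α
  have hH := measurable_thresholdH n z₀ ε h α
  unfold correction
  have key : ∀ t : ℕ, Measurable fun y : ℕ → ℝ =>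
      (open Classical in
      if thresholdH n z₀ ε h α y ≤ sumA n z₀ h y (nu n z₀ h α) t then
        (thresholdH n z₀ ε h α y - sumA n z₀ h y (nu n z₀ h α) (t - 1)) /
          (weight n z₀ h t * y (t - 1) ^ 2)
      else 1) := by
    intro t
    have := measurable_sumA n z₀ h (nu n z₀ h α) (t - 1)
    exact Measurable.ite (measurableSet_thresholdH_le_sumA n z₀ ε h α _ t) (by fun_prop)
      measurable_const
  exact measurable_eval_random_index key hτ

lemma measurable_seqEst (n : ℕ) (z₀ ε h α : ℝ) :
    Measurable fun y : ℕ → ℝ => seqEst n z₀ ε h α y := by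
  have hτ := measurable_tau n z₀ ε h α
  have hH := measurable_thresholdH n z₀ ε h α
  have hκ := measurable_correction n z₀ ε h α
  unfold seqEst
  refine Measurable.ite (measurableSet_thresholdH_le_sumA n z₀ ε h α _ n) ?_ measurable_const
  have key : ∀ t : ℕ, Measurable fun y : ℕ → ℝ =>
      (∑ j ∈ Finset.Ioc (nu n z₀ h α) (t - 1), weight n z₀ h j * y (j - 1) * y j) +
        correction n z₀ ε h α y * weight n z₀ h t * y (t - 1) * y t := by
    intro t
    fun_prop
  exact (measurable_const.div hH).mul (measurable_eval_random_index key hτ)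

lemma measurable_gridEst (n : ℕ) (z₀ ε βlow βup : ℝ) (k : ℕ) :
    Measurable fun y : ℕ → ℝ => gridEst n z₀ ε βlow βup y k :=
  measurable_seqEst _ _ _ _ _

lemma measurable_selectedIndex (n : ℕ) (z₀ ε βlow βup lam : ℝ) :
    Measurable fun y : ℕ → ℝ => selectedIndex n z₀ ε βlow βup lam y := by
  classical
  unfold selectedIndex
  refine measurable_findGreatest fun k _ => ?_
  have : ∀ j, Measurable fun y : ℕ → ℝ => gridEst n z₀ ε βlow βup y j :=
    measurable_gridEst n z₀ ε βlow βup
  have heq : {y : ℕ → ℝ | omega n z₀ ε βlow βup lam y k ≤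
      lam / rate n (gridBeta n βlow βup k)} = ⋂ j ∈ Finset.range (k + 1),
      {y : ℕ → ℝ | |gridEst n z₀ ε βlow βup y j - gridEst n z₀ ε βlow βup y k| -
        lam / rate n (gridBeta n βlow βup j) ≤ lam / rate n (gridBeta n βlow βup k)} := by
    ext y
    simp [omega, Finset.sup'_le_iff]
  rw [heq]
  refine Finset.measurableSet_biInter _ fun j _ => measurableSet_le ?_ measurable_const
  exact (((this j).sub (this k)).norm).sub_const _

lemma measurable_pathOf (n : ℕ) (y₀ : ℝ) : Measurable (pathOf n y₀) := by
  refine measurable_pi_lambda _ fun k => ?_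
  cases k with
  | zero => exact measurable_const
  | succ k =>
    by_cases hk : k < n
    · simp only [pathOf, hk, dif_pos]; fun_prop
    · simp only [pathOf, hk, dif_neg, not_false_eq_true]; fun_prop

theorem measurable_adaptiveEst (z₀ y₀ ε βlow βup lam : ℝ) (n : ℕ) :
    Measurable (adaptiveEst z₀ y₀ ε βlow βup lam n) :=
  (measurable_eval_random_index (measurable_gridEst n z₀ ε βlow βup)
    (measurable_selectedIndex n z₀ ε βlow βup lam)).comp (measurable_pathOf n y₀)

/-! ### Elementary properties of the rates -/

lemma card_le_of_mem_Icc (s : Finset ℕ) (a b : ℝ) (hab : a ≤ b)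
    (hs : ∀ k ∈ s, a ≤ (k : ℝ) ∧ (k : ℝ) ≤ b) : (s.card : ℝ) ≤ b - a + 1 := by
  rcases s.eq_empty_or_nonempty with rfl | hne
  · simp; linarith
  have hmin := hs _ (s.min'_mem hne)
  have hmax := hs _ (s.max'_mem hne)
  have hsub : s ⊆ Finset.Icc (s.min' hne) (s.max' hne) := fun k hk =>
    Finset.mem_Icc.2 ⟨s.min'_le k hk, s.le_max' k hk⟩
  have h1 := Finset.card_le_card hsub
  rw [Nat.card_Icc] at h1
  have h2 : s.min' hne ≤ s.max' hne := s.min'_le _ (s.max'_mem hne)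
  have h3 : s.card + s.min' hne ≤ s.max' hne + 1 := by omega
  have h4 : (s.card : ℝ) + (s.min' hne : ℝ) ≤ (s.max' hne : ℝ) + 1 := by exact_mod_cast h3
  linarith [hmin.1, hmax.2]

lemma tendsto_dn : Tendsto dn atTop atTop := by
  have h1 : Tendsto (fun x : ℝ => x / Real.log x) atTop atTop := by
    have h2 : Tendsto (fun x : ℝ => Real.log x / x) atTop (nhds 0) :=
      Real.isLittleO_log_id_atTop.tendsto_div_nhds_zero
    have h3 : Tendsto (fun x : ℝ => Real.log x / x) atTop (nhdsWithin 0 (Set.Ioi 0)) := by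
      refine tendsto_nhdsWithin_iff.2 ⟨h2, ?_⟩
      filter_upwards [eventually_gt_atTop 1] with x hx
      exact div_pos (Real.log_pos hx) (by linarith)
    refine h3.inv_tendsto_nhdsGT_zero.congr fun x => ?_
    simp
  exact h1.comp tendsto_natCast_atTop_atTop

lemma tendsto_log_natCast : Tendsto (fun n : ℕ => Real.log n) atTop atTop :=
  Real.tendsto_log_atTop.comp tendsto_natCast_atTop_atTop

/-- From ln n ≤ 2√n one gets ln ln n ≤ ln 2 + (ln n)/2, so ln d_n keeps nearly half of ln n. This
lets negative powers of d_n absorb powers of ln n, and measures energies of order ln n on the scale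
ln d_n. -/
lemma eventually_log_le_log_dn : ∀ᶠ n : ℕ in atTop, Real.log n ≤ 3 * Real.log (dn n) := by
  filter_upwards [tendsto_log_natCast.eventually_ge_atTop (6 * Real.log 2 + 1),
    eventually_gt_atTop 1] with n hn hn1
  have hn0 : (0 : ℝ) < n := by positivity
  have hl2 : 0 < Real.log 2 := Real.log_pos (by norm_num)
  have hl : 0 < Real.log n := by linarith
  have h1 : Real.log n ≤ (n : ℝ) ^ (1 / 2 : ℝ) / (1 / 2) :=
    Real.log_le_rpow_div hn0.le (by norm_num)
  have h2 : Real.log (Real.log n) ≤ Real.log 2 + 1 / 2 * Real.log n := by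
    rw [← Real.log_rpow hn0, ← Real.log_mul (by norm_num) (by positivity)]
    refine Real.log_le_log hl ?_
    linarith
  rw [dn, Real.log_div hn0.ne' hl.ne']
  linarith

section Rates

variable {n : ℕ} {β : ℝ}

lemma bandwidth_pos (hd : 0 < dn n) : 0 < bandwidth n β := by
  unfold bandwidth; positivity

lemma bandwidth_le_one (hd : 1 ≤ dn n) (hβ : 0 < β) : bandwidth n β ≤ 1 := by
  unfold bandwidth
  refine Real.rpow_le_one (by positivity) ?_ (by positivity)
  rw [div_le_one (by linarith)]
  exact hd

lemma rate_pos (hd : 0 < dn n) : 0 < rate n β := by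
  unfold rate; positivity

lemma bandwidth_rpow (hd : 0 < dn n) (p : ℝ) :
    bandwidth n β ^ p = dn n ^ (-(p / (2 * β + 1))) := by
  unfold bandwidth
  rw [one_div, Real.inv_rpow hd.le, ← Real.rpow_neg hd.le, ← Real.rpow_mul hd.le]
  congr 1
  ring

lemma rate_eq (hd : 0 < dn n) : rate n β = (bandwidth n β ^ β)⁻¹ := by
  rw [bandwidth_rpow hd, Real.rpow_neg hd.le, inv_inv, rate]

lemma mul_bandwidth_rpow (hd : 0 < dn n) (hn : 1 < n) (hβ : 0 < β) :
    n * bandwidth n β ^ (2 * β + 1) = Real.log n := by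
  rw [bandwidth_rpow hd, div_self (by linarith), Real.rpow_neg_one, dn, inv_div]
  have : (n : ℝ) ≠ 0 := by positivity
  field_simp

/-- The bandwidth balances bias against variance with a logarithmic surplus: the variance proxy
1/(nh) is N(β)⁻² / ln n, so deviations of order 1/N(β) are polynomially rare in n. -/
lemma mul_bandwidth_eq (hd : 0 < dn n) (hn : 1 < n) (hβ : 0 < β) :
    n * bandwidth n β = rate n β ^ 2 * Real.log n := by
  have hb := bandwidth_pos (n := n) (β := β) hd
  rw [← mul_bandwidth_rpow hd hn hβ, rate_eq hd, inv_pow, ← Real.rpow_natCast,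
    ← Real.rpow_mul hb.le, Real.rpow_add hb, Real.rpow_one]
  have : bandwidth n β ^ (β * ((2 : ℕ) : ℝ)) = bandwidth n β ^ (2 * β) := by
    congr 1; push_cast; ring
  rw [this]
  have : bandwidth n β ^ (2 * β) ≠ 0 := by positivity
  field_simp

lemma one_le_rate (hd : 1 ≤ dn n) (hβ : 0 < β) : 1 ≤ rate n β :=
  Real.one_le_rpow hd (by positivity)

end Rates

/-! ### The lower bound -/

/-- A smooth bump has a compactly supported C¹ derivative, which is therefore bounded and Lipschitz;
`K` dominates both constants. -/
lemma exists_smooth_bump : ∃ (V : ℝ → ℝ) (K : ℝ), 0 < K ∧ ContDiff ℝ 1 V ∧ V 0 = 1 ∧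
    (∀ x, |V x| ≤ 1) ∧ (∀ x, 1 ≤ |x| → V x = 0) ∧ (∀ x, |deriv V x| ≤ K) ∧
    ∀ x, |deriv V x - deriv V 0| ≤ K * |x| := by
  let b : ContDiffBump (0 : ℝ) := ⟨1 / 2, 1, by norm_num, by norm_num⟩
  have h2 : ContDiff ℝ 2 b := b.contDiff
  have hd : ContDiff ℝ 1 (deriv b) := by
    have := (contDiff_succ_iff_deriv (n := 1) (f := (b : ℝ → ℝ))).1 (by exact_mod_cast h2)
    exact this.2.2
  have hcs : HasCompactSupport (deriv b) := b.hasCompactSupport.deriv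
  obtain ⟨C, hC⟩ := hcs.exists_bound_of_continuous hd.continuous
  obtain ⟨K, hK⟩ := hd.lipschitzWith_of_hasCompactSupport hcs one_ne_zero
  refine ⟨b, max 1 (max C K), by positivity, b.contDiff, ?_, ?_, ?_, ?_, ?_⟩
  · exact b.one_of_mem_closedBall (by simp [b])
  · intro x; rw [abs_of_nonneg b.nonneg]; exact b.le_one
  · intro x hx
    refine b.zero_of_le_dist ?_
    simpa [b] using hx
  · intro x
    exact (hC x).trans ((le_max_left _ _).trans (le_max_right _ _))
  · intro x
    have := hK.dist_le_mul x 0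
    rw [Real.dist_eq, Real.dist_eq, sub_zero] at this
    refine this.trans (mul_le_mul_of_nonneg_right ?_ (abs_nonneg _))
    exact (le_max_right _ _).trans (le_max_right _ _)

lemma zero_mem_holderClass {z₀ ε L Lstar β : ℝ} (hε : ε ≤ 1) (hL : 0 ≤ L) (hLs : 0 ≤ Lstar) :
    (fun _ => 0 : ℝ → ℝ) ∈ holderClass z₀ ε L Lstar β := by
  refine ⟨⟨contDiffOn_const, fun x _ => by simpa using hε, fun x _ => by simpa using hL⟩,
    fun x _ _ => by simpa using hLs⟩

/-- The scaling h^β V((x - z₀)/h) leaves the Hölder quotient of the derivative at z₀ unchanged. For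
the rescaled distance t, the Lipschitz bound with t ≤ t^(β-1) handles t ≤ 1, and boundedness of V'
with 1 ≤ t^(β-1) handles t ≥ 1. -/
lemma bump_mem_holderClass {z₀ ε L Lstar β c h K : ℝ} {V : ℝ → ℝ} (hz₀ : z₀ ∈ Set.Ioo (0 : ℝ) 1)
    (hV : ContDiff ℝ 1 V) (hV1 : ∀ x, |V x| ≤ 1) (hVK : ∀ x, |deriv V x| ≤ K)
    (hVlip : ∀ x, |deriv V x - deriv V 0| ≤ K * |x|) (hβ : 1 < β) (hβ2 : β < 2)
    (hc : 0 < c) (hh : 0 < h) (hh1 : h ≤ 1) (hcε : c ≤ 1 - ε) (hcL : c * K ≤ L)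
    (hcLs : 2 * c * K ≤ Lstar) :
    (fun x => c * h ^ β * V ((x - z₀) / h)) ∈ holderClass z₀ ε L Lstar β := by
  have hK : 0 ≤ K := (abs_nonneg _).trans (hVK 0)
  have hhβ : h ^ β ≤ 1 := Real.rpow_le_one hh.le hh1 (by linarith)
  have hhβ1 : h ^ (β - 1) ≤ 1 := Real.rpow_le_one hh.le hh1 (by linarith)
  have hhs : h ^ β / h = h ^ (β - 1) := by rw [Real.rpow_sub_one hh.ne']
  have hD : ∀ x, HasDerivAt (fun x => c * h ^ β * V ((x - z₀) / h))
      (c * h ^ (β - 1) * deriv V ((x - z₀) / h)) x := by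
    intro x
    have h1 : HasDerivAt (fun x => (x - z₀) / h) (1 / h) x :=
      ((hasDerivAt_id x).sub_const z₀).div_const h
    have h2 : HasDerivAt V (deriv V ((x - z₀) / h)) ((x - z₀) / h) :=
      (hV.differentiable one_ne_zero _).hasDerivAt
    have h3 := (h2.comp x h1).const_mul (c * h ^ β)
    refine h3.congr_deriv ?_
    rw [← hhs]
    ring
  have hDW : ∀ x ∈ Set.Icc (0 : ℝ) 1,
      derivWithin (fun x => c * h ^ β * V ((x - z₀) / h)) (Set.Icc 0 1) x =
        c * h ^ (β - 1) * deriv V ((x - z₀) / h) := fun x hx =>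
    (hD x).hasDerivWithinAt.derivWithin (uniqueDiffOn_Icc zero_lt_one x hx)
  refine ⟨⟨?_, ?_, ?_⟩, ?_⟩
  · exact (contDiff_const.mul (hV.comp (by fun_prop))).contDiffOn
  · intro x _
    rw [abs_mul, abs_of_nonneg (by positivity)]
    calc c * h ^ β * |V ((x - z₀) / h)| ≤ c * 1 * 1 := by
          gcongr; exact hV1 _
      _ ≤ _ := by linarith
  · intro x hx
    rw [hDW x hx, abs_mul, abs_of_nonneg (by positivity)]
    calc c * h ^ (β - 1) * |deriv V ((x - z₀) / h)| ≤ c * 1 * K := by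
          gcongr; exact hVK _
      _ ≤ _ := by linarith
  · intro x hx hxz
    rw [hDW x hx, hDW z₀ ⟨hz₀.1.le, hz₀.2.le⟩, sub_self, zero_div, ← mul_sub, abs_mul,
      abs_of_nonneg (by positivity : 0 ≤ c * h ^ (β - 1))]
    have hxp : 0 < |x - z₀| := abs_pos.2 (sub_ne_zero.2 hxz)
    rw [div_le_iff₀ (by positivity)]
    set t := |x - z₀| / h with ht
    have ht0 : 0 < t := by positivity
    have hxt : |x - z₀| = h * t := by rw [ht]; field_simp
    have habs : |(x - z₀) / h| = t := by rw [abs_div, abs_of_pos hh]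
    have h1 : |deriv V ((x - z₀) / h) - deriv V 0| ≤ 2 * K * t ^ (β - 1) := by
      rcases le_total t 1 with h2 | h2
      · have h3 := hVlip ((x - z₀) / h)
        rw [habs] at h3
        have h4 : t ≤ t ^ (β - 1) := by
          have := Real.rpow_le_rpow_of_exponent_ge ht0 h2 (by linarith : β - 1 ≤ 1)
          rwa [Real.rpow_one] at this
        nlinarith
      · have h3 := abs_sub (deriv V ((x - z₀) / h)) (deriv V 0)
        have h4 := hVK ((x - z₀) / h)
        have h5 := hVK 0
        have h6 : 1 ≤ t ^ (β - 1) := Real.one_le_rpow h2 (by linarith)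
        nlinarith
    rw [hxt, Real.mul_rpow hh.le ht0.le]
    calc c * h ^ (β - 1) * |deriv V ((x - z₀) / h) - deriv V 0|
        ≤ c * h ^ (β - 1) * (2 * K * t ^ (β - 1)) := by gcongr
      _ = 2 * c * K * (h ^ (β - 1) * t ^ (β - 1)) := by ring
      _ ≤ _ := by gcongr

/-! ### Likelihood ratios and the two-point argument. -/

lemma lintegral_sq_gaussianReal : ∫⁻ x, ENNReal.ofReal (x ^ 2) ∂(gaussianReal 0 1) = 1 := by
  have h2 : MemLp (fun x : ℝ => x) 2 (gaussianReal 0 1) :=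
    memLp_id_gaussianReal' 2 (by norm_num)
  have hv := variance_fun_id_gaussianReal (μ := 0) (v := 1)
  rw [variance_eq_integral (by fun_prop), integral_id_gaussianReal (μ := 0) (v := 1)] at hv
  have hv' : ∫ x : ℝ, x ^ 2 ∂(gaussianReal 0 1) = 1 := by simpa using hv
  rw [← ofReal_integral_eq_lintegral_ofReal (by simpa using h2.integrable_sq)
    (Eventually.of_forall fun x => sq_nonneg x), hv', ENNReal.ofReal_one]

/-- The bound (sy + ξ)² ≤ y²/2 + 2ξ² contracts the second moment towards 4, so y₀² + 4 is preserved
by the recursion, without using independence. -/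
lemma lintegral_arPath_sq_le {n : ℕ} {S : ℝ → ℝ} (hS : ∀ x, |S x| ≤ 1 / 2) (y₀ : ℝ) (k : ℕ) :
    ∫⁻ ξ, ENNReal.ofReal (arPath n S y₀ ξ k ^ 2) ∂noiseLaw ≤ ENNReal.ofReal (y₀ ^ 2 + 4) := by
  induction k with
  | zero =>
    simp only [arPath, lintegral_const, measure_univ, mul_one]
    exact ENNReal.ofReal_le_ofReal (by linarith)
  | succ k ih =>
    have hm := measurable_arPath n S y₀ k
    calc _ ≤ ∫⁻ ξ : ℕ → ℝ, (ENNReal.ofReal (1 / 2) * ENNReal.ofReal (arPath n S y₀ ξ k ^ 2) +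
          ENNReal.ofReal 2 * ENNReal.ofReal (ξ k ^ 2)) ∂noiseLaw := by
          refine lintegral_mono fun ξ => ?_
          simp only
          rw [← ENNReal.ofReal_mul (by norm_num), ← ENNReal.ofReal_mul (by norm_num),
            ← ENNReal.ofReal_add (by positivity) (by positivity), arPath_succ]
          refine ENNReal.ofReal_le_ofReal ?_
          set s := S (((k + 1 : ℕ) : ℝ) / n) with hs
          have h1 : s ^ 2 ≤ (1 / 2) ^ 2 := sq_le_sq.2 (by
            rw [abs_of_pos (by norm_num : (0 : ℝ) < 1 / 2)]; exact hS _)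
          set y := arPath n S y₀ ξ k
          nlinarith [sq_nonneg (s * y - ξ k), sq_nonneg y]
      _ ≤ ENNReal.ofReal (1 / 2) * ENNReal.ofReal (y₀ ^ 2 + 4) + ENNReal.ofReal 2 * 1 := by
          rw [lintegral_add_left (by fun_prop), lintegral_const_mul _ (by fun_prop),
            lintegral_const_mul _ (by fun_prop)]
          gcongr
          have := lintegral_map (μ := noiseLaw) (f := fun x : ℝ => ENNReal.ofReal (x ^ 2))
            (g := fun ξ : ℕ → ℝ => ξ k) (by fun_prop) (measurable_pi_apply k)
          rw [map_eval_noiseLaw, lintegral_sq_gaussianReal] at this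
          exact this.symm.le
      _ ≤ _ := by
          rw [mul_one, ← ENNReal.ofReal_mul (by norm_num),
            ← ENNReal.ofReal_add (by positivity) (by positivity)]
          exact ENNReal.ofReal_le_ofReal (by nlinarith [sq_nonneg y₀])

/-- The log-likelihood ratio is small with large probability when the drift has small energy. -/
lemma measure_lt_logLik_le {n : ℕ} {S : ℝ → ℝ} (hS : ∀ x, |S x| ≤ 1 / 2) (y₀ D : ℝ) (hD : 0 < D)
    (hQ : (y₀ ^ 2 + 4) * ∑ k ∈ Finset.range n, S (((k + 1 : ℕ) : ℝ) / n) ^ 2 ≤ D / 4) :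
    noiseLaw {ξ | D < logLik n S y₀ ξ n} ≤ ENNReal.ofReal (1 / 4 + Real.exp (-(D / 8))) := by
  set a : ℕ → (ℕ → ℝ) → ℝ := fun k ξ => S (((k + 1 : ℕ) : ℝ) / n) * arPath n S y₀ ξ k with ha
  have ham : ∀ k, Measurable (a k) := fun k => (measurable_arPath n S y₀ k).const_mul _
  have had : ∀ k, DependsOn (a k) (Set.Iio k) := fun k ξ η h => by
    simp only [ha, dependsOn_arPath n S y₀ k h]
  -- The level `D` is split evenly: if the quadratic sum is at most `D` its half is at most D/2, so
  -- the martingale must exceed D/2. With t = 1/2 the exponent is D/8 - D/4 = -D/8.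
  have h1 := measure_predictable_ge_le a n (fun k _ => ham k) (fun k _ => had k) (D / 2) D (1 / 2)
    (by norm_num)
  -- Markov's inequality: the quadratic sum has mean at most D/4.
  have h2 : noiseLaw {ξ | ENNReal.ofReal D ≤
      ENNReal.ofReal (∑ k ∈ Finset.range n, a k ξ ^ 2)} ≤ ENNReal.ofReal (1 / 4) := by
    have hm : Measurable fun ξ => ∑ k ∈ Finset.range n, a k ξ ^ 2 := by
      refine Finset.measurable_sum _ fun k _ => ?_
      have := ham k
      fun_prop
    refine (meas_ge_le_lintegral_div (μ := noiseLaw) (by fun_prop) (by simpa using hD)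
      ENNReal.ofReal_ne_top).trans ?_
    have h3 : ∫⁻ ξ, ENNReal.ofReal (∑ k ∈ Finset.range n, a k ξ ^ 2) ∂noiseLaw ≤
        ENNReal.ofReal (D / 4) := by
      calc _ = ∫⁻ ξ, ∑ k ∈ Finset.range n, ENNReal.ofReal (S (((k + 1 : ℕ) : ℝ) / n) ^ 2) *
            ENNReal.ofReal (arPath n S y₀ ξ k ^ 2) ∂noiseLaw := by
            refine lintegral_congr fun ξ => ?_
            rw [ENNReal.ofReal_sum_of_nonneg fun k _ => sq_nonneg _]
            refine Finset.sum_congr rfl fun k _ => ?_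
            rw [← ENNReal.ofReal_mul (sq_nonneg _), ha, mul_pow]
        _ = ∑ k ∈ Finset.range n, ENNReal.ofReal (S (((k + 1 : ℕ) : ℝ) / n) ^ 2) *
            ∫⁻ ξ, ENNReal.ofReal (arPath n S y₀ ξ k ^ 2) ∂noiseLaw := by
            rw [lintegral_finsetSum]
            · refine Finset.sum_congr rfl fun k _ => lintegral_const_mul _ ?_
              have := measurable_arPath n S y₀ k
              fun_prop
            · intro k _
              have := measurable_arPath n S y₀ k
              fun_prop
        _ ≤ ∑ k ∈ Finset.range n, ENNReal.ofReal (S (((k + 1 : ℕ) : ℝ) / n) ^ 2) *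
            ENNReal.ofReal (y₀ ^ 2 + 4) := by
            gcongr; exact lintegral_arPath_sq_le hS y₀ _
        _ = ENNReal.ofReal ((y₀ ^ 2 + 4) *
              ∑ k ∈ Finset.range n, S (((k + 1 : ℕ) : ℝ) / n) ^ 2) := by
            rw [← Finset.sum_mul, ← ENNReal.ofReal_sum_of_nonneg fun k _ => sq_nonneg _,
              ← ENNReal.ofReal_mul (Finset.sum_nonneg fun k _ => sq_nonneg _), mul_comm]
        _ ≤ _ := ENNReal.ofReal_le_ofReal hQ
    refine (ENNReal.div_le_div_right h3 _).trans ?_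
    rw [← ENNReal.ofReal_div_of_pos hD]
    refine ENNReal.ofReal_le_ofReal (le_of_eq ?_)
    field_simp
  have hsub : {ξ | D < logLik n S y₀ ξ n} ⊆
      {ξ | ENNReal.ofReal D ≤ ENNReal.ofReal (∑ k ∈ Finset.range n, a k ξ ^ 2)} ∪
      {ξ | D / 2 ≤ ∑ i ∈ Finset.range n, a i ξ * ξ i ∧
        ∑ i ∈ Finset.range n, a i ξ ^ 2 ≤ D} := by
    intro ξ hξ
    have hξ' : D < logLik n S y₀ ξ n := hξ
    have e : logLik n S y₀ ξ n = ∑ i ∈ Finset.range n, a i ξ * ξ i +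
        (∑ i ∈ Finset.range n, a i ξ ^ 2) / 2 := by
      rw [logLik, Finset.sum_add_distrib, Finset.sum_div]
    rcases le_total D (∑ k ∈ Finset.range n, a k ξ ^ 2) with h | h
    · exact Or.inl (ENNReal.ofReal_le_ofReal h)
    · refine Or.inr ⟨?_, h⟩
      linarith
  refine (measure_mono hsub).trans ((measure_union_le _ _).trans ?_)
  rw [ENNReal.ofReal_add (by norm_num) (Real.exp_nonneg _)]
  refine add_le_add h2 (h1.trans (ENNReal.ofReal_le_ofReal (Real.exp_le_exp.2 ?_)))
  linarith

/-- Two-point lower bound for the sum of the risks at pure noise and at a drift `S`. -/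
lemma two_point_lower_bound (n : ℕ) (S : ℝ → ℝ) (y₀ θ N₀ N₁ : ℝ) (hN₀ : 0 < N₀) (hN₁ : 0 < N₁)
    (T : (Fin n → ℝ) → ℝ) (hT : Measurable T) :
    ENNReal.ofReal (N₁ * |θ|) * noiseLaw {ξ | logLik n S y₀ ξ n ≤ Real.log (N₀ / N₁)} ≤
      ENNReal.ofReal N₀ * ∫⁻ y, ENNReal.ofReal |T y - 0| ∂(obsLaw n (fun _ => 0) y₀) +
      ENNReal.ofReal N₁ * ∫⁻ y, ENNReal.ofReal |T y - θ| ∂(obsLaw n S y₀) := by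
  have hTa : ∀ c, Measurable fun y => ENNReal.ofReal |T y - c| := fun c =>
    ((hT.sub_const c).norm).ennreal_ofReal
  have hobs := measurable_observations n S y₀
  have hr : Measurable fun (ξ : ℕ → ℝ) (i : Fin n) => ξ i := by fun_prop
  have e0 : ∫⁻ y, ENNReal.ofReal |T y - 0| ∂(obsLaw n (fun _ => 0) y₀) =
      ∫⁻ ξ, ENNReal.ofReal |T (observations n S y₀ ξ) - 0| *
        ENNReal.ofReal (Real.exp (-logLik n S y₀ ξ n)) ∂noiseLaw := by
    rw [obsLaw, lintegral_map (hTa 0) (measurable_observations n _ y₀)]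
    have : ∀ ξ, observations n (fun _ => 0) y₀ ξ = fun i : Fin n => ξ i := fun ξ => by
      funext i
      simp [observations, arPath_succ]
    simp only [this]
    exact lintegral_noiseLaw_eq_shiftedPath n S y₀ n
      (fun ξ => ENNReal.ofReal |T (fun i : Fin n => ξ i) - 0|) ((hTa 0).comp hr)
      (fun ξ η h => by
        have : (fun i : Fin n => ξ i) = fun i : Fin n => η i := funext fun i => h i i.2
        simp only [this])
  rw [e0, obsLaw, lintegral_map (hTa θ) hobs]
  have hl := measurable_logLik n S y₀ n
  have hT0 : Measurable fun ξ => ENNReal.ofReal |T (observations n S y₀ ξ) - 0| :=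
    (hTa 0).comp hobs
  have hT1 : Measurable fun ξ => ENNReal.ofReal |T (observations n S y₀ ξ) - θ| :=
    (hTa θ).comp hobs
  have hA : MeasurableSet {ξ | logLik n S y₀ ξ n ≤ Real.log (N₀ / N₁)} :=
    measurableSet_le hl measurable_const
  rw [← lintegral_const_mul _ (by fun_prop), ← lintegral_const_mul _ hT1,
    ← lintegral_add_right _ (hT1.const_mul _), ← lintegral_indicator_const hA]
  refine lintegral_mono fun ξ => ?_
  by_cases hξ : ξ ∈ {ξ | logLik n S y₀ ξ n ≤ Real.log (N₀ / N₁)}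
  · rw [Set.indicator_of_mem hξ]
    have hξ' : logLik n S y₀ ξ n ≤ Real.log (N₀ / N₁) := hξ
    rw [← ENNReal.ofReal_mul (abs_nonneg _), ← ENNReal.ofReal_mul hN₀.le,
      ← ENNReal.ofReal_mul hN₁.le, ← ENNReal.ofReal_add (by positivity) (by positivity)]
    refine ENNReal.ofReal_le_ofReal ?_
    set t := T (observations n S y₀ ξ)
    have h1 : N₁ / N₀ ≤ Real.exp (-logLik n S y₀ ξ n) := by
      rw [← Real.exp_log (by positivity : 0 < N₁ / N₀)]
      refine Real.exp_le_exp.2 ?_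
      rw [← inv_div, Real.log_inv]
      linarith
    -- On this event the larger rate pays for the likelihood ratio, so both losses carry at least
    -- the weight `N₁` and the triangle inequality applies.
    have h2 : N₁ ≤ N₀ * Real.exp (-logLik n S y₀ ξ n) := by
      rw [div_le_iff₀ hN₀] at h1; linarith
    have h3 : |θ| ≤ |t - 0| + |t - θ| := by
      have := abs_sub (t - 0) (t - θ)
      simpa using this
    calc N₁ * |θ| ≤ N₁ * (|t - 0| + |t - θ|) := by gcongr
      _ = N₁ * |t - 0| + N₁ * |t - θ| := by ring
      _ ≤ N₀ * Real.exp (-logLik n S y₀ ξ n) * |t - 0| + N₁ * |t - θ| := by gcongr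
      _ = _ := by ring
  · rw [Set.indicator_of_notMem hξ]; exact zero_le

/-- At the two ends of the scale this exponent is the δ in λ_*² = 32δ. It is the likelihood budget
of the lower bound and the worst loss of rate in the upper bound. -/
lemma rate_div_rate {n : ℕ} (hd : 0 < dn n) {β₀ β₁ : ℝ} (h₀ : 0 < β₀) (h₁ : 0 < β₁) :
    rate n β₁ / rate n β₀ = dn n ^ ((β₁ - β₀) / ((2 * β₀ + 1) * (2 * β₁ + 1))) := by
  rw [rate, rate, ← Real.rpow_sub hd]
  congr 1
  field_simp
  ring

/-- No estimator improves on the rate with the logarithmic factor, uniformly over the scale. -/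
theorem lower_bound {z₀ ε βlow βup L Lstar : ℝ} (y₀ : ℝ)
    (hz₀ : z₀ ∈ Set.Ioo (0 : ℝ) 1) (hε : ε ∈ Set.Ioo (0 : ℝ) 1)
    (hβlow : 1 < βlow) (hβ : βlow < βup) (hβup : βup < 2) (hL : 0 < L) (hLs : 0 < Lstar) :
    0 < liminf (fun n : ℕ => ⨅ (T : (Fin n → ℝ) → ℝ) (_ : Measurable T),
        adaptiveRisk z₀ y₀ ε L Lstar βlow βup n T) atTop := by
  obtain ⟨V, K, hK, hV, hV0, hV1, hVs, hVK, hVlip⟩ := exists_smooth_bump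
  set δ : ℝ := (βup - βlow) / ((2 * βlow + 1) * (2 * βup + 1)) with hδ
  have hδ0 : 0 < δ :=
    div_pos (by linarith) (mul_pos (by linarith) (by linarith))
  -- The first conditions put the bump in the class and keep |S| ≤ 1/2. The last one keeps the
  -- expected energy below a quarter of δ ln d_n; its two factors 3 come from the number 3nh of
  -- design points and from ln n ≤ 3 ln d_n.
  obtain ⟨c, hc0, hc⟩ : ∃ c : ℝ, 0 < c ∧ c ≤ 1 - ε ∧ c ≤ 1 / 2 ∧ c * K ≤ L ∧
      2 * c * K ≤ Lstar ∧ (y₀ ^ 2 + 4) * (3 * c ^ 2) * 3 ≤ δ / 4 := by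
    have h1 : 0 < 1 - ε := by linarith [hε.2]
    generalize 1 - ε = e at h1 ⊢
    refine ⟨min (min (e) (1 / 2)) (min (min (L / K) (Lstar / (2 * K)))
      (δ / (36 * (y₀ ^ 2 + 4)))), by positivity, ?_, ?_, ?_, ?_, ?_⟩
    · exact (min_le_left _ _).trans (min_le_left _ _)
    · exact (min_le_left _ _).trans (min_le_right _ _)
    · rw [← le_div_iff₀ hK]
      exact (min_le_right _ _).trans ((min_le_left _ _).trans (min_le_left _ _))
    · have h2 : min (min (e) (1 / 2)) (min (min (L / K) (Lstar / (2 * K)))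
          (δ / (36 * (y₀ ^ 2 + 4)))) ≤ Lstar / (2 * K) :=
        (min_le_right _ _).trans ((min_le_left _ _).trans (min_le_right _ _))
      rw [le_div_iff₀ (by positivity)] at h2
      linarith
    · set c := min (min (e) (1 / 2)) (min (min (L / K) (Lstar / (2 * K)))
          (δ / (36 * (y₀ ^ 2 + 4))))
      have hc0 : 0 < c := by positivity
      have h2 : c ≤ δ / (36 * (y₀ ^ 2 + 4)) := (min_le_right _ _).trans (min_le_right _ _)
      have h3 : c ≤ 1 / 2 := (min_le_left _ _).trans (min_le_right _ _)
      rw [le_div_iff₀ (by positivity)] at h2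
      have h4 : c ^ 2 ≤ c := by nlinarith
      nlinarith [sq_nonneg y₀]
  obtain ⟨hcε, hc2, hcL, hcLs, hcδ⟩ := hc
  have hlogd : Tendsto (fun n : ℕ => Real.log (dn n)) atTop atTop :=
    Real.tendsto_log_atTop.comp tendsto_dn
  have hev : ∀ᶠ n : ℕ in atTop, ENNReal.ofReal (c / 4) ≤
      ⨅ (T : (Fin n → ℝ) → ℝ) (_ : Measurable T),
        adaptiveRisk z₀ y₀ ε L Lstar βlow βup n T := by
    filter_upwards [tendsto_dn.eventually_ge_atTop 1, eventually_gt_atTop 1,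
      eventually_log_le_log_dn, tendsto_log_natCast.eventually_ge_atTop 1,
      hlogd.eventually_ge_atTop (16 / δ)] with n hd1 hn1 hlog hl1 hlogd
    refine le_iInf fun T => le_iInf fun hT => ?_
    have hd : 0 < dn n := by linarith
    have hβ0 : 0 < βlow := by linarith
    set h := bandwidth n βlow with hh
    have hh0 : 0 < h := bandwidth_pos hd
    have hh1 : h ≤ 1 := bandwidth_le_one hd1 hβ0
    set S : ℝ → ℝ := fun x => c * h ^ βlow * V ((x - z₀) / h) with hS
    have hSmem : S ∈ holderClass z₀ ε L Lstar βlow :=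
      bump_mem_holderClass hz₀ hV hV1 hVK hVlip hβlow (by linarith) hc0 hh0 hh1 hcε hcL hcLs
    have hhβ : h ^ βlow ≤ 1 := Real.rpow_le_one hh0.le hh1 hβ0.le
    have hShalf : ∀ x, |S x| ≤ 1 / 2 := by
      intro x
      rw [hS, abs_mul, abs_of_nonneg (by positivity)]
      calc c * h ^ βlow * |V ((x - z₀) / h)| ≤ c * 1 * 1 := by gcongr; exact hV1 _
        _ ≤ _ := by linarith
    have hSz : S z₀ = c * h ^ βlow := by simp [hS, hV0]
    have hNl := rate_pos (n := n) (β := βlow) hd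
    have hNu := rate_pos (n := n) (β := βup) hd
    have hNS : rate n βlow * |S z₀| = c := by
      rw [hSz, abs_of_nonneg (by positivity), rate_eq hd, ← hh]
      field_simp
    have hn0 : (0 : ℝ) < n := by positivity
    have hlogN : Real.log (rate n βup / rate n βlow) = δ * Real.log (dn n) := by
      rw [rate_div_rate hd hβ0 (by linarith), Real.log_rpow hd]
    -- At most 2nh + 1 ≤ 3nh design points meet the bump, each contributing at most c²h^(2β), and nh
    -- · h^(2β) = ln n.
    have hQ : ∑ k ∈ Finset.range n, S (((k + 1 : ℕ) : ℝ) / n) ^ 2 ≤ 3 * c ^ 2 * Real.log n := by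
      set s := (Finset.range n).filter fun k => |((k + 1 : ℕ) : ℝ) / n - z₀| < h with hs
      have hcard : (s.card : ℝ) ≤ 2 * (n * h) + 1 := by
        have := card_le_of_mem_Icc s (n * z₀ - n * h - 1) (n * z₀ + n * h - 1)
          (by nlinarith) (fun k hk => by
            have h1 := (Finset.mem_filter.1 hk).2
            rw [abs_lt] at h1
            have h2 : ((k + 1 : ℕ) : ℝ) = n * (((k + 1 : ℕ) : ℝ) / n) := by field_simp
            push_cast at h1 h2
            constructor <;> nlinarith)
        linarith
      have hnh : 1 ≤ n * h := by
        rw [hh, mul_bandwidth_eq hd hn1 hβ0]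
        have := one_le_rate (n := n) (β := βlow) hd1 hβ0
        nlinarith
      have hzero : ∀ k ∈ Finset.range n, k ∉ s → S (((k + 1 : ℕ) : ℝ) / n) ^ 2 = 0 := by
        intro k hk hks
        have h1 : h ≤ |((k + 1 : ℕ) : ℝ) / n - z₀| := by
          by_contra hcon
          exact hks (Finset.mem_filter.2 ⟨hk, not_le.1 hcon⟩)
        have h2 : V ((((k + 1 : ℕ) : ℝ) / n - z₀) / h) = 0 := hVs _ (by
          rw [abs_div, abs_of_pos hh0, le_div_iff₀ hh0]; linarith)
        simp only [hS]
        rw [h2]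
        simp
      rw [← Finset.sum_subset (Finset.filter_subset _ _) hzero]
      calc ∑ k ∈ s, S (((k + 1 : ℕ) : ℝ) / n) ^ 2 ≤ ∑ k ∈ s, (c * h ^ βlow) ^ 2 := by
            refine Finset.sum_le_sum fun k _ => ?_
            simp only [hS, mul_pow (c * h ^ βlow)]
            have h1 : V ((((k + 1 : ℕ) : ℝ) / n - z₀) / h) ^ 2 ≤ 1 :=
              (sq_le_one_iff_abs_le_one _).2 (hV1 _)
            exact mul_le_of_le_one_right (sq_nonneg _) h1
        _ = s.card * (c * h ^ βlow) ^ 2 := by rw [Finset.sum_const, nsmul_eq_mul]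
        _ ≤ (3 * (n * h)) * (c * h ^ βlow) ^ 2 := by
            refine mul_le_mul_of_nonneg_right ?_ (sq_nonneg _)
            linarith
        _ = 3 * c ^ 2 * (n * h * (h ^ βlow) ^ 2) := by ring
        _ = 3 * c ^ 2 * Real.log n := by
            rw [hh, mul_bandwidth_eq hd hn1 hβ0, rate_eq hd]
            have : bandwidth n βlow ^ βlow ≠ 0 := by positivity
            field_simp
    have hD : 16 ≤ δ * Real.log (dn n) := by
      rw [div_le_iff₀ hδ0] at hlogd; linarith
    have hQ' : (y₀ ^ 2 + 4) * ∑ k ∈ Finset.range n, S (((k + 1 : ℕ) : ℝ) / n) ^ 2 ≤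
        δ * Real.log (dn n) / 4 := by
      have hld : 0 ≤ Real.log (dn n) := Real.log_nonneg hd1
      calc _ ≤ (y₀ ^ 2 + 4) * (3 * c ^ 2 * Real.log n) := by gcongr
        _ ≤ (y₀ ^ 2 + 4) * (3 * c ^ 2 * (3 * Real.log (dn n))) := by gcongr
        _ = (y₀ ^ 2 + 4) * (3 * c ^ 2) * 3 * Real.log (dn n) := by ring
        _ ≤ δ / 4 * Real.log (dn n) := by gcongr
        _ = _ := by ring
    have hbad := measure_lt_logLik_le hShalf y₀ _ (by linarith) hQ'
    have hgood : ENNReal.ofReal (1 / 2) ≤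
        noiseLaw {ξ | logLik n S y₀ ξ n ≤ Real.log (rate n βup / rate n βlow)} := by
      rw [hlogN]
      -- The requirement δ ln d_n ≥ 16 gives e⁻² ≤ 1/4, so the bad event has probability at most
      -- 1/2.
      have hexp : Real.exp (-(δ * Real.log (dn n) / 8)) ≤ 1 / 4 := by
        have h1 : Real.exp (-(δ * Real.log (dn n) / 8)) ≤ Real.exp (-2) :=
          Real.exp_le_exp.2 (by linarith)
        have h2 : Real.exp (-2) = (Real.exp 1 ^ 2)⁻¹ := by
          rw [← Real.exp_nat_mul, ← Real.exp_neg]; norm_num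
        have h3 : (2 : ℝ) ≤ Real.exp 1 := by have := Real.add_one_le_exp (1 : ℝ); linarith
        have h4 : (Real.exp 1 ^ 2)⁻¹ ≤ ((2 : ℝ) ^ 2)⁻¹ := by gcongr
        rw [h2] at h1
        have h5 : ((2 : ℝ) ^ 2)⁻¹ = 1 / 4 := by norm_num
        linarith
      have hA : MeasurableSet {ξ | logLik n S y₀ ξ n ≤ δ * Real.log (dn n)} :=
        measurableSet_le (measurable_logLik n S y₀ n) measurable_const
      have hcompl : {ξ | logLik n S y₀ ξ n ≤ δ * Real.log (dn n)}ᶜ =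
          {ξ | δ * Real.log (dn n) < logLik n S y₀ ξ n} := by
        ext ξ; simp
      have h1 := prob_add_prob_compl (μ := noiseLaw) hA
      rw [hcompl] at h1
      have h2 : noiseLaw {ξ | δ * Real.log (dn n) < logLik n S y₀ ξ n} ≤
          ENNReal.ofReal (1 / 2) := hbad.trans (ENNReal.ofReal_le_ofReal (by linarith))
      have h3 : ENNReal.ofReal (1 / 2) + ENNReal.ofReal (1 / 2) = 1 := by
        rw [← ENNReal.ofReal_add (by norm_num) (by norm_num)]; norm_num
      by_contra hcon
      rw [not_le] at hcon
      have h4 := ENNReal.add_lt_add_of_lt_of_le (ne_top_of_le_ne_top ENNReal.ofReal_ne_top h2)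
        hcon h2
      rw [h1, h3] at h4
      exact lt_irrefl _ h4
    have hmain := two_point_lower_bound n S y₀ (S z₀) (rate n βup) (rate n βlow) hNu hNl T hT
    rw [hNS] at hmain
    have hR0 : ENNReal.ofReal (rate n βup) *
        ∫⁻ y, ENNReal.ofReal |T y - 0| ∂(obsLaw n (fun _ => 0) y₀) ≤
        adaptiveRisk z₀ y₀ ε L Lstar βlow βup n T :=
      le_iSup₂_of_le βup ⟨hβ.le, le_rfl⟩ (le_iSup₂_of_le (fun _ => 0)
        (zero_mem_holderClass hε.2.le hL.le hLs.le) le_rfl)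
    have hR1 : ENNReal.ofReal (rate n βlow) *
        ∫⁻ y, ENNReal.ofReal |T y - S z₀| ∂(obsLaw n S y₀) ≤
        adaptiveRisk z₀ y₀ ε L Lstar βlow βup n T :=
      le_iSup₂_of_le βlow ⟨le_rfl, hβ.le⟩ (le_iSup₂_of_le S hSmem le_rfl)
    have h5 : ENNReal.ofReal (c / 2) ≤ 2 * adaptiveRisk z₀ y₀ ε L Lstar βlow βup n T := by
      calc ENNReal.ofReal (c / 2) = ENNReal.ofReal c * ENNReal.ofReal (1 / 2) := by
            rw [← ENNReal.ofReal_mul hc0.le]; congr 1; ring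
        _ ≤ _ := (mul_le_mul_right hgood _).trans (hmain.trans (add_le_add hR0 hR1))
        _ = _ := (two_mul _).symm
    have h6 : ENNReal.ofReal (c / 2) = 2 * ENNReal.ofReal (c / 4) := by
      rw [← ENNReal.ofReal_ofNat 2, ← ENNReal.ofReal_mul (by norm_num)]; congr 1; ring
    rw [h6] at h5
    exact (ENNReal.mul_le_mul_iff_right (by norm_num) (by norm_num)).1 h5
  exact lt_of_lt_of_le (by simpa using by positivity) (le_liminf_of_le (by isBoundedDefault) hev)

/-! ### Functions of the local Hölder class -/

section HolderClass

variable {z₀ ε L Lstar β : ℝ} {S : ℝ → ℝ}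

lemma hasDerivWithinAt_of_mem (hS : S ∈ holderClass z₀ ε L Lstar β) {x : ℝ}
    (hx : x ∈ Set.Icc (0 : ℝ) 1) :
    HasDerivWithinAt S (derivWithin S (Set.Icc 0 1) x) (Set.Icc 0 1) x :=
  (hS.1.1.differentiableOn one_ne_zero x hx).hasDerivWithinAt

lemma abs_sub_le_of_mem (hS : S ∈ holderClass z₀ ε L Lstar β) (hz₀ : z₀ ∈ Set.Icc (0 : ℝ) 1)
    {x : ℝ} (hx : x ∈ Set.Icc (0 : ℝ) 1) : |S x - S z₀| ≤ L * |x - z₀| := by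
  have := (convex_Icc (0 : ℝ) 1).norm_image_sub_le_of_norm_hasDerivWithin_le
    (fun x hx => hasDerivWithinAt_of_mem hS hx)
    (fun x hx => by rw [Real.norm_eq_abs]; exact hS.1.2.2 x hx) hz₀ hx
  simpa [Real.norm_eq_abs] using this

/-- The mean value inequality is applied to t ↦ S t - D t on the segment from z₀ to x, where the
local Hölder condition bounds the derivative by its value at the far end, Lstar |x - z₀|^(β-1). -/
lemma abs_sub_sub_le_of_mem (hS : S ∈ holderClass z₀ ε L Lstar β) (hLs : 0 ≤ Lstar) (hβ : 1 < β)
    (hz₀ : z₀ ∈ Set.Icc (0 : ℝ) 1) {x : ℝ} (hx : x ∈ Set.Icc (0 : ℝ) 1) :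
    |S x - S z₀ - derivWithin S (Set.Icc 0 1) z₀ * (x - z₀)| ≤ Lstar * |x - z₀| ^ β := by
  set D := derivWithin S (Set.Icc 0 1) z₀ with hD
  rcases eq_or_ne x z₀ with rfl | hne
  · simp [Real.zero_rpow (by linarith : β ≠ 0)]
  have hsub : Set.uIcc z₀ x ⊆ Set.Icc 0 1 := Set.uIcc_subset_Icc hz₀ hx
  have hxp : 0 < |x - z₀| := abs_pos.2 (sub_ne_zero.2 hne)
  have h1 : ∀ t ∈ Set.uIcc z₀ x, HasDerivWithinAt (fun t => S t - D * t)
      (derivWithin S (Set.Icc 0 1) t - D) (Set.uIcc z₀ x) t := by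
    intro t ht
    have h2 := (hasDerivWithinAt_of_mem hS (hsub ht)).mono hsub
    have h3 : HasDerivWithinAt (fun t => D * t) (D * 1) (Set.uIcc z₀ x) t :=
      (hasDerivWithinAt_id t _).const_mul D
    rw [mul_one] at h3
    exact h2.sub h3
  have h2 : ∀ t ∈ Set.uIcc z₀ x, ‖derivWithin S (Set.Icc 0 1) t - D‖ ≤
      Lstar * |x - z₀| ^ (β - 1) := by
    intro t ht
    rw [Real.norm_eq_abs]
    rcases eq_or_ne t z₀ with rfl | htne
    · rw [← hD, sub_self, abs_zero]; positivity
    have h3 := hS.2 t (hsub ht) htne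
    have htp : 0 < |t - z₀| := abs_pos.2 (sub_ne_zero.2 htne)
    rw [div_le_iff₀ (by positivity)] at h3
    refine h3.trans (mul_le_mul_of_nonneg_left ?_ hLs)
    exact Real.rpow_le_rpow htp.le (Set.abs_sub_left_of_mem_uIcc ht) (by linarith)
  have h3 := (convex_uIcc z₀ x).norm_image_sub_le_of_norm_hasDerivWithin_le h1 h2
    Set.left_mem_uIcc Set.right_mem_uIcc
  rw [Real.norm_eq_abs, Real.norm_eq_abs, mul_assoc, ← Real.rpow_add_one hxp.ne'] at h3
  have e : S x - S z₀ - D * (x - z₀) = S x - D * x - (S z₀ - D * z₀) := by ring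
  rw [e]
  simpa using h3

end HolderClass

/-! ### The stopped sums -/

lemma weight_nonneg (n : ℕ) (z₀ h : ℝ) (j : ℕ) : 0 ≤ weight n z₀ h j :=
  Set.indicator_nonneg (fun _ _ => zero_le_one) _

lemma weight_eq_one_or_zero (n : ℕ) (z₀ h : ℝ) (j : ℕ) :
    (weight n z₀ h j = 1 ∧ |((j : ℝ) / n - z₀) / h| ≤ 1) ∨ weight n z₀ h j = 0 := by
  by_cases hj : ((j : ℝ) / n - z₀) / h ∈ Set.Icc (-1 : ℝ) 1
  · exact Or.inl ⟨by simp [weight, kernelQ, Set.indicator_of_mem hj], abs_le.2 hj⟩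
  · exact Or.inr (by simp [weight, kernelQ, Set.indicator_of_notMem hj])

lemma sumA_mono (n : ℕ) (z₀ h : ℝ) (y : ℕ → ℝ) (k : ℕ) : Monotone (sumA n z₀ h y k) := by
  intro a b hab
  refine Finset.sum_le_sum_of_subset_of_nonneg (Finset.Ioc_subset_Ioc le_rfl hab) ?_
  intro j _ _
  exact mul_nonneg (weight_nonneg _ _ _ _) (sq_nonneg _)

lemma sumA_self (n : ℕ) (z₀ h : ℝ) (y : ℕ → ℝ) (k : ℕ) : sumA n z₀ h y k k = 0 := by
  simp [sumA]

lemma sumA_succ (n : ℕ) (z₀ h : ℝ) (y : ℕ → ℝ) {k m : ℕ} (hkm : k ≤ m) :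
    sumA n z₀ h y k (m + 1) = sumA n z₀ h y k m + weight n z₀ h (m + 1) * y m ^ 2 := by
  rw [sumA, Finset.sum_Ioc_succ_top (by omega)]
  simp [sumA]

open Classical in
/-- The weight of the `j`-th term in the sums stopped when `A_{ν,·}` reaches `H`. -/
def stopCoef (n : ℕ) (z₀ ε h α : ℝ) (y : ℕ → ℝ) (j : ℕ) : ℝ :=
  if sumA n z₀ h y (nu n z₀ h α) j < thresholdH n z₀ ε h α y then 1
  else if sumA n z₀ h y (nu n z₀ h α) (j - 1) < thresholdH n z₀ ε h α y then
    (thresholdH n z₀ ε h α y - sumA n z₀ h y (nu n z₀ h α) (j - 1)) /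
      (weight n z₀ h j * y (j - 1) ^ 2)
  else 0

section Stopped

variable {n : ℕ} {z₀ ε h α : ℝ} {y : ℕ → ℝ}

/-- The weighted terms are increments of min(A, H), so they telescope and add up to exactly `H` once
the level is reached. The division at the crossing index is legitimate because A strictly increases
there. -/
lemma stopCoef_mul {j : ℕ} (hj : nu n z₀ h α < j) :
    stopCoef n z₀ ε h α y j * (weight n z₀ h j * y (j - 1) ^ 2) =
      min (sumA n z₀ h y (nu n z₀ h α) j) (thresholdH n z₀ ε h α y) -
      min (sumA n z₀ h y (nu n z₀ h α) (j - 1)) (thresholdH n z₀ ε h α y) := by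
  obtain ⟨i, rfl⟩ : ∃ i, j = i + 1 := ⟨j - 1, by omega⟩
  have hs := sumA_succ n z₀ h y (show nu n z₀ h α ≤ i by omega)
  have hm := sumA_mono n z₀ h y (nu n z₀ h α) (Nat.le_succ i)
  simp only [Nat.add_sub_cancel]
  unfold stopCoef
  simp only [Nat.add_sub_cancel]
  split_ifs with h1 h2
  · rw [min_eq_left h1.le, min_eq_left (hm.trans h1.le), hs]
    ring
  · rw [min_eq_right (not_lt.1 h1), min_eq_left h2.le, div_mul_cancel₀]
    have := not_lt.1 h1
    intro h0
    linarith
  · rw [min_eq_right (not_lt.1 h1), min_eq_right (not_lt.1 h2)]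
    ring

lemma stopCoef_nonneg (j : ℕ) : 0 ≤ stopCoef n z₀ ε h α y j := by
  unfold stopCoef
  split_ifs with h1 h2
  · exact zero_le_one
  · exact div_nonneg (by linarith) (mul_nonneg (weight_nonneg _ _ _ _) (sq_nonneg _))
  · exact le_rfl

lemma stopCoef_le_one {j : ℕ} (hj : nu n z₀ h α < j) : stopCoef n z₀ ε h α y j ≤ 1 := by
  obtain ⟨i, rfl⟩ : ∃ i, j = i + 1 := ⟨j - 1, by omega⟩
  have hs := sumA_succ n z₀ h y (show nu n z₀ h α ≤ i by omega)
  unfold stopCoef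
  simp only [Nat.add_sub_cancel]
  split_ifs with h1 h2
  · exact le_rfl
  · rw [div_le_one (by linarith [not_lt.1 h1])]
    linarith [not_lt.1 h1]
  · exact zero_le_one

lemma sum_stopCoef_mul (hH : 0 < thresholdH n z₀ ε h α y) {m : ℕ} (hm : nu n z₀ h α ≤ m) :
    ∑ j ∈ Finset.Ioc (nu n z₀ h α) m,
      stopCoef n z₀ ε h α y j * (weight n z₀ h j * y (j - 1) ^ 2) =
      min (sumA n z₀ h y (nu n z₀ h α) m) (thresholdH n z₀ ε h α y) := by
  induction m, hm using Nat.le_induction with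
  | base => simp [sumA_self, hH.le]
  | succ m hm ih =>
    rw [Finset.sum_Ioc_succ_top (by omega), ih, stopCoef_mul (by omega)]
    simp

/-- The coefficient is 1 before τ, the correction at τ and 0 after it. The randomly stopped sum thus
becomes a sum over a deterministic range with predictable weights, and optional stopping is not
needed. -/
lemma seqEst_eq_sum_stopCoef (hH : 0 < thresholdH n z₀ ε h α y)
    (hΓ : thresholdH n z₀ ε h α y ≤ sumA n z₀ h y (nu n z₀ h α) n) :
    seqEst n z₀ ε h α y = (∑ j ∈ Finset.Ioc (nu n z₀ h α) n,
      stopCoef n z₀ ε h α y j * (weight n z₀ h j * y (j - 1) * y j)) /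
        thresholdH n z₀ ε h α y := by
  set H := thresholdH n z₀ ε h α y with hHdef
  set ν := nu n z₀ h α with hν
  set A := sumA n z₀ h y ν with hA
  have hνn : ν < n := by
    by_contra hcon
    have : A n ≤ A ν := sumA_mono n z₀ h y ν (not_lt.1 hcon)
    rw [hA, sumA_self] at this
    linarith
  have hex : ∃ k, ν + 1 ≤ k ∧ k ≤ n ∧ H ≤ A k := ⟨n, hνn, le_rfl, hΓ⟩
  have hτ : tau n z₀ ε h α y = sInf {k | ν + 1 ≤ k ∧ k ≤ n ∧ H ≤ A k} := if_pos hex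
  have hmem : tau n z₀ ε h α y ∈ {k | ν + 1 ≤ k ∧ k ≤ n ∧ H ≤ A k} := by
    rw [hτ]; exact Nat.sInf_mem hex
  have hmin : ∀ k, k < tau n z₀ ε h α y → ν ≤ k → A k < H := by
    intro k hk hνk
    rcases hνk.eq_or_lt with rfl | h1
    · rw [hA, sumA_self]; exact hH
    · by_contra hcon
      have hle : tau n z₀ ε h α y ≤ k := by
        rw [hτ]
        exact Nat.sInf_le ⟨h1, by have := hmem.2.1; omega, not_lt.1 hcon⟩
      omega
  have hcor : correction n z₀ ε h α y = stopCoef n z₀ ε h α y (tau n z₀ ε h α y) := by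
    have h2 : A (tau n z₀ ε h α y - 1) < H :=
      hmin _ (by have := hmem.1; omega) (by have := hmem.1; omega)
    have h3 : ¬ A (tau n z₀ ε h α y) < H := not_lt.2 hmem.2.2
    rw [correction, if_pos hmem.2.2, stopCoef, if_neg h3, if_pos h2]
  rw [seqEst, if_pos hΓ, hcor, one_div, inv_mul_eq_div]
  congr 1
  obtain ⟨t, ht⟩ : ∃ t, tau n z₀ ε h α y = t + 1 :=
    ⟨tau n z₀ ε h α y - 1, by have := hmem.1; omega⟩
  rw [ht] at hmem hmin ⊢
  have hνt : ν ≤ t := by have := hmem.1; omega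
  rw [← Finset.sum_Ioc_consecutive _ (hνt.trans (Nat.le_succ t)) hmem.2.1,
    Finset.sum_Ioc_succ_top hνt]
  have h1 : ∑ j ∈ Finset.Ioc (t + 1) n,
      stopCoef n z₀ ε h α y j * (weight n z₀ h j * y (j - 1) * y j) = 0 := by
    refine Finset.sum_eq_zero fun j hj => ?_
    have hj' := Finset.mem_Ioc.1 hj
    have h2 : H ≤ A (j - 1) := hmem.2.2.trans (sumA_mono n z₀ h y ν (by omega))
    have h3 : H ≤ A j := h2.trans (sumA_mono n z₀ h y ν (by omega))
    rw [stopCoef, if_neg (not_lt.2 h3), if_neg (not_lt.2 h2), zero_mul]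
  have h2 : ∑ j ∈ Finset.Ioc ν t,
      stopCoef n z₀ ε h α y j * (weight n z₀ h j * y (j - 1) * y j) =
      ∑ j ∈ Finset.Ioc ν t, weight n z₀ h j * y (j - 1) * y j := by
    refine Finset.sum_congr rfl fun j hj => ?_
    have hj' := Finset.mem_Ioc.1 hj
    rw [stopCoef, if_pos (hmin j (by omega) hj'.1.le), one_mul]
  rw [h1, h2, add_zero, Nat.add_sub_cancel]
  ring

/-! ### Bias and noise of the stopped estimator. -/

/-- The predictable coefficient of the innovation with index `i` in the estimation error. -/
def noiseCoef (n : ℕ) (z₀ ε h α : ℝ) (y : ℕ → ℝ) (i : ℕ) : ℝ :=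
  if nu n z₀ h α ≤ i then
    stopCoef n z₀ ε h α y (i + 1) * weight n z₀ h (i + 1) * y i / thresholdH n z₀ ε h α y
  else 0

lemma sum_Ioc_eq_sum_range_ite (f : ℕ → ℝ) (a b : ℕ) :
    ∑ j ∈ Finset.Ioc a b, f j = ∑ i ∈ Finset.range b, if a ≤ i then f (i + 1) else 0 := by
  induction b with
  | zero => simp
  | succ b ih =>
    rw [Finset.sum_range_succ, ← ih]
    split_ifs with hab
    · rw [Finset.sum_Ioc_succ_top hab]
    · rw [Finset.Ioc_eq_empty (by omega), Finset.Ioc_eq_empty (by omega)]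
      simp

/-- Coefficients in [0, 1] dominate their squares and kernel weights equal theirs, so the sum is at
most min(A, H)/H² ≤ 1/H, whether or not the threshold is reached. -/
lemma sum_noiseCoef_sq_le (hH : 0 < thresholdH n z₀ ε h α y) :
    ∑ i ∈ Finset.range n, noiseCoef n z₀ ε h α y i ^ 2 ≤ 1 / thresholdH n z₀ ε h α y := by
  set H := thresholdH n z₀ ε h α y with hHdef
  have e : ∑ i ∈ Finset.range n, noiseCoef n z₀ ε h α y i ^ 2 =
      ∑ j ∈ Finset.Ioc (nu n z₀ h α) n,
        (stopCoef n z₀ ε h α y j * weight n z₀ h j * y (j - 1) / H) ^ 2 := by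
    rw [sum_Ioc_eq_sum_range_ite]
    refine Finset.sum_congr rfl fun i _ => ?_
    unfold noiseCoef
    split_ifs <;> simp [hHdef]
  rw [e]
  rcases le_total n (nu n z₀ h α) with hn | hn
  · rw [Finset.Ioc_eq_empty (by omega), Finset.sum_empty]; positivity
  have h1 := sum_stopCoef_mul hH hn
  calc _ ≤ ∑ j ∈ Finset.Ioc (nu n z₀ h α) n,
        stopCoef n z₀ ε h α y j * (weight n z₀ h j * y (j - 1) ^ 2) / H ^ 2 := by
        refine Finset.sum_le_sum fun j hj => ?_
        rw [div_pow]
        refine div_le_div_of_nonneg_right ?_ (sq_nonneg _)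
        have hκ0 := stopCoef_nonneg (n := n) (z₀ := z₀) (ε := ε) (h := h) (α := α) (y := y) j
        have hκ1 := stopCoef_le_one (ε := ε) (y := y) (Finset.mem_Ioc.1 hj).1
        have hw : weight n z₀ h j ^ 2 = weight n z₀ h j := by
          rcases weight_eq_one_or_zero n z₀ h j with hw | hw
          · rw [hw.1]; norm_num
          · rw [hw]; norm_num
        rw [mul_pow, mul_pow, hw, mul_assoc]
        refine mul_le_mul_of_nonneg_right ?_
          (mul_nonneg (weight_nonneg _ _ _ _) (sq_nonneg _))
        nlinarith
    _ = min (sumA n z₀ h y (nu n z₀ h α) n) H / H ^ 2 := by rw [← Finset.sum_div, h1]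
    _ ≤ H / H ^ 2 := by gcongr; exact min_le_right _ _
    _ = 1 / H := by field_simp

/-- Decomposition of the estimation error into a bias and a noise term. -/
lemma seqEst_sub_eq (hH : 0 < thresholdH n z₀ ε h α y)
    (hΓ : thresholdH n z₀ ε h α y ≤ sumA n z₀ h y (nu n z₀ h α) n) (s ξ : ℕ → ℝ) (θ : ℝ)
    (hy : ∀ j ∈ Finset.Ioc (nu n z₀ h α) n, y j = s j * y (j - 1) + ξ (j - 1)) :
    seqEst n z₀ ε h α y - θ = (∑ j ∈ Finset.Ioc (nu n z₀ h α) n,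
      stopCoef n z₀ ε h α y j * (weight n z₀ h j * y (j - 1) ^ 2) * (s j - θ)) /
        thresholdH n z₀ ε h α y + ∑ i ∈ Finset.range n, noiseCoef n z₀ ε h α y i * ξ i := by
  have hνn : nu n z₀ h α ≤ n := by
    by_contra hcon
    have := sumA_mono n z₀ h y (nu n z₀ h α) (not_le.1 hcon).le
    rw [sumA_self] at this
    linarith
  have h1 := sum_stopCoef_mul hH hνn
  rw [min_eq_right hΓ] at h1
  have e : ∑ i ∈ Finset.range n, noiseCoef n z₀ ε h α y i * ξ i =
      (∑ j ∈ Finset.Ioc (nu n z₀ h α) n,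
        stopCoef n z₀ ε h α y j * weight n z₀ h j * y (j - 1) * ξ (j - 1)) /
        thresholdH n z₀ ε h α y := by
    rw [Finset.sum_div, sum_Ioc_eq_sum_range_ite]
    refine Finset.sum_congr rfl fun i _ => ?_
    unfold noiseCoef
    split_ifs
    · rw [Nat.add_sub_cancel]; ring
    · ring
  rw [seqEst_eq_sum_stopCoef hH hΓ, e, ← add_div, eq_div_iff hH.ne', sub_mul,
    div_mul_cancel₀ _ hH.ne', ← h1, Finset.mul_sum, ← Finset.sum_sub_distrib,
    ← Finset.sum_add_distrib]
  refine Finset.sum_congr rfl fun j hj => ?_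
  rw [hy j hj]
  ring

/-- After division by `H` the stopped weights are nonnegative with total mass one, so the expression
is an average of `b` over the window. -/
lemma abs_bias_le (hH : 0 < thresholdH n z₀ ε h α y)
    (hΓ : thresholdH n z₀ ε h α y ≤ sumA n z₀ h y (nu n z₀ h α) n) (b : ℕ → ℝ) (C : ℝ)
    (hb : ∀ j ∈ Finset.Ioc (nu n z₀ h α) n, weight n z₀ h j = 1 → |b j| ≤ C) :
    |(∑ j ∈ Finset.Ioc (nu n z₀ h α) n,
      stopCoef n z₀ ε h α y j * (weight n z₀ h j * y (j - 1) ^ 2) * b j) /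
        thresholdH n z₀ ε h α y| ≤ C := by
  have hνn : nu n z₀ h α ≤ n := by
    by_contra hcon
    have := sumA_mono n z₀ h y (nu n z₀ h α) (not_le.1 hcon).le
    rw [sumA_self] at this
    linarith
  have h1 := sum_stopCoef_mul hH hνn
  rw [min_eq_right hΓ] at h1
  rw [abs_div, abs_of_pos hH, div_le_iff₀ hH]
  calc _ ≤ ∑ j ∈ Finset.Ioc (nu n z₀ h α) n,
        |stopCoef n z₀ ε h α y j * (weight n z₀ h j * y (j - 1) ^ 2) * b j| :=
        Finset.abs_sum_le_sum_abs _ _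
    _ ≤ ∑ j ∈ Finset.Ioc (nu n z₀ h α) n,
        stopCoef n z₀ ε h α y j * (weight n z₀ h j * y (j - 1) ^ 2) * C := by
        refine Finset.sum_le_sum fun j hj => ?_
        rcases weight_eq_one_or_zero n z₀ h j with hw | hw
        · have h2 := hb j hj hw.1
          have h3 : 0 ≤ stopCoef n z₀ ε h α y j * (weight n z₀ h j * y (j - 1) ^ 2) :=
            mul_nonneg (stopCoef_nonneg j) (mul_nonneg (weight_nonneg _ _ _ _) (sq_nonneg _))
          rw [abs_mul, abs_of_nonneg h3]
          exact mul_le_mul_of_nonneg_left h2 h3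
        · simp [hw]
    _ = _ := by rw [← Finset.sum_mul, h1, mul_comm]

/-- A weighted stopped sum differs from the complete one by at most the overshoot. -/
lemma abs_sum_stopCoef_mul_le (hH : 0 < thresholdH n z₀ ε h α y)
    (hΓ : thresholdH n z₀ ε h α y ≤ sumA n z₀ h y (nu n z₀ h α) n) (u : ℕ → ℝ)
    (hu : ∀ j ∈ Finset.Ioc (nu n z₀ h α) n, weight n z₀ h j = 1 → |u j| ≤ 1) :
    |∑ j ∈ Finset.Ioc (nu n z₀ h α) n,
      stopCoef n z₀ ε h α y j * (weight n z₀ h j * y (j - 1) ^ 2) * u j| ≤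
      |∑ j ∈ Finset.Ioc (nu n z₀ h α) n, weight n z₀ h j * y (j - 1) ^ 2 * u j| +
      (sumA n z₀ h y (nu n z₀ h α) n - thresholdH n z₀ ε h α y) := by
  have hνn : nu n z₀ h α ≤ n := by
    by_contra hcon
    have := sumA_mono n z₀ h y (nu n z₀ h α) (not_le.1 hcon).le
    rw [sumA_self] at this
    linarith
  have h1 := sum_stopCoef_mul hH hνn
  rw [min_eq_right hΓ] at h1
  have h2 : ∑ j ∈ Finset.Ioc (nu n z₀ h α) n, weight n z₀ h j * y (j - 1) ^ 2 * u j -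
      ∑ j ∈ Finset.Ioc (nu n z₀ h α) n,
        stopCoef n z₀ ε h α y j * (weight n z₀ h j * y (j - 1) ^ 2) * u j =
      ∑ j ∈ Finset.Ioc (nu n z₀ h α) n,
        (1 - stopCoef n z₀ ε h α y j) * (weight n z₀ h j * y (j - 1) ^ 2) * u j := by
    rw [← Finset.sum_sub_distrib]
    exact Finset.sum_congr rfl fun j _ => by ring
  have h3 : |∑ j ∈ Finset.Ioc (nu n z₀ h α) n,
        (1 - stopCoef n z₀ ε h α y j) * (weight n z₀ h j * y (j - 1) ^ 2) * u j| ≤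
      sumA n z₀ h y (nu n z₀ h α) n - thresholdH n z₀ ε h α y := by
    calc _ ≤ ∑ j ∈ Finset.Ioc (nu n z₀ h α) n,
          |(1 - stopCoef n z₀ ε h α y j) * (weight n z₀ h j * y (j - 1) ^ 2) * u j| :=
          Finset.abs_sum_le_sum_abs _ _
      _ ≤ ∑ j ∈ Finset.Ioc (nu n z₀ h α) n,
          (weight n z₀ h j * y (j - 1) ^ 2 -
            stopCoef n z₀ ε h α y j * (weight n z₀ h j * y (j - 1) ^ 2)) := by
          refine Finset.sum_le_sum fun j hj => ?_
          rcases weight_eq_one_or_zero n z₀ h j with hw | hw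
          · have h2 := hu j hj hw.1
            have hκ1 := stopCoef_le_one (ε := ε) (y := y) (Finset.mem_Ioc.1 hj).1
            have h3 : 0 ≤ (1 - stopCoef n z₀ ε h α y j) * (weight n z₀ h j * y (j - 1) ^ 2) :=
              mul_nonneg (by linarith) (mul_nonneg (weight_nonneg _ _ _ _) (sq_nonneg _))
            rw [abs_mul, abs_of_nonneg h3]
            calc _ ≤ (1 - stopCoef n z₀ ε h α y j) * (weight n z₀ h j * y (j - 1) ^ 2) * 1 :=
                  mul_le_mul_of_nonneg_left h2 h3
              _ = _ := by ring
          · simp [hw]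
      _ = _ := by rw [Finset.sum_sub_distrib, h1]; rfl
  rw [← h2, abs_sub_comm] at h3
  have h4 := abs_sub_abs_le_abs_sub (∑ j ∈ Finset.Ioc (nu n z₀ h α) n,
      stopCoef n z₀ ε h α y j * (weight n z₀ h j * y (j - 1) ^ 2) * u j)
    (∑ j ∈ Finset.Ioc (nu n z₀ h α) n, weight n z₀ h j * y (j - 1) ^ 2 * u j)
  linarith

end Stopped

/-- Ergodic identity for weighted sums of squares along an autoregressive path. -/
lemma sum_weighted_sq_eq (y ξ s v : ℕ → ℝ) (g : ℝ) {a b : ℕ} (hab : a ≤ b)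
    (hy : ∀ j ∈ Finset.Ioc a b, y j = s j * y (j - 1) + ξ (j - 1)) :
    ∑ j ∈ Finset.Ioc a b, v j * ((1 - g) * y (j - 1) ^ 2 - 1) =
      v a * y a ^ 2 - v b * y b ^ 2 +
      ∑ j ∈ Finset.Ioc a b, (v j - v (j - 1)) * y (j - 1) ^ 2 +
      ∑ j ∈ Finset.Ioc a b, v j * ((s j ^ 2 - g) * y (j - 1) ^ 2) +
      2 * ∑ j ∈ Finset.Ioc a b, v j * s j * y (j - 1) * ξ (j - 1) +
      ∑ j ∈ Finset.Ioc a b, v j * (ξ (j - 1) ^ 2 - 1) := by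
  -- The new step is the square of the recursion, y_j² = s_j²y_{j-1}² + 2s_j y_{j-1}ξ + ξ², combined
  -- with summation by parts in `v`.
  induction b, hab using Nat.le_induction with
  | base => simp
  | succ b hab ih =>
    have h1 := ih fun j hj => hy j (Finset.Ioc_subset_Ioc le_rfl (Nat.le_succ b) hj)
    have h2 := hy (b + 1) (Finset.mem_Ioc.2 ⟨by omega, le_rfl⟩)
    simp only [Finset.sum_Ioc_succ_top hab, h1, Nat.add_sub_cancel] at h2 ⊢
    rw [h2]
    ring

/-! ### Deterministic control of the sequential estimator -/

/-- The last index before the kernel window. -/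
def winLo (n : ℕ) (z₀ h : ℝ) : ℕ := ⌈n * z₀ - n * h⌉₊ - 1

/-- The last index of the kernel window. -/
def winHi (n : ℕ) (z₀ h : ℝ) : ℕ := ⌊n * z₀ + n * h⌋₊

/-- The rescaled design point `u_j = (j/n - z₀)/h`. -/
def scaledPoint (n : ℕ) (z₀ h : ℝ) (j : ℕ) : ℝ := ((j : ℝ) / n - z₀) / h

/-- Quantitative conditions on the sample size `n`, the bandwidth `h`, the fraction `e` of
observations used by the pilot and the bound `Y` of the path under which the sequential estimator
is under control. -/
structure Admissible (n : ℕ) (z₀ ε L h e Y : ℝ) : Prop where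
  n_pos : 0 < n
  h_pos : 0 < h
  h_lt : h < z₀
  lt_one : z₀ + h < 1
  e_pos : 0 < e
  e_le : e ≤ 1 / 2
  le_mul : 24 / ε ≤ e * (n * h)
  L_nonneg : 0 ≤ L
  L_mul_le : L * h ≤ ε ^ 2 * e / 32
  sq_le : 8 * Y ^ 2 ≤ ε * (e * (n * h)) / 32
  mul_sq_le : 6 * L * h * Y ^ 2 ≤ ε * e / 32

section Window

variable {n : ℕ} {z₀ ε L h e Y : ℝ}

lemma Admissible.mul_pos (hA : Admissible n z₀ ε L h e Y) : 0 < n * h :=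
  _root_.mul_pos (Nat.cast_pos.2 hA.n_pos) hA.h_pos

lemma Admissible.left_pos (hA : Admissible n z₀ ε L h e Y) : 0 < n * z₀ - n * h := by
  have : (0 : ℝ) < n := Nat.cast_pos.2 hA.n_pos
  nlinarith [hA.h_lt]

lemma Admissible.le_mul' (hA : Admissible n z₀ ε L h e Y) (hε : ε ∈ Set.Ioo (0 : ℝ) 1) :
    24 ≤ e * (n * h) := by
  refine le_trans ?_ hA.le_mul
  rw [le_div_iff₀ hε.1]
  nlinarith [hε.2]

lemma Admissible.mul_ge (hA : Admissible n z₀ ε L h e Y) (hε : ε ∈ Set.Ioo (0 : ℝ) 1) :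
    48 ≤ n * h := by
  have := hA.le_mul' hε
  have := hA.mul_pos
  nlinarith [hA.e_le]

lemma Admissible.winLo_bounds (hA : Admissible n z₀ ε L h e Y) :
    (winLo n z₀ h : ℝ) < n * z₀ - n * h ∧ n * z₀ - n * h ≤ winLo n z₀ h + 1 := by
  have hp := hA.left_pos
  have h1 : 1 ≤ ⌈n * z₀ - n * h⌉₊ := Nat.one_le_ceil_iff.2 hp
  have h2 := Nat.ceil_lt_add_one hp.le
  have h3 := Nat.le_ceil (n * z₀ - n * h)
  have h4 : (winLo n z₀ h : ℝ) + 1 = (⌈n * z₀ - n * h⌉₊ : ℝ) := by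
    have : winLo n z₀ h + 1 = ⌈n * z₀ - n * h⌉₊ := by unfold winLo; omega
    exact_mod_cast this
  constructor <;> linarith

lemma Admissible.winHi_bounds (hA : Admissible n z₀ ε L h e Y) :
    n * z₀ + n * h - 1 < winHi n z₀ h ∧ (winHi n z₀ h : ℝ) ≤ n * z₀ + n * h := by
  have hp := hA.left_pos
  have hq := hA.mul_pos
  have h1 := Nat.floor_le (show (0 : ℝ) ≤ n * z₀ + n * h by linarith)
  have h2 := Nat.lt_floor_add_one (n * z₀ + n * h)
  unfold winHi
  constructor <;> linarith

lemma Admissible.winHi_le (hA : Admissible n z₀ ε L h e Y) : winHi n z₀ h ≤ n := by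
  have h1 := hA.winHi_bounds.2
  have : (0 : ℝ) < n := Nat.cast_pos.2 hA.n_pos
  have h2 : (winHi n z₀ h : ℝ) ≤ n := by nlinarith [hA.lt_one]
  exact_mod_cast h2

lemma Admissible.nu_bounds {α : ℝ} (hA : Admissible n z₀ ε L h (epsTilde n h α) Y) :
    n * z₀ - n * h + epsTilde n h α * (n * h) < nu n z₀ h α ∧
      (nu n z₀ h α : ℝ) ≤ n * z₀ - n * h + epsTilde n h α * (n * h) + 2 := by
  have hp := hA.left_pos
  have hq := _root_.mul_pos hA.e_pos hA.mul_pos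
  have h1 := Nat.floor_le hp.le
  have h2 := Nat.lt_floor_add_one (n * z₀ - n * h)
  have h3 := Nat.floor_le (show 0 ≤ epsTilde n h α * n * h by linarith)
  have h4 := Nat.lt_floor_add_one (epsTilde n h α * n * h)
  unfold nu
  push_cast
  constructor <;> linarith

lemma Admissible.abs_scaledPoint_le (hA : Admissible n z₀ ε L h e Y) {j : ℕ} :
    |scaledPoint n z₀ h j| ≤ 1 ↔ n * z₀ - n * h ≤ j ∧ (j : ℝ) ≤ n * z₀ + n * h := by
  have hn : (0 : ℝ) < n := Nat.cast_pos.2 hA.n_pos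
  rw [scaledPoint, abs_le, le_div_iff₀ hA.h_pos, div_le_iff₀ hA.h_pos, le_sub_iff_add_le,
    sub_le_iff_le_add, le_div_iff₀ hn, div_le_iff₀ hn]
  constructor <;> rintro ⟨h1, h2⟩ <;> constructor <;> linarith

lemma Admissible.mem_window (hA : Admissible n z₀ ε L h e Y) {j : ℕ} (hj : winLo n z₀ h < j)
    (hj' : j ≤ winHi n z₀ h) : |scaledPoint n z₀ h j| ≤ 1 := by
  rw [hA.abs_scaledPoint_le]
  have h1 : (winLo n z₀ h : ℝ) + 1 ≤ j := by exact_mod_cast hj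
  have h2 : (j : ℝ) ≤ winHi n z₀ h := by exact_mod_cast hj'
  exact ⟨by linarith [hA.winLo_bounds.2], by linarith [hA.winHi_bounds.2]⟩

lemma Admissible.weight_eq (hA : Admissible n z₀ ε L h e Y) (j : ℕ) :
    weight n z₀ h j = if winLo n z₀ h < j ∧ j ≤ winHi n z₀ h then 1 else 0 := by
  have hp := hA.left_pos
  split_ifs with hj
  · have hmem : ((j : ℝ) / n - z₀) / h ∈ Set.Icc (-1 : ℝ) 1 :=
      abs_le.1 (hA.mem_window hj.1 hj.2)
    unfold weight kernelQ
    rw [Set.indicator_of_mem hmem]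
  · unfold weight kernelQ
    rw [Set.indicator_of_notMem]
    intro hmem
    have h1 : |scaledPoint n z₀ h j| ≤ 1 := abs_le.2 hmem
    rw [hA.abs_scaledPoint_le] at h1
    refine hj ⟨?_, Nat.le_floor h1.2⟩
    have h2 : (winLo n z₀ h : ℝ) < j := hA.winLo_bounds.1.trans_le h1.1
    exact_mod_cast h2

lemma Admissible.abs_point_sub_le (hA : Admissible n z₀ ε L h e Y) {j : ℕ}
    (hj : |scaledPoint n z₀ h j| ≤ 1) : |(j : ℝ) / n - z₀| ≤ h := by
  rw [scaledPoint, abs_div, abs_of_pos hA.h_pos, div_le_one hA.h_pos] at hj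
  exact hj

lemma scaledPoint_sub (hn : 0 < n) (hh : 0 < h) {j : ℕ} (hj : 1 ≤ j) :
    scaledPoint n z₀ h j - scaledPoint n z₀ h (j - 1) = 1 / (n * h) := by
  have hn' : (0 : ℝ) < n := Nat.cast_pos.2 hn
  rw [scaledPoint, scaledPoint, Nat.cast_sub hj]
  field_simp
  push_cast
  ring

lemma sum_Ioc_natCast {a b : ℕ} (hab : a ≤ b) :
    ∑ j ∈ Finset.Ioc a b, (j : ℝ) = ((b : ℝ) - a) * (a + b + 1) / 2 := by
  induction b, hab using Nat.le_induction with
  | base => simp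
  | succ b hab ih =>
    rw [Finset.sum_Ioc_succ_top hab, ih]
    push_cast
    ring

lemma one_sub_sq_ge {θ : ℝ} (hε : ε ∈ Set.Ioo (0 : ℝ) 1) (hθ : |θ| ≤ 1 - ε) :
    ε ≤ 1 - θ ^ 2 := by
  have h1 : θ ^ 2 ≤ (1 - ε) ^ 2 := sq_le_sq.2 (by
    rwa [abs_of_nonneg (by linarith [hε.2] : 0 ≤ 1 - ε)])
  nlinarith [hε.1, hε.2]

/-- Control of the deviation of weighted sums of squares over a part of the window. -/
lemma Admissible.abs_window_sum_le (hA : Admissible n z₀ ε L h e Y)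
    (hε : ε ∈ Set.Ioo (0 : ℝ) 1) {θ : ℝ} (hθ : |θ| ≤ 1 - ε) {a b : ℕ} (hab : a ≤ b)
    (hcard : (b : ℝ) - a ≤ 3 * (n * h)) {y ξ s v : ℕ → ℝ}
    (hy : ∀ j ∈ Finset.Ioc a b, y j = s j * y (j - 1) + ξ (j - 1))
    (hyY : ∀ j ≤ b, |y j| ≤ Y) (hs : ∀ j ∈ Finset.Ioc a b, |s j| ≤ 1)
    (hsθ : ∀ j ∈ Finset.Ioc a b, |s j - θ| ≤ L * h)
    (hv : ∀ j ∈ Finset.Icc a b, |v j| ≤ 2) (hv1 : ∀ j ∈ Finset.Ioc a b, |v j| ≤ 1)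
    (hvd : ∀ j ∈ Finset.Ioc a b, |v j - v (j - 1)| ≤ 1 / (n * h))
    (hN1 : |∑ j ∈ Finset.Ioc a b, v j * s j * y (j - 1) * ξ (j - 1)| ≤ ε * (e * (n * h)) / 100)
    (hN2 : |∑ j ∈ Finset.Ioc a b, v j * (ξ (j - 1) ^ 2 - 1)| ≤ ε * (e * (n * h)) / 100) :
    |∑ j ∈ Finset.Ioc a b, v j * (y (j - 1) ^ 2 - 1 / (1 - θ ^ 2))| ≤ e * (n * h) / 8 := by
  have hB := hA.mul_pos
  have hg := one_sub_sq_ge hε hθ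
  have hg0 : 0 < 1 - θ ^ 2 := hε.1.trans_le hg
  have hLh : 0 ≤ L * h := mul_nonneg hA.L_nonneg hA.h_pos.le
  have hθ1 : |θ| ≤ 1 := hθ.trans (by linarith [hε.1])
  have hy2 : ∀ j ≤ b, y j ^ 2 ≤ Y ^ 2 := fun j hj =>
    sq_le_sq.2 ((hyY j hj).trans (le_abs_self Y))
  have hid := sum_weighted_sq_eq y ξ s v (θ ^ 2) hab hy
  have hcardN : ((Finset.Ioc a b).card : ℝ) ≤ 3 * (n * h) := by
    rw [Nat.card_Ioc, Nat.cast_sub hab]; exact hcard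
  have e1 : (1 - θ ^ 2) * ∑ j ∈ Finset.Ioc a b, v j * (y (j - 1) ^ 2 - 1 / (1 - θ ^ 2)) =
      ∑ j ∈ Finset.Ioc a b, v j * ((1 - θ ^ 2) * y (j - 1) ^ 2 - 1) := by
    rw [Finset.mul_sum]
    refine Finset.sum_congr rfl fun j _ => ?_
    field_simp
  have b1 : |v a * y a ^ 2| ≤ 2 * Y ^ 2 := by
    rw [abs_mul, abs_of_nonneg (sq_nonneg (y a))]
    exact mul_le_mul (hv a (Finset.left_mem_Icc.2 hab)) (hy2 a hab) (sq_nonneg _) (by norm_num)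
  have b2 : |v b * y b ^ 2| ≤ 2 * Y ^ 2 := by
    rw [abs_mul, abs_of_nonneg (sq_nonneg (y b))]
    exact mul_le_mul (hv b (Finset.right_mem_Icc.2 hab)) (hy2 b le_rfl) (sq_nonneg _)
      (by norm_num)
  have b3 : |∑ j ∈ Finset.Ioc a b, (v j - v (j - 1)) * y (j - 1) ^ 2| ≤ 3 * Y ^ 2 := by
    calc _ ≤ ∑ j ∈ Finset.Ioc a b, |(v j - v (j - 1)) * y (j - 1) ^ 2| :=
          Finset.abs_sum_le_sum_abs _ _
      _ ≤ ∑ j ∈ Finset.Ioc a b, 1 / (n * h) * Y ^ 2 := by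
          refine Finset.sum_le_sum fun j hj => ?_
          have hj' := Finset.mem_Ioc.1 hj
          rw [abs_mul, abs_of_nonneg (sq_nonneg (y (j - 1)))]
          exact mul_le_mul (hvd j hj) (hy2 _ (by omega)) (sq_nonneg _) (by positivity)
      _ = (Finset.Ioc a b).card * (1 / (n * h) * Y ^ 2) := by
          rw [Finset.sum_const, nsmul_eq_mul]
      _ ≤ 3 * (n * h) * (1 / (n * h) * Y ^ 2) := by gcongr
      _ = 3 * Y ^ 2 := by
          rw [mul_assoc 3, ← mul_assoc (n * h), mul_one_div_cancel hB.ne', one_mul]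
  have b4 : |∑ j ∈ Finset.Ioc a b, v j * ((s j ^ 2 - θ ^ 2) * y (j - 1) ^ 2)| ≤
      3 * (n * h) * (2 * (L * h) * Y ^ 2) := by
    calc _ ≤ ∑ j ∈ Finset.Ioc a b, |v j * ((s j ^ 2 - θ ^ 2) * y (j - 1) ^ 2)| :=
          Finset.abs_sum_le_sum_abs _ _
      _ ≤ ∑ j ∈ Finset.Ioc a b, 1 * (2 * (L * h) * Y ^ 2) := by
          refine Finset.sum_le_sum fun j hj => ?_
          have hj' := Finset.mem_Ioc.1 hj
          rw [abs_mul, abs_mul, abs_of_nonneg (sq_nonneg (y (j - 1)))]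
          have h1 : |s j ^ 2 - θ ^ 2| ≤ 2 * (L * h) := by
            rw [sq_sub_sq, abs_mul]
            refine mul_le_mul ?_ (hsθ j hj) (abs_nonneg _) (by norm_num)
            exact (abs_add_le _ _).trans (by linarith [hs j hj])
          exact mul_le_mul (hv1 j hj) (mul_le_mul h1 (hy2 _ (by omega)) (sq_nonneg _)
            (by positivity)) (mul_nonneg (abs_nonneg _) (sq_nonneg _)) zero_le_one
      _ = (Finset.Ioc a b).card * (2 * (L * h) * Y ^ 2) := by
          rw [Finset.sum_const, nsmul_eq_mul, one_mul]
      _ ≤ _ := by gcongr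
  -- In units of ε·e·nh the budget is 1/8: boundary and summation by parts use at most 7Y², hence
  -- 1/32; the variation of S uses 1/32; the two noise sums use 2/100 + 1/100.
  have htot : |∑ j ∈ Finset.Ioc a b, v j * ((1 - θ ^ 2) * y (j - 1) ^ 2 - 1)| ≤
      ε * (e * (n * h) / 8) := by
    rw [hid]
    have c1 := hA.sq_le
    have c2 : 3 * (n * h) * (2 * (L * h) * Y ^ 2) ≤ ε * (e * (n * h)) / 32 := by
      have := mul_le_mul_of_nonneg_left hA.mul_sq_le hB.le
      calc _ = n * h * (6 * L * h * Y ^ 2) := by ring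
        _ ≤ _ := this
        _ = _ := by ring
    have hpos : 0 ≤ ε * (e * (n * h)) :=
      mul_nonneg hε.1.le (mul_nonneg hA.e_pos.le hB.le)
    rw [abs_le] at *
    constructor <;> nlinarith [sq_nonneg Y]
  rw [← e1, abs_mul, abs_of_pos hg0] at htot
  have h1 : ε * |∑ j ∈ Finset.Ioc a b, v j * (y (j - 1) ^ 2 - 1 / (1 - θ ^ 2))| ≤
      ε * (e * (n * h) / 8) :=
    (mul_le_mul_of_nonneg_right hg (abs_nonneg _)).trans htot
  exact le_of_mul_le_mul_left h1 hε.1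

end Window

/-- The noise sums entering the analysis of the sequential estimator are small. -/
structure GoodSums (n : ℕ) (z₀ ε h α : ℝ) (y ξ s : ℕ → ℝ) : Prop where
  pilot_one : |∑ j ∈ Finset.Ioc (winLo n z₀ h) (nu n z₀ h α), 1 * s j * y (j - 1) * ξ (j - 1)| ≤
    ε * (epsTilde n h α * (n * h)) / 100
  pilot_sq : |∑ j ∈ Finset.Ioc (winLo n z₀ h) (nu n z₀ h α), 1 * (ξ (j - 1) ^ 2 - 1)| ≤
    ε * (epsTilde n h α * (n * h)) / 100
  main_one : |∑ j ∈ Finset.Ioc (nu n z₀ h α) (winHi n z₀ h), 1 * s j * y (j - 1) * ξ (j - 1)| ≤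
    ε * (epsTilde n h α * (n * h)) / 100
  main_sq : |∑ j ∈ Finset.Ioc (nu n z₀ h α) (winHi n z₀ h), 1 * (ξ (j - 1) ^ 2 - 1)| ≤
    ε * (epsTilde n h α * (n * h)) / 100
  lin_one : |∑ j ∈ Finset.Ioc (nu n z₀ h α) (winHi n z₀ h),
      scaledPoint n z₀ h j * s j * y (j - 1) * ξ (j - 1)| ≤
    ε * (epsTilde n h α * (n * h)) / 100
  lin_sq : |∑ j ∈ Finset.Ioc (nu n z₀ h α) (winHi n z₀ h),
      scaledPoint n z₀ h j * (ξ (j - 1) ^ 2 - 1)| ≤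
    ε * (epsTilde n h α * (n * h)) / 100
  noise : |∑ j ∈ Finset.Ioc (winLo n z₀ h) (nu n z₀ h α), 1 * 1 * y (j - 1) * ξ (j - 1)| ≤
    ε ^ 2 * epsTilde n h α * (epsTilde n h α * (n * h)) / 64

/-- Projection onto an interval containing θ cannot increase the distance to θ. -/
lemma abs_clip_sub_le {x θ ε : ℝ} (hθ : |θ| ≤ 1 - ε) :
    |min (max x (-1 + ε)) (1 - ε) - θ| ≤ |x - θ| := by
  rw [abs_le] at hθ
  rcases le_total x (-1 + ε) with h1 | h1
  · rw [max_eq_right h1, min_eq_left (by linarith), abs_of_nonpos (by linarith),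
      abs_of_nonpos (by linarith)]
    linarith
  · rw [max_eq_left h1]
    rcases le_total x (1 - ε) with h2 | h2
    · rw [min_eq_left h2]
    · rw [min_eq_right h2, abs_of_nonneg (by linarith), abs_of_nonneg (by linarith)]
      linarith

lemma abs_pilotProj_le {n : ℕ} {z₀ ε h α : ℝ} (hε : ε ∈ Set.Ioo (0 : ℝ) 1) (y : ℕ → ℝ) :
    |pilotProj n z₀ ε h α y| ≤ 1 - ε := by
  unfold pilotProj
  rw [abs_le]
  constructor
  · rw [neg_sub, le_min_iff]
    exact ⟨by linarith [le_max_right (pilot n z₀ h α y) (-1 + ε)], by linarith [hε.2]⟩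
  · exact min_le_right _ _

/-! ### Pilot accuracy, overshoot and error bounds. -/

section Deterministic

variable {n : ℕ} {z₀ ε L h α Y : ℝ} {y ξ s : ℕ → ℝ} {θ : ℝ}

/-- The projection keeps 1 - S̃² in (0, 1] and ε̃ ≤ 1/2, so this holds on every path. It makes the
variance bound 1/(nh) unconditional. -/
lemma Admissible.le_thresholdH (hA : Admissible n z₀ ε L h (epsTilde n h α) Y)
    (hε : ε ∈ Set.Ioo (0 : ℝ) 1) (y : ℕ → ℝ) : n * h ≤ thresholdH n z₀ ε h α y := by
  have h1 := one_sub_sq_ge hε (abs_pilotProj_le (n := n) (z₀ := z₀) (h := h) (α := α) hε y)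
  have h2 := sq_nonneg (pilotProj n z₀ ε h α y)
  have hB := hA.mul_pos
  have h3 : 1 ≤ 2 * (1 - epsTilde n h α) / (1 - pilotProj n z₀ ε h α y ^ 2) := by
    rw [le_div_iff₀ (hε.1.trans_le h1)]
    linarith [hA.e_le]
  unfold thresholdH
  nlinarith

lemma Admissible.sum_Ioc_zero_nu (hA : Admissible n z₀ ε L h (epsTilde n h α) Y)
    (hε : ε ∈ Set.Ioo (0 : ℝ) 1) (f : ℕ → ℝ) :
    ∑ j ∈ Finset.Ioc 0 (nu n z₀ h α), weight n z₀ h j * f j =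
      ∑ j ∈ Finset.Ioc (winLo n z₀ h) (nu n z₀ h α), f j := by
  have h1 := hA.nu_bounds
  have h2 := hA.winHi_bounds
  have h3 := hA.mul_ge hε
  have h5 : nu n z₀ h α ≤ winHi n z₀ h := by
    have : (nu n z₀ h α : ℝ) < winHi n z₀ h := by nlinarith [hA.e_le, h1.2, h2.1]
    exact_mod_cast this.le
  rw [← Finset.sum_subset (Finset.Ioc_subset_Ioc (Nat.zero_le (winLo n z₀ h)) le_rfl)]
  · refine Finset.sum_congr rfl fun j hj => ?_
    have hj' := Finset.mem_Ioc.1 hj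
    rw [hA.weight_eq, if_pos ⟨hj'.1, hj'.2.trans h5⟩, one_mul]
  · intro j hj hj2
    have hj' := Finset.mem_Ioc.1 hj
    rw [hA.weight_eq, if_neg, zero_mul]
    intro hcon
    exact hj2 (Finset.mem_Ioc.2 ⟨hcon.1, hj'.2⟩)

lemma Admissible.sum_Ioc_nu (hA : Admissible n z₀ ε L h (epsTilde n h α) Y) (f : ℕ → ℝ) :
    ∑ j ∈ Finset.Ioc (nu n z₀ h α) n, weight n z₀ h j * f j =
      ∑ j ∈ Finset.Ioc (nu n z₀ h α) (winHi n z₀ h), f j := by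
  have h1 := hA.nu_bounds
  have h2 := hA.winLo_bounds
  have h3 : winLo n z₀ h < nu n z₀ h α := by
    have : (winLo n z₀ h : ℝ) < nu n z₀ h α := by
      nlinarith [_root_.mul_pos hA.e_pos hA.mul_pos]
    exact_mod_cast this
  rw [← Finset.sum_subset (Finset.Ioc_subset_Ioc le_rfl hA.winHi_le)]
  · refine Finset.sum_congr rfl fun j hj => ?_
    have hj' := Finset.mem_Ioc.1 hj
    rw [hA.weight_eq, if_pos ⟨h3.trans hj'.1, hj'.2⟩, one_mul]
  · intro j hj hj2
    have hj' := Finset.mem_Ioc.1 hj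
    rw [hA.weight_eq, if_neg, zero_mul]
    intro hcon
    exact hj2 (Finset.mem_Ioc.2 ⟨hj'.1, hcon.2⟩)

lemma abs_inv_one_sub_sq_sub_le {ε e P θ : ℝ} (hε : ε ∈ Set.Ioo (0 : ℝ) 1) (he : 0 < e)
    (hP : |P| ≤ 1 - ε) (hθ : |θ| ≤ 1 - ε) (hPθ : |P - θ| ≤ ε ^ 2 * e / 16) :
    |1 / (1 - P ^ 2) - 1 / (1 - θ ^ 2)| ≤ e / 8 := by
  have hg := one_sub_sq_ge hε hθ
  have hg0 : 0 < 1 - θ ^ 2 := hε.1.trans_le hg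
  have hgP := one_sub_sq_ge hε hP
  have hgP0 : 0 < 1 - P ^ 2 := hε.1.trans_le hgP
  have e1 : 1 / (1 - P ^ 2) - 1 / (1 - θ ^ 2) =
      (P - θ) * (P + θ) / ((1 - P ^ 2) * (1 - θ ^ 2)) := by
    field_simp
    ring
  have hpos : 0 < (1 - P ^ 2) * (1 - θ ^ 2) := mul_pos hgP0 hg0
  rw [e1, abs_div, abs_mul, abs_of_pos hpos, div_le_iff₀ hpos]
  have h1 : |P + θ| ≤ 2 := (abs_add_le _ _).trans (by linarith [hε.1])
  have h2 : ε * ε ≤ (1 - P ^ 2) * (1 - θ ^ 2) := mul_le_mul hgP hg hε.1.le hgP0.le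
  calc |P - θ| * |P + θ| ≤ ε ^ 2 * e / 16 * 2 :=
        mul_le_mul hPθ h1 (abs_nonneg _) (by positivity)
    _ = e / 8 * (ε * ε) := by ring
    _ ≤ _ := by gcongr

/-- After the pilot about (2 - e)B window points remain, so A ≈ (2 - e)BG while the threshold is
about 2(1 - e)BG. The surplus eBG absorbs the fluctuation of A, the error of Γ and the rounding 3G ≤
eBG/8, and it also determines the size of the overshoot. -/
lemma overshoot_bounds {ε e B G Γ N A : ℝ} (he : 0 < e) (he2 : e ≤ 1 / 2) (hB : 0 < B)
    (heB : 24 ≤ e * B) (hG1 : 1 ≤ G) (hGε : G ≤ 1 / ε) (hN1 : 2 * B - e * B - 3 ≤ N)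
    (hN2 : N ≤ 2 * B - e * B) (hA : |A - N * G| ≤ e * B / 8) (hΓ : |Γ - G| ≤ e / 8) :
    2 * (1 - e) * B * Γ ≤ A ∧ A - 2 * (1 - e) * B * Γ ≤ 2 / ε * (e * B) := by
  have hG0 : 0 ≤ G := by linarith
  have hAlow := mul_le_mul_of_nonneg_right hN1 hG0
  have hAup := mul_le_mul_of_nonneg_right hN2 hG0
  rw [abs_le] at hA hΓ
  have hcoef : 0 ≤ 2 * (1 - e) * B := mul_nonneg (by linarith) hB.le
  have heB0 : 0 ≤ e * B := by linarith
  have hcoef2 : 2 * (1 - e) * B * (e / 8) ≤ e * B / 4 := by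
    have := mul_nonneg he.le heB0
    linarith
  have h1 := mul_le_mul_of_nonneg_left (by linarith [hΓ.2] : Γ ≤ G + e / 8) hcoef
  have h2 := mul_le_mul_of_nonneg_left (by linarith [hΓ.1] : G - e / 8 ≤ Γ) hcoef
  have hGeB : e * B ≤ e * B * G := le_mul_of_one_le_right heB0 hG1
  have hGeB' : e * B * G ≤ e * B * (1 / ε) := mul_le_mul_of_nonneg_left hGε heB0
  have h3G : 24 * G ≤ e * B * G := mul_le_mul_of_nonneg_right heB hG0
  have e2 : 2 / ε * (e * B) = 2 * (e * B * (1 / ε)) := by ring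
  rw [e2]
  constructor <;> linarith [hA.1, hA.2]

/-- The full window is symmetric around z₀; only the points consumed by the pilot and the rounding
at its ends break the symmetry of this arithmetic progression. -/
lemma Admissible.abs_sum_scaledPoint_le (hA : Admissible n z₀ ε L h (epsTilde n h α) Y)
    (hνhi : nu n z₀ h α ≤ winHi n z₀ h) :
    |∑ j ∈ Finset.Ioc (nu n z₀ h α) (winHi n z₀ h), scaledPoint n z₀ h j| ≤
      epsTilde n h α * (n * h) + 3 := by
  have hν := hA.nu_bounds
  have hhi := hA.winHi_bounds
  have hB := hA.mul_pos
  have hn : (0 : ℝ) < n := Nat.cast_pos.2 hA.n_pos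
  have hh := hA.h_pos
  have heB : 0 < epsTilde n h α * (n * h) := _root_.mul_pos hA.e_pos hB
  have hνhi' : (nu n z₀ h α : ℝ) ≤ winHi n z₀ h := by exact_mod_cast hνhi
  have e5 : ∑ j ∈ Finset.Ioc (nu n z₀ h α) (winHi n z₀ h), scaledPoint n z₀ h j =
      ((winHi n z₀ h : ℝ) - nu n z₀ h α) *
        (nu n z₀ h α + winHi n z₀ h + 1 - 2 * (n * z₀)) / (2 * (n * h)) := by
    have : ∀ j : ℕ, scaledPoint n z₀ h j = (j : ℝ) * (1 / (n * h)) - n * z₀ / (n * h) := by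
      intro j
      rw [scaledPoint]
      field_simp
    simp only [this]
    rw [Finset.sum_sub_distrib, ← Finset.sum_mul, sum_Ioc_natCast hνhi, Finset.sum_const,
      Nat.card_Ioc, nsmul_eq_mul, Nat.cast_sub hνhi]
    field_simp
  rw [e5, abs_div, abs_mul, abs_of_pos (by positivity : 0 < 2 * (n * h)),
    div_le_iff₀ (by positivity)]
  have h7 : |(winHi n z₀ h : ℝ) - nu n z₀ h α| ≤ 2 * (n * h) :=
    abs_le.2 ⟨by linarith, by linarith⟩
  have h8 : |(nu n z₀ h α : ℝ) + winHi n z₀ h + 1 - 2 * (n * z₀)| ≤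
      epsTilde n h α * (n * h) + 3 := abs_le.2 ⟨by linarith, by linarith⟩
  calc _ ≤ 2 * (n * h) * (epsTilde n h α * (n * h) + 3) :=
        mul_le_mul h7 h8 (abs_nonneg _) (by positivity)
    _ = _ := by ring

lemma Admissible.window_order (hA : Admissible n z₀ ε L h (epsTilde n h α) Y)
    (hε : ε ∈ Set.Ioo (0 : ℝ) 1) :
    winLo n z₀ h < nu n z₀ h α ∧ nu n z₀ h α < winHi n z₀ h := by
  have hν := hA.nu_bounds
  have hlo := hA.winLo_bounds
  have hhi := hA.winHi_bounds
  have hB48 := hA.mul_ge hε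
  have heB : 0 < epsTilde n h α * (n * h) := _root_.mul_pos hA.e_pos hA.mul_pos
  have heB2 := mul_le_mul_of_nonneg_right hA.e_le hA.mul_pos.le
  have h1 : (winLo n z₀ h : ℝ) < nu n z₀ h α := by linarith
  have h2 : (nu n z₀ h α : ℝ) < winHi n z₀ h := by linarith
  exact ⟨by exact_mod_cast h1, by exact_mod_cast h2⟩

/-- Accuracy of the pilot estimator on the good event. -/
lemma Admissible.abs_pilot_sub_le (hA : Admissible n z₀ ε L h (epsTilde n h α) Y)
    (hε : ε ∈ Set.Ioo (0 : ℝ) 1) (hθ : |θ| ≤ 1 - ε)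
    (hy : ∀ j ∈ Finset.Ioc 0 n, y j = s j * y (j - 1) + ξ (j - 1))
    (hyY : ∀ j ≤ n, |y j| ≤ Y) (hs : ∀ j ∈ Finset.Ioc 0 n, |s j| ≤ 1)
    (hsθ : ∀ j ∈ Finset.Ioc 0 n, |scaledPoint n z₀ h j| ≤ 1 → |s j - θ| ≤ L * h)
    (hgood : GoodSums n z₀ ε h α y ξ s) :
    |pilot n z₀ h α y - θ| ≤ ε ^ 2 * epsTilde n h α / 16 := by
  have hν := hA.nu_bounds
  have hlo := hA.winLo_bounds
  have hhin := hA.winHi_le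
  have hB := hA.mul_pos
  have hB48 := hA.mul_ge hε
  have he := hA.e_pos
  have heB2 := mul_le_mul_of_nonneg_right hA.e_le hA.mul_pos.le
  obtain ⟨hlo_lt, hνhi⟩ := hA.window_order hε
  set e := epsTilde n h α with hedef
  set B : ℝ := n * h with hBdef
  set ν := nu n z₀ h α with hνdef
  set lo := winLo n z₀ h with hlodef
  have hg := one_sub_sq_ge hε hθ
  have hg0 : 0 < 1 - θ ^ 2 := hε.1.trans_le hg
  have hG1 : 1 ≤ 1 / (1 - θ ^ 2) := by rw [le_div_iff₀ hg0]; linarith [sq_nonneg θ]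
  have mem0 : ∀ j ∈ Finset.Ioc lo ν, j ∈ Finset.Ioc 0 n := fun j hj => by
    have := Finset.mem_Ioc.1 hj
    exact Finset.mem_Ioc.2 ⟨by omega, by omega⟩
  have memw : ∀ j ∈ Finset.Ioc lo ν, |scaledPoint n z₀ h j| ≤ 1 := fun j hj => by
    have := Finset.mem_Ioc.1 hj
    exact hA.mem_window this.1 (this.2.trans hνhi.le)
  have w0 := hA.abs_window_sum_le hε hθ hlo_lt.le (v := fun _ => 1) (s := s) (ξ := ξ) (y := y)
    (by linarith) (fun j hj => hy j (mem0 j hj)) (fun j hj => hyY j (by omega))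
    (fun j hj => hs j (mem0 j hj)) (fun j hj => hsθ j (mem0 j hj) (memw j hj))
    (fun j _ => by norm_num) (fun j _ => by norm_num)
    (fun j _ => by simp only [sub_self, abs_zero]; exact (one_div_pos.2 hB).le)
    hgood.pilot_one hgood.pilot_sq
  simp only [one_mul] at w0
  set A₀ := sumA n z₀ h y 0 ν with hA₀
  have eA₀ : A₀ = ∑ j ∈ Finset.Ioc lo ν, y (j - 1) ^ 2 :=
    hA.sum_Ioc_zero_nu hε fun j => y (j - 1) ^ 2
  have hcard0 : ∑ j ∈ Finset.Ioc lo ν, 1 / (1 - θ ^ 2) =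
      ((ν : ℝ) - lo) * (1 / (1 - θ ^ 2)) := by
    rw [Finset.sum_const, Nat.card_Ioc, nsmul_eq_mul, Nat.cast_sub hlo_lt.le]
  have heBpos : 0 < e * B := _root_.mul_pos he hB
  -- The pilot window has at least eB points, each contributing G ≥ 1 on average, up to a
  -- fluctuation eB/8.
  have hA₀ge : e * B / 2 ≤ A₀ := by
    rw [Finset.sum_sub_distrib, hcard0, ← eA₀, abs_le] at w0
    have h2 : e * B ≤ ((ν : ℝ) - lo) := by linarith
    have h3 : ((ν : ℝ) - lo) ≤ ((ν : ℝ) - lo) * (1 / (1 - θ ^ 2)) :=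
      le_mul_of_one_le_right (by linarith) hG1
    linarith [w0.1]
  have hA₀pos : 0 < A₀ := by linarith
  have e1 : ∑ j ∈ Finset.Ioc 0 ν, weight n z₀ h j * y (j - 1) * y j =
      ∑ j ∈ Finset.Ioc lo ν, y (j - 1) * y j := by
    rw [← hA.sum_Ioc_zero_nu hε fun j => y (j - 1) * y j]
    exact Finset.sum_congr rfl fun j _ => by ring
  have e2 : pilot n z₀ h α y - θ = (∑ j ∈ Finset.Ioc lo ν, (s j - θ) * y (j - 1) ^ 2 +
      ∑ j ∈ Finset.Ioc lo ν, 1 * 1 * y (j - 1) * ξ (j - 1)) / A₀ := by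
    rw [eq_div_iff hA₀pos.ne', pilot, ← hνdef, ← hA₀, sub_mul, div_mul_cancel₀ _ hA₀pos.ne', e1,
      eA₀, Finset.mul_sum, ← Finset.sum_sub_distrib, ← Finset.sum_add_distrib]
    refine Finset.sum_congr rfl fun j hj => ?_
    rw [hy j (mem0 j hj)]
    ring
  have b1 : |∑ j ∈ Finset.Ioc lo ν, (s j - θ) * y (j - 1) ^ 2| ≤ L * h * A₀ := by
    rw [eA₀, Finset.mul_sum]
    refine (Finset.abs_sum_le_sum_abs _ _).trans (Finset.sum_le_sum fun j hj => ?_)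
    rw [abs_mul, abs_of_nonneg (sq_nonneg (y (j - 1)))]
    exact mul_le_mul_of_nonneg_right (hsθ j (mem0 j hj) (memw j hj)) (sq_nonneg _)
  rw [e2, abs_div, abs_of_pos hA₀pos, div_le_iff₀ hA₀pos]
  -- This noise bound carries an additional factor `e`: the pilot error must be of order ε̃ for the
  -- threshold to be accurate to relative order ε̃.
  have b2 := hgood.noise
  have b3 : ε ^ 2 * e * (e * B) / 64 ≤ ε ^ 2 * e / 32 * A₀ := by
    have : 0 ≤ ε ^ 2 * e / 32 := by positivity
    have := mul_le_mul_of_nonneg_left hA₀ge this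
    linarith
  have b4 : L * h * A₀ ≤ ε ^ 2 * e / 32 * A₀ :=
    mul_le_mul_of_nonneg_right hA.L_mul_le hA₀pos.le
  calc _ ≤ _ := abs_add_le _ _
    _ ≤ ε ^ 2 * e / 32 * A₀ + ε ^ 2 * e / 32 * A₀ :=
        add_le_add (b1.trans b4) (b2.trans b3)
    _ = _ := by ring

/-- On the good event the threshold is reached, the overshoot is small and the sum of the scaled
points is small. -/
lemma Admissible.overshoot_le (hA : Admissible n z₀ ε L h (epsTilde n h α) Y)
    (hε : ε ∈ Set.Ioo (0 : ℝ) 1) (hθ : |θ| ≤ 1 - ε)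
    (hy : ∀ j ∈ Finset.Ioc 0 n, y j = s j * y (j - 1) + ξ (j - 1))
    (hyY : ∀ j ≤ n, |y j| ≤ Y) (hs : ∀ j ∈ Finset.Ioc 0 n, |s j| ≤ 1)
    (hsθ : ∀ j ∈ Finset.Ioc 0 n, |scaledPoint n z₀ h j| ≤ 1 → |s j - θ| ≤ L * h)
    (hgood : GoodSums n z₀ ε h α y ξ s) :
    thresholdH n z₀ ε h α y ≤ sumA n z₀ h y (nu n z₀ h α) n ∧
    sumA n z₀ h y (nu n z₀ h α) n - thresholdH n z₀ ε h α y ≤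
      2 / ε * (epsTilde n h α * (n * h)) ∧
    |∑ j ∈ Finset.Ioc (nu n z₀ h α) n, weight n z₀ h j * y (j - 1) ^ 2 * scaledPoint n z₀ h j| ≤
      3 / ε * (epsTilde n h α * (n * h)) := by
  have hpil := hA.abs_pilot_sub_le hε hθ hy hyY hs hsθ hgood
  have hν := hA.nu_bounds
  have hhi := hA.winHi_bounds
  have hhin := hA.winHi_le
  have hB := hA.mul_pos
  have heB := hA.le_mul' hε
  have he := hA.e_pos
  have he2 := hA.e_le
  obtain ⟨hlo_lt, hνhi⟩ := hA.window_order hε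
  have husum := hA.abs_sum_scaledPoint_le hνhi.le
  set e := epsTilde n h α with hedef
  set B : ℝ := n * h with hBdef
  set ν := nu n z₀ h α with hνdef
  set hi := winHi n z₀ h with hhidef
  have hg := one_sub_sq_ge hε hθ
  have hg0 : 0 < 1 - θ ^ 2 := hε.1.trans_le hg
  set G : ℝ := 1 / (1 - θ ^ 2) with hG
  have hG1 : 1 ≤ G := by rw [hG, le_div_iff₀ hg0]; linarith [sq_nonneg θ]
  have hGε : G ≤ 1 / ε := one_div_le_one_div_of_le hε.1 hg
  have mem0 : ∀ j ∈ Finset.Ioc ν hi, j ∈ Finset.Ioc 0 n := fun j hj => by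
    have := Finset.mem_Ioc.1 hj
    exact Finset.mem_Ioc.2 ⟨by omega, by omega⟩
  have memw : ∀ j ∈ Finset.Icc ν hi, |scaledPoint n z₀ h j| ≤ 1 := fun j hj => by
    have := Finset.mem_Icc.1 hj
    exact hA.mem_window (lt_of_lt_of_le hlo_lt this.1) this.2
  have memw' : ∀ j ∈ Finset.Ioc ν hi, |scaledPoint n z₀ h j| ≤ 1 := fun j hj =>
    memw j (Finset.Ioc_subset_Icc_self hj)
  have hcardle : (hi : ℝ) - ν ≤ 3 * B := by linarith [_root_.mul_pos he hB]
  have w1 := hA.abs_window_sum_le hε hθ hνhi.le (v := fun _ => 1) (s := s) (ξ := ξ) (y := y)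
    hcardle (fun j hj => hy j (mem0 j hj)) (fun j hj => hyY j (by omega))
    (fun j hj => hs j (mem0 j hj)) (fun j hj => hsθ j (mem0 j hj) (memw' j hj))
    (fun j _ => by norm_num) (fun j _ => by norm_num)
    (fun j _ => by simp only [sub_self, abs_zero]; exact (one_div_pos.2 hB).le)
    hgood.main_one hgood.main_sq
  have w2 := hA.abs_window_sum_le hε hθ hνhi.le (v := scaledPoint n z₀ h) (s := s) (ξ := ξ)
    (y := y) hcardle (fun j hj => hy j (mem0 j hj)) (fun j hj => hyY j (by omega))
    (fun j hj => hs j (mem0 j hj)) (fun j hj => hsθ j (mem0 j hj) (memw' j hj))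
    (fun j hj => (memw j hj).trans one_le_two) memw'
    (fun j hj => by
      rw [scaledPoint_sub hA.n_pos hA.h_pos (by have := Finset.mem_Ioc.1 hj; omega)]
      exact (abs_of_pos (one_div_pos.2 hB)).le)
    hgood.lin_one hgood.lin_sq
  simp only [one_mul] at w1
  set A := sumA n z₀ h y ν n with hAdef
  have eA : A = ∑ j ∈ Finset.Ioc ν hi, y (j - 1) ^ 2 :=
    hA.sum_Ioc_nu fun j => y (j - 1) ^ 2
  have hcard1 : ∑ j ∈ Finset.Ioc ν hi, G = ((hi : ℝ) - ν) * G := by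
    rw [Finset.sum_const, Nat.card_Ioc, nsmul_eq_mul, Nat.cast_sub hνhi.le]
  rw [Finset.sum_sub_distrib, hcard1, ← eA] at w1
  have hGP := abs_inv_one_sub_sq_sub_le hε he (abs_pilotProj_le (n := n) (z₀ := z₀) (h := h)
    (α := α) hε y) hθ ((abs_clip_sub_le hθ).trans hpil)
  have hH : thresholdH n z₀ ε h α y =
      2 * (1 - e) * B * (1 / (1 - pilotProj n z₀ ε h α y ^ 2)) := by
    rw [thresholdH, ← hedef, hBdef]; ring
  obtain ⟨r1, r2⟩ := overshoot_bounds he he2 hB heB hG1 hGε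
    (by linarith : 2 * B - e * B - 3 ≤ (hi : ℝ) - ν) (by linarith) w1 hGP
  rw [← hH] at r1 r2
  refine ⟨r1, r2, ?_⟩
  -- The squares are centred at their ergodic limit G: the first sum is a fluctuation, the second is
  -- handled by the symmetry of the design.
  have e4 : ∑ j ∈ Finset.Ioc ν n, weight n z₀ h j * y (j - 1) ^ 2 * scaledPoint n z₀ h j =
      ∑ j ∈ Finset.Ioc ν hi, scaledPoint n z₀ h j * (y (j - 1) ^ 2 - G) +
        G * ∑ j ∈ Finset.Ioc ν hi, scaledPoint n z₀ h j := by
    rw [Finset.mul_sum, ← Finset.sum_add_distrib]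
    calc _ = ∑ j ∈ Finset.Ioc ν n, weight n z₀ h j *
          (scaledPoint n z₀ h j * y (j - 1) ^ 2) :=
          Finset.sum_congr rfl fun j _ => by ring
      _ = ∑ j ∈ Finset.Ioc ν hi, scaledPoint n z₀ h j * y (j - 1) ^ 2 :=
          hA.sum_Ioc_nu fun j => scaledPoint n z₀ h j * y (j - 1) ^ 2
      _ = _ := Finset.sum_congr rfl fun j _ => by ring
  have e3 : 3 / ε * (e * B) = 3 * (1 / ε * (e * B)) := by ring
  have heB0 : 0 ≤ e * B := by linarith
  have h1 : G * (e * B + 3) ≤ 1 / ε * (e * B) + 1 / ε * (e * B) / 8 := by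
    have h2 : G * (e * B + 3) ≤ 1 / ε * (e * B + 3) :=
      mul_le_mul_of_nonneg_right hGε (by linarith)
    have h3 : 1 / ε * 24 ≤ 1 / ε * (e * B) :=
      mul_le_mul_of_nonneg_left heB (by linarith)
    linarith
  have h4 : e * B ≤ 1 / ε * (e * B) :=
    le_mul_of_one_le_left heB0 (hG1.trans hGε)
  rw [e4, e3]
  calc _ ≤ _ := abs_add_le _ _
    _ ≤ e * B / 8 + G * (e * B + 3) := by
        refine add_le_add w2 ?_
        rw [abs_mul, abs_of_pos (by linarith : 0 < G)]
        exact mul_le_mul_of_nonneg_left husum (by linarith)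
    _ ≤ _ := by linarith

/-- Error bound for the sequential estimator on the good event. -/
theorem Admissible.abs_seqEst_sub_le (hA : Admissible n z₀ ε L h (epsTilde n h α) Y)
    (hε : ε ∈ Set.Ioo (0 : ℝ) 1) (hθ : |θ| ≤ 1 - ε)
    (hy : ∀ j ∈ Finset.Ioc 0 n, y j = s j * y (j - 1) + ξ (j - 1))
    (hyY : ∀ j ≤ n, |y j| ≤ Y) (hs : ∀ j ∈ Finset.Ioc 0 n, |s j| ≤ 1)
    (hsθ : ∀ j ∈ Finset.Ioc 0 n, |scaledPoint n z₀ h j| ≤ 1 → |s j - θ| ≤ L * h)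
    (hgood : GoodSums n z₀ ε h α y ξ s) {D R : ℝ} (hD : |D| ≤ L)
    (hsD : ∀ j ∈ Finset.Ioc 0 n, |scaledPoint n z₀ h j| ≤ 1 →
      |s j - θ - D * (h * scaledPoint n z₀ h j)| ≤ R) :
    |seqEst n z₀ ε h α y - θ| ≤ R + 5 * L / ε * (h * epsTilde n h α) +
      |∑ i ∈ Finset.range n, noiseCoef n z₀ ε h α y i * ξ i| := by
  obtain ⟨hΓ, hover, hlin⟩ := hA.overshoot_le hε hθ hy hyY hs hsθ hgood
  have hHB := hA.le_thresholdH hε y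
  have hB := hA.mul_pos
  have hH : 0 < thresholdH n z₀ ε h α y := hB.trans_le hHB
  have hsubs : ∀ j ∈ Finset.Ioc (nu n z₀ h α) n, j ∈ Finset.Ioc 0 n :=
    fun j hj => Finset.Ioc_subset_Ioc (Nat.zero_le _) le_rfl hj
  have hw1 : ∀ j, weight n z₀ h j = 1 → |scaledPoint n z₀ h j| ≤ 1 := by
    intro j hw
    rcases weight_eq_one_or_zero n z₀ h j with h1 | h1
    · exact h1.2
    · rw [h1] at hw; norm_num at hw
  rw [seqEst_sub_eq hH hΓ s ξ θ fun j hj => hy j (hsubs j hj)]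
  refine (abs_add_le _ _).trans (add_le_add_left ?_ _)
  -- Taylor splitting at z₀. The remainder is averaged to at most `R`; the linear part is compared
  -- with the unstopped sum (3/ε) at the price of the overshoot (2/ε), which gives the constant 5.
  have e1 : ∑ j ∈ Finset.Ioc (nu n z₀ h α) n,
      stopCoef n z₀ ε h α y j * (weight n z₀ h j * y (j - 1) ^ 2) * (s j - θ) =
      ∑ j ∈ Finset.Ioc (nu n z₀ h α) n,
      stopCoef n z₀ ε h α y j * (weight n z₀ h j * y (j - 1) ^ 2) *
        (s j - θ - D * (h * scaledPoint n z₀ h j)) +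
      D * h * ∑ j ∈ Finset.Ioc (nu n z₀ h α) n,
        stopCoef n z₀ ε h α y j * (weight n z₀ h j * y (j - 1) ^ 2) * scaledPoint n z₀ h j := by
    rw [Finset.mul_sum, ← Finset.sum_add_distrib]
    exact Finset.sum_congr rfl fun j _ => by ring
  rw [e1, add_div]
  refine (abs_add_le _ _).trans (add_le_add ?_ ?_)
  · exact abs_bias_le hH hΓ _ R fun j hj hw => hsD j (hsubs j hj) (hw1 j hw)
  · have h1 := abs_sum_stopCoef_mul_le hH hΓ (scaledPoint n z₀ h) fun j _ hw => hw1 j hw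
    have h2 := h1.trans (add_le_add hlin hover)
    have heB : 0 < epsTilde n h α * (n * h) := _root_.mul_pos hA.e_pos hB
    rw [abs_div, abs_mul, abs_mul, abs_of_pos hH, abs_of_pos hA.h_pos, div_le_iff₀ hH]
    calc _ ≤ L * h * (3 / ε * (epsTilde n h α * (n * h)) +
          2 / ε * (epsTilde n h α * (n * h))) := by
          refine mul_le_mul (mul_le_mul_of_nonneg_right hD hA.h_pos.le) h2 (abs_nonneg _)
            (mul_nonneg hA.L_nonneg hA.h_pos.le)
      _ = 5 * L / ε * (h * epsTilde n h α) * (n * h) := by ring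
      _ ≤ _ := by
          refine mul_le_mul_of_nonneg_left hHB ?_
          have := hA.L_nonneg
          have := hA.h_pos
          have := hA.e_pos
          have := hε.1
          positivity

/-- Crude error bound for the sequential estimator, valid everywhere. -/
theorem Admissible.abs_seqEst_sub_le_two (hA : Admissible n z₀ ε L h (epsTilde n h α) Y)
    (hε : ε ∈ Set.Ioo (0 : ℝ) 1) (hθ : |θ| ≤ 1 - ε)
    (hy : ∀ j ∈ Finset.Ioc 0 n, y j = s j * y (j - 1) + ξ (j - 1))
    (hs : ∀ j ∈ Finset.Ioc 0 n, |s j| ≤ 1) :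
    |seqEst n z₀ ε h α y - θ| ≤ 2 +
      |∑ i ∈ Finset.range n, noiseCoef n z₀ ε h α y i * ξ i| := by
  have hH : 0 < thresholdH n z₀ ε h α y := hA.mul_pos.trans_le (hA.le_thresholdH hε y)
  have hsubs : ∀ j ∈ Finset.Ioc (nu n z₀ h α) n, j ∈ Finset.Ioc 0 n :=
    fun j hj => Finset.Ioc_subset_Ioc (Nat.zero_le _) le_rfl hj
  by_cases hΓ : thresholdH n z₀ ε h α y ≤ sumA n z₀ h y (nu n z₀ h α) n
  · rw [seqEst_sub_eq hH hΓ s ξ θ fun j hj => hy j (hsubs j hj)]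
    refine (abs_add_le _ _).trans (add_le_add_left ?_ _)
    refine abs_bias_le hH hΓ _ 2 fun j hj _ => ?_
    exact (abs_sub _ _).trans (by linarith [hs j (hsubs j hj), hε.1])
  · rw [seqEst, if_neg hΓ, zero_sub, abs_neg]
    linarith [abs_nonneg (∑ i ∈ Finset.range n, noiseCoef n z₀ ε h α y i * ξ i), hε.1]

end Deterministic

/-! ### The observed path as a function of the noise -/

/-- The path `y_0, …, y_n` of the autoregression (continued by `0`) as a function of the noise. -/
def obsPath (n : ℕ) (S : ℝ → ℝ) (y₀ : ℝ) (ξ : ℕ → ℝ) : ℕ → ℝ :=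
  pathOf n y₀ (observations n S y₀ ξ)

lemma obsPath_of_le {n : ℕ} {S : ℝ → ℝ} {y₀ : ℝ} {ξ : ℕ → ℝ} {j : ℕ} (hj : j ≤ n) :
    obsPath n S y₀ ξ j = arPath n S y₀ ξ j := by
  cases j with
  | zero => rfl
  | succ j => simp [obsPath, pathOf, observations, Nat.lt_of_succ_le hj]

lemma obsPath_of_lt {n : ℕ} {S : ℝ → ℝ} {y₀ : ℝ} {ξ : ℕ → ℝ} {j : ℕ} (hj : n < j) :
    obsPath n S y₀ ξ j = 0 := by
  cases j with
  | zero => omega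
  | succ j => simp [obsPath, pathOf, show ¬ j < n by omega]

lemma obsPath_rec (n : ℕ) (S : ℝ → ℝ) (y₀ : ℝ) (ξ : ℕ → ℝ) :
    ∀ j ∈ Finset.Ioc 0 n, obsPath n S y₀ ξ j =
      S ((j : ℝ) / n) * obsPath n S y₀ ξ (j - 1) + ξ (j - 1) := by
  intro j hj
  have hj' := Finset.mem_Ioc.1 hj
  obtain ⟨i, rfl⟩ : ∃ i, j = i + 1 := ⟨j - 1, by omega⟩
  rw [obsPath_of_le hj'.2, Nat.add_sub_cancel, obsPath_of_le (by omega), arPath_succ]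

lemma measurable_obsPath (n : ℕ) (S : ℝ → ℝ) (y₀ : ℝ) : Measurable (obsPath n S y₀) :=
  (measurable_pathOf n y₀).comp (measurable_observations n S y₀)

lemma dependsOn_obsPath (n : ℕ) (S : ℝ → ℝ) (y₀ : ℝ) (j : ℕ) :
    DependsOn (fun ξ : ℕ → ℝ => obsPath n S y₀ ξ j) (Set.Iio j) := by
  intro ξ η h
  rcases le_or_gt j n with hj | hj
  · simp only [obsPath_of_le hj]
    exact dependsOn_arPath n S y₀ j h
  · simp only [obsPath_of_lt hj]

/-- The level |y₀| + X/ε is invariant, since contraction by 1 - ε frees at least the amount X added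
by an innovation. -/
lemma abs_obsPath_le {n : ℕ} {S : ℝ → ℝ} {y₀ ε X : ℝ} {ξ : ℕ → ℝ} (hε : ε ∈ Set.Ioo (0 : ℝ) 1)
    (hS : ∀ x ∈ Set.Icc (0 : ℝ) 1, |S x| ≤ 1 - ε) (hX : 0 ≤ X) (hξ : ∀ i < n, |ξ i| ≤ X) :
    ∀ j ≤ n, |obsPath n S y₀ ξ j| ≤ |y₀| + X / ε := by
  intro j hj
  have hXε : 0 ≤ X / ε := div_nonneg hX hε.1.le
  induction j with
  | zero =>
    rw [obsPath_of_le hj]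
    simpa [arPath] using hXε
  | succ j ih =>
    have h1 := ih (by omega)
    have h2 := obsPath_rec n S y₀ ξ (j + 1) (Finset.mem_Ioc.2 ⟨by omega, hj⟩)
    rw [Nat.add_sub_cancel] at h2
    have hn : (0 : ℝ) < n := by
      have : 0 < n := by omega
      exact_mod_cast this
    have h3 := hS (((j + 1 : ℕ) : ℝ) / n) ⟨by positivity, by
      rw [div_le_one hn]; exact_mod_cast hj⟩
    rw [h2]
    have h4 : X = ε * (X / ε) := by field_simp [hε.1.ne']
    calc _ ≤ |S (((j + 1 : ℕ) : ℝ) / n) * obsPath n S y₀ ξ j| + |ξ j| := abs_add_le _ _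
      _ ≤ (1 - ε) * (|y₀| + X / ε) + X := by
          rw [abs_mul]
          exact add_le_add (mul_le_mul h3 h1 (abs_nonneg _) (by linarith [hε.2]))
            (hξ j (by omega))
      _ ≤ _ := by nlinarith [mul_nonneg hε.1.le (abs_nonneg y₀)]

/-! ### Predictability of the noise coefficients -/

lemma sumA_congr {n : ℕ} {z₀ h : ℝ} {y y' : ℕ → ℝ} {k m : ℕ} (hyy : ∀ j < m, y j = y' j) :
    sumA n z₀ h y k m = sumA n z₀ h y' k m := by
  refine Finset.sum_congr rfl fun j hj => ?_
  rw [hyy (j - 1) (by have := Finset.mem_Ioc.1 hj; omega)]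

lemma thresholdH_congr {n : ℕ} {z₀ ε h α : ℝ} {y y' : ℕ → ℝ}
    (hyy : ∀ j ≤ nu n z₀ h α, y j = y' j) :
    thresholdH n z₀ ε h α y = thresholdH n z₀ ε h α y' := by
  have h1 : pilot n z₀ h α y = pilot n z₀ h α y' := by
    unfold pilot
    rw [sumA_congr fun j hj => hyy j hj.le]
    congr 1
    refine Finset.sum_congr rfl fun j hj => ?_
    have := Finset.mem_Ioc.1 hj
    rw [hyy (j - 1) (by omega), hyy j (by omega)]
  unfold thresholdH pilotProj
  rw [h1]

/-- Predictability rests on a shift of index: A_{ν,i+1} involves y only up to y_i, and `H` only up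
to y_ν with ν ≤ i. Hence even the correction at the stopping index is known before its innovation.
-/
lemma noiseCoef_congr {n : ℕ} {z₀ ε h α : ℝ} {y y' : ℕ → ℝ} {i : ℕ}
    (hyy : ∀ j ≤ i, y j = y' j) : noiseCoef n z₀ ε h α y i = noiseCoef n z₀ ε h α y' i := by
  unfold noiseCoef
  split_ifs with hi
  · have hH : thresholdH n z₀ ε h α y = thresholdH n z₀ ε h α y' :=
      thresholdH_congr fun j hj => hyy j (hj.trans hi)
    have hA1 : sumA n z₀ h y (nu n z₀ h α) (i + 1) = sumA n z₀ h y' (nu n z₀ h α) (i + 1) :=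
      sumA_congr fun j hj => hyy j (by omega)
    have hA0 : sumA n z₀ h y (nu n z₀ h α) i = sumA n z₀ h y' (nu n z₀ h α) i :=
      sumA_congr fun j hj => hyy j (by omega)
    unfold stopCoef
    simp only [Nat.add_sub_cancel]
    rw [hH, hA1, hA0, hyy i le_rfl]
  · rfl

lemma measurable_noiseCoef (n : ℕ) (z₀ ε h α : ℝ) (i : ℕ) :
    Measurable fun y : ℕ → ℝ => noiseCoef n z₀ ε h α y i := by
  have hH := measurable_thresholdH n z₀ ε h α
  have hA := measurable_sumA n z₀ h (nu n z₀ h α) i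
  unfold noiseCoef
  split_ifs
  · have : Measurable fun y : ℕ → ℝ => stopCoef n z₀ ε h α y (i + 1) := by
      unfold stopCoef
      refine Measurable.ite (measurableSet_lt (measurable_sumA _ _ _ _ _) hH) measurable_const
        (Measurable.ite (measurableSet_lt (measurable_sumA _ _ _ _ _) hH) ?_ measurable_const)
      simp only [Nat.add_sub_cancel]
      fun_prop
    fun_prop
  · exact measurable_const

section Noise

variable {n : ℕ} {z₀ ε L h α Y y₀ : ℝ} {S : ℝ → ℝ}

/-- The stochastic part of the error of the sequential estimator. -/
def noiseTerm (n : ℕ) (z₀ ε h α : ℝ) (S : ℝ → ℝ) (y₀ : ℝ) (ξ : ℕ → ℝ) : ℝ :=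
  ∑ i ∈ Finset.range n, noiseCoef n z₀ ε h α (obsPath n S y₀ ξ) i * ξ i

lemma measurable_noiseTerm : Measurable (noiseTerm n z₀ ε h α S y₀) := by
  refine Finset.measurable_sum _ fun i _ => ?_
  exact ((measurable_noiseCoef n z₀ ε h α i).comp (measurable_obsPath n S y₀)).mul
    (measurable_pi_apply i)

lemma dependsOn_noiseCoef_obsPath (i : ℕ) :
    DependsOn (fun ξ : ℕ → ℝ => noiseCoef n z₀ ε h α (obsPath n S y₀ ξ) i) (Set.Iio i) := by
  intro ξ η hξη
  refine noiseCoef_congr fun j hj => ?_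
  exact dependsOn_obsPath n S y₀ j fun l hl => hξη l (lt_of_lt_of_le hl hj)

lemma Admissible.sum_noiseCoef_sq_le (hA : Admissible n z₀ ε L h (epsTilde n h α) Y)
    (hε : ε ∈ Set.Ioo (0 : ℝ) 1) (y : ℕ → ℝ) :
    ∑ i ∈ Finset.range n, noiseCoef n z₀ ε h α y i ^ 2 ≤ 1 / (n * h) := by
  have h1 := hA.le_thresholdH hε y
  exact (SeqAR.sum_noiseCoef_sq_le (hA.mul_pos.trans_le h1)).trans
    (one_div_le_one_div_of_le hA.mul_pos h1)

lemma Admissible.measure_noiseTerm_ge_le (hA : Admissible n z₀ ε L h (epsTilde n h α) Y)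
    (hε : ε ∈ Set.Ioo (0 : ℝ) 1) {x : ℝ} (hx : 0 ≤ x) :
    noiseLaw {ξ | x ≤ |noiseTerm n z₀ ε h α S y₀ ξ|} ≤
      ENNReal.ofReal (2 * Real.exp (-(x ^ 2 * (n * h) / 2))) := by
  have := measure_abs_predictable_ge_le
    (fun i ξ => noiseCoef n z₀ ε h α (obsPath n S y₀ ξ) i) n
    (fun i _ => (measurable_noiseCoef n z₀ ε h α i).comp (measurable_obsPath n S y₀))
    (fun i _ => dependsOn_noiseCoef_obsPath i) x (1 / (n * h)) hx (one_div_pos.2 hA.mul_pos)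
    (fun ξ => hA.sum_noiseCoef_sq_le hε _)
  refine this.trans_eq ?_
  have hB := hA.mul_pos
  congr 4
  field_simp

lemma Admissible.lintegral_noiseTerm_sq_le (hA : Admissible n z₀ ε L h (epsTilde n h α) Y)
    (hε : ε ∈ Set.Ioo (0 : ℝ) 1) :
    ∫⁻ ξ, ENNReal.ofReal (noiseTerm n z₀ ε h α S y₀ ξ ^ 2) ∂noiseLaw ≤
      ENNReal.ofReal (8 / (n * h)) := by
  have := lintegral_predictable_sq_le
    (fun i ξ => noiseCoef n z₀ ε h α (obsPath n S y₀ ξ) i) n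
    (fun i _ => (measurable_noiseCoef n z₀ ε h α i).comp (measurable_obsPath n S y₀))
    (fun i _ => dependsOn_noiseCoef_obsPath i) (1 / (n * h)) (one_div_pos.2 hA.mul_pos)
    (fun ξ => hA.sum_noiseCoef_sq_le hε _)
  refine this.trans_eq ?_
  rw [mul_one_div]

/-! ### Probability of the bad event -/

lemma measure_abs_coord_ge_le (i : ℕ) {x : ℝ} (hx : 0 ≤ x) :
    noiseLaw {ξ : ℕ → ℝ | x ≤ |ξ i|} ≤ ENNReal.ofReal (2 * Real.exp (-(x ^ 2 / 2))) := by
  have := measure_abs_predictable_ge_le (fun j _ => if j = i then 1 else 0) (i + 1)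
    (fun _ _ => measurable_const) (fun _ _ _ _ _ => rfl) x 1 hx one_pos (by simp)
  simpa using this

/-- A deterministic sum of products of the path with the next innovation is sub-Gaussian as long
as the path is bounded. -/
lemma measure_window_sum_ge_le {a b : ℕ} {V : ℝ} (hV : 0 < V)
    (hcard : ((b : ℝ) - a) * Y ^ 2 ≤ V) (c : ℕ → ℝ) (hc : ∀ j ∈ Finset.Ioc a b, |c j| ≤ 1)
    (hbn : b ≤ n) {x : ℝ} (hx : 0 ≤ x) :
    noiseLaw {ξ | (∀ j ≤ n, |obsPath n S y₀ ξ j| ≤ Y) ∧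
      x < |∑ j ∈ Finset.Ioc a b, c j * obsPath n S y₀ ξ (j - 1) * ξ (j - 1)|} ≤
      ENNReal.ofReal (2 * Real.exp (-(x ^ 2 / (2 * V)))) := by
  classical
  -- Truncating the path bounds the quadratic variation surely, and changes nothing on the event
  -- considered.
  let f : ℝ → ℝ := fun t => if |t| ≤ Y then t else 0
  have hf : Measurable f :=
    Measurable.ite (measurableSet_le measurable_norm measurable_const) measurable_id
      measurable_const
  have hfY : ∀ t, f t ^ 2 ≤ Y ^ 2 := by
    intro t
    simp only [f]
    split_ifs with ht
    · exact sq_le_sq.2 (ht.trans (le_abs_self Y))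
    · simpa using sq_nonneg Y
  let A : ℕ → (ℕ → ℝ) → ℝ := fun i ξ =>
    if a ≤ i then c (i + 1) * f (obsPath n S y₀ ξ i) else 0
  have hAm : ∀ i, Measurable (A i) := by
    intro i
    simp only [A]
    split_ifs
    · have h1 : Measurable fun ξ => obsPath n S y₀ ξ i :=
        (measurable_pi_apply i).comp (measurable_obsPath n S y₀)
      exact (hf.comp h1).const_mul _
    · exact measurable_const
  have hAd : ∀ i, DependsOn (A i) (Set.Iio i) := by
    intro i ξ η hξη
    have h1 : obsPath n S y₀ ξ i = obsPath n S y₀ η i := dependsOn_obsPath n S y₀ i hξη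
    simp only [A, h1]
  have hAV : ∀ ξ, ∑ i ∈ Finset.range b, A i ξ ^ 2 ≤ V := by
    intro ξ
    have e : ∑ i ∈ Finset.range b, A i ξ ^ 2 = ∑ j ∈ Finset.Ioc a b,
        (c j * f (obsPath n S y₀ ξ (j - 1))) ^ 2 := by
      rw [sum_Ioc_eq_sum_range_ite]
      refine Finset.sum_congr rfl fun i _ => ?_
      simp only [A]
      split_ifs <;> simp
    rw [e]
    rcases le_total b a with hab | hab
    · rw [Finset.Ioc_eq_empty (by omega), Finset.sum_empty]; exact hV.le
    calc _ ≤ ∑ j ∈ Finset.Ioc a b, 1 * Y ^ 2 := by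
          refine Finset.sum_le_sum fun j hj => ?_
          rw [mul_pow]
          exact mul_le_mul ((sq_le_one_iff_abs_le_one _).2 (hc j hj)) (hfY _) (sq_nonneg _)
            zero_le_one
      _ = ((b : ℝ) - a) * Y ^ 2 := by
          rw [Finset.sum_const, Nat.card_Ioc, nsmul_eq_mul, Nat.cast_sub hab, one_mul]
      _ ≤ V := hcard
  refine (measure_mono ?_).trans
    (measure_abs_predictable_ge_le A b (fun i _ => hAm i) (fun i _ => hAd i) x V hx hV hAV)
  rintro ξ ⟨h1, h2⟩
  have e : ∑ i ∈ Finset.range b, A i ξ * ξ i =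
      ∑ j ∈ Finset.Ioc a b, c j * obsPath n S y₀ ξ (j - 1) * ξ (j - 1) := by
    rw [sum_Ioc_eq_sum_range_ite]
    refine Finset.sum_congr rfl fun i hi => ?_
    have hi' := Finset.mem_range.1 hi
    simp only [A, f]
    split_ifs with h3 h4
    · simp
    · exact absurd (h1 i (by omega)) h4
    · simp
  show x ≤ _
  rw [e]
  exact h2.le

lemma exists_measure_window_sq_sub_one_gt_le : ∃ κ : ℝ, 0 < κ ∧
    ∀ (a b : ℕ) (v : ℕ → ℝ) (B : ℝ), a ≤ b → (∀ j ∈ Finset.Ioc a b, |v j| ≤ 1) →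
      (b : ℝ) - a ≤ B → ∀ x : ℝ, 0 < x →
      noiseLaw {ξ | x < |∑ j ∈ Finset.Ioc a b, v j * (ξ (j - 1) ^ 2 - 1)|} ≤
        ENNReal.ofReal (κ * B / x ^ 2) := by
  obtain ⟨κ, hκ, hC⟩ := exists_measure_sum_sq_sub_one_ge_le
  refine ⟨κ, hκ, fun a b v B hab hv hB x hx => ?_⟩
  have h1 := hC (Finset.Ico a b) (fun i => v (i + 1))
    (fun i hi => hv (i + 1) (by
      have := Finset.mem_Ico.1 hi
      exact Finset.mem_Ioc.2 ⟨by omega, by omega⟩)) x hx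
  have e : ∀ ξ : ℕ → ℝ, ∑ j ∈ Finset.Ioc a b, v j * (ξ (j - 1) ^ 2 - 1) =
      ∑ i ∈ Finset.Ico a b, v (i + 1) * (ξ i ^ 2 - 1) := by
    intro ξ
    rw [sum_Ioc_eq_sum_range_ite, ← Finset.sum_filter]
    refine Finset.sum_congr ?_ fun i _ => by simp
    ext i
    simp [Finset.mem_Ico]
    omega
  refine (measure_mono ?_).trans (h1.trans (ENNReal.ofReal_le_ofReal ?_))
  · intro ξ hξ
    have hξ' : x < |∑ j ∈ Finset.Ioc a b, v j * (ξ (j - 1) ^ 2 - 1)| := hξ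
    rw [e ξ] at hξ'
    exact hξ'.le
  · rw [Nat.card_Ico, Nat.cast_sub hab]
    gcongr

/-- The event on which the sequential estimator is under control. -/
def goodEvent (n : ℕ) (z₀ ε h α Y : ℝ) (S : ℝ → ℝ) (y₀ : ℝ) : Set (ℕ → ℝ) :=
  {ξ | (∀ j ≤ n, |obsPath n S y₀ ξ j| ≤ Y) ∧
    GoodSums n z₀ ε h α (obsPath n S y₀ ξ) ξ (fun j => S ((j : ℝ) / n))}

/-- Union bound over eight events: one innovation exceeding X, three drift-weighted sums and the
pilot noise with sub-Gaussian tails, and three sums of centred squares treated by Chebyshev's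
inequality. -/
theorem exists_measure_compl_goodEvent_le : ∃ κ : ℝ, 0 < κ ∧
    ∀ (n : ℕ) (z₀ ε L h α X y₀ : ℝ) (S : ℝ → ℝ), ε ∈ Set.Ioo (0 : ℝ) 1 → 0 < X →
      Admissible n z₀ ε L h (epsTilde n h α) (|y₀| + X / ε) →
      (∀ x ∈ Set.Icc (0 : ℝ) 1, |S x| ≤ 1 - ε) →
      noiseLaw (goodEvent n z₀ ε h α (|y₀| + X / ε) S y₀)ᶜ ≤
        ENNReal.ofReal (2 * n * Real.exp (-(X ^ 2 / 2)) +
          6 * Real.exp (-((ε * (epsTilde n h α * (n * h)) / 100) ^ 2 /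
            (6 * (n * h) * (|y₀| + X / ε) ^ 2))) +
          2 * Real.exp (-((ε ^ 2 * epsTilde n h α * (epsTilde n h α * (n * h)) / 64) ^ 2 /
            (6 * (n * h) * (|y₀| + X / ε) ^ 2))) +
          9 * κ * (n * h) / (ε * (epsTilde n h α * (n * h)) / 100) ^ 2) := by
  obtain ⟨κ, hκ, hC⟩ := exists_measure_window_sq_sub_one_gt_le
  refine ⟨κ, hκ, fun n z₀ ε L h α X y₀ S hε hX hA hS => ?_⟩
  set Y := |y₀| + X / ε with hYdef
  have hY : 0 < Y := by
    have := abs_nonneg y₀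
    have := div_pos hX hε.1
    linarith
  have hB := hA.mul_pos
  have he := hA.e_pos
  have hν := hA.nu_bounds
  have hlo := hA.winLo_bounds
  have hhi := hA.winHi_bounds
  have hhin := hA.winHi_le
  have hB48 := hA.mul_ge hε
  have heB2 := mul_le_mul_of_nonneg_right hA.e_le hB.le
  have heB := _root_.mul_pos he hB
  obtain ⟨hlo_lt, hνhi⟩ := hA.window_order hε
  set e := epsTilde n h α with hedef
  set B : ℝ := n * h with hBdef
  set ν := nu n z₀ h α with hνdef
  set lo := winLo n z₀ h with hlodef
  set hi := winHi n z₀ h with hhidef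
  set x := ε * (e * B) / 100 with hxdef
  set x' := ε ^ 2 * e * (e * B) / 64 with hx'def
  have hx : 0 < x := div_pos (_root_.mul_pos hε.1 heB) (by norm_num)
  have hx' : 0 < x' := div_pos (_root_.mul_pos (_root_.mul_pos (pow_pos hε.1 2) he) heB)
    (by norm_num)
  have hV : 0 < 3 * B * Y ^ 2 := by positivity
  have c0 : (ν : ℝ) - lo ≤ 3 * B := by linarith
  have c1 : (hi : ℝ) - ν ≤ 3 * B := by linarith
  have c0' := mul_le_mul_of_nonneg_right c0 (sq_nonneg Y)
  have c1' := mul_le_mul_of_nonneg_right c1 (sq_nonneg Y)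
  have eV : 2 * (3 * B * Y ^ 2) = 6 * B * Y ^ 2 := by ring
  have hS1 : ∀ j ∈ Finset.Ioc 0 n, |S ((j : ℝ) / n)| ≤ 1 := by
    intro j hj
    have hj' := Finset.mem_Ioc.1 hj
    have hn : (0 : ℝ) < n := Nat.cast_pos.2 hA.n_pos
    refine (hS _ ⟨by positivity, ?_⟩).trans (by linarith [hε.1])
    rw [div_le_one hn]
    exact_mod_cast hj'.2
  have mem0 : ∀ j ∈ Finset.Ioc lo ν, j ∈ Finset.Ioc 0 n := fun j hj => by
    have := Finset.mem_Ioc.1 hj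
    exact Finset.mem_Ioc.2 ⟨by omega, by omega⟩
  have mem1 : ∀ j ∈ Finset.Ioc ν hi, j ∈ Finset.Ioc 0 n := fun j hj => by
    have := Finset.mem_Ioc.1 hj
    exact Finset.mem_Ioc.2 ⟨by omega, by omega⟩
  have memw : ∀ j ∈ Finset.Ioc ν hi, |scaledPoint n z₀ h j| ≤ 1 := fun j hj => by
    have := Finset.mem_Ioc.1 hj
    exact hA.mem_window (by omega) this.2
  have p0 : noiseLaw {ξ : ℕ → ℝ | ∃ i < n, X ≤ |ξ i|} ≤
      ENNReal.ofReal (2 * n * Real.exp (-(X ^ 2 / 2))) := by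
    have : {ξ : ℕ → ℝ | ∃ i < n, X ≤ |ξ i|} =
        ⋃ i ∈ Finset.range n, {ξ : ℕ → ℝ | X ≤ |ξ i|} := by
      ext ξ; simp
    rw [this]
    refine (measure_biUnion_finset_le _ _).trans
      ((Finset.sum_le_sum fun i _ => measure_abs_coord_ge_le i hX.le).trans ?_)
    rw [Finset.sum_const, Finset.card_range, nsmul_eq_mul, ← ENNReal.ofReal_natCast,
      ← ENNReal.ofReal_mul (Nat.cast_nonneg _)]
    exact ENNReal.ofReal_le_ofReal (le_of_eq (by ring))
  have p1 := measure_window_sum_ge_le (n := n) (S := S) (y₀ := y₀) hV c0'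
    (fun j => 1 * S ((j : ℝ) / n)) (fun j hj => by
      simpa using hS1 j (mem0 j hj)) (by omega) hx.le
  have p2 := measure_window_sum_ge_le (n := n) (S := S) (y₀ := y₀) hV c1'
    (fun j => 1 * S ((j : ℝ) / n)) (fun j hj => by
      simpa using hS1 j (mem1 j hj)) hhin hx.le
  have p3 := measure_window_sum_ge_le (n := n) (S := S) (y₀ := y₀) hV c1'
    (fun j => scaledPoint n z₀ h j * S ((j : ℝ) / n)) (fun j hj => by
      rw [abs_mul]
      exact mul_le_one₀ (memw j hj) (abs_nonneg _) (hS1 j (mem1 j hj))) hhin hx.le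
  have p4 := measure_window_sum_ge_le (n := n) (S := S) (y₀ := y₀) hV c0'
    (fun j => 1 * 1) (fun j hj => by simp) (by omega) hx'.le
  have q1 := hC lo ν (fun _ => 1) (3 * B) hlo_lt.le (fun j _ => by simp) c0 x hx
  have q2 := hC ν hi (fun _ => 1) (3 * B) hνhi.le (fun j _ => by simp) c1 x hx
  have q3 := hC ν hi (scaledPoint n z₀ h) (3 * B) hνhi.le memw c1 x hx
  rw [eV] at p1 p2 p3 p4
  set E1 := Real.exp (-(x ^ 2 / (6 * B * Y ^ 2))) with hE1
  set E2 := Real.exp (-(x' ^ 2 / (6 * B * Y ^ 2))) with hE2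
  set E0 := Real.exp (-(X ^ 2 / 2)) with hE0
  have hE0' : 0 ≤ E0 := Real.exp_nonneg _
  have hE1' : 0 ≤ E1 := Real.exp_nonneg _
  have hE2' : 0 ≤ E2 := Real.exp_nonneg _
  have hQ' : 0 ≤ κ * (3 * B) / x ^ 2 := by positivity
  have etot : 2 * n * E0 + 6 * E1 + 2 * E2 + 9 * κ * B / x ^ 2 =
      2 * n * E0 + (2 * E1 + (2 * E1 + (2 * E1 + (2 * E2 + (κ * (3 * B) / x ^ 2 +
        (κ * (3 * B) / x ^ 2 + κ * (3 * B) / x ^ 2)))))) := by ring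
  have hn0 : (0 : ℝ) ≤ n := Nat.cast_nonneg _
  rw [etot, ENNReal.ofReal_add (by positivity) (by positivity),
    ENNReal.ofReal_add (by positivity) (by positivity),
    ENNReal.ofReal_add (by positivity) (by positivity),
    ENNReal.ofReal_add (by positivity) (by positivity),
    ENNReal.ofReal_add (by positivity) (by positivity),
    ENNReal.ofReal_add (by positivity) (by positivity),
    ENNReal.ofReal_add (by positivity) (by positivity)]
  refine le_trans ?_ (add_le_add p0 (add_le_add p1 (add_le_add p2 (add_le_add p3
    (add_le_add p4 (add_le_add q1 (add_le_add q2 q3)))))))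
  refine le_trans (measure_mono ?_) ((measure_union_le _ _).trans (add_le_add_right
    ((measure_union_le _ _).trans (add_le_add_right
    ((measure_union_le _ _).trans (add_le_add_right
    ((measure_union_le _ _).trans (add_le_add_right
    ((measure_union_le _ _).trans (add_le_add_right
    ((measure_union_le _ _).trans (add_le_add_right
    (measure_union_le _ _) _)) _)) _)) _)) _)) _))
  intro ξ hξ
  by_contra hcon
  simp only [Set.mem_union, Set.mem_ofPred_eq, not_or, not_and, not_lt, not_exists, not_le]
    at hcon
  obtain ⟨n0, n1, n2, n3, n4, m1, m2, m3⟩ := hcon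
  have hbd : ∀ j ≤ n, |obsPath n S y₀ ξ j| ≤ Y :=
    abs_obsPath_le hε hS hX.le fun i hi => (n0 i hi).le
  exact hξ ⟨hbd, ⟨n1 hbd, m1, n2 hbd, m2, n3 hbd, m3, n4 hbd⟩⟩

end Noise

/-! ### Asymptotics, uniformly over the scale of regularities -/

/-- Eventually d_n ≥ n^(1/3), so d_n^(-r) is at most exp(-(r/3) ln n), which beats every power of ln
n. -/
lemma eventually_log_pow_mul_dn_rpow_le (p : ℕ) {r : ℝ} (hr : 0 < r) (M : ℝ) :
    ∀ᶠ n : ℕ in atTop, M * Real.log n ^ p * dn n ^ (-r) ≤ 1 := by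
  have h1 : Tendsto (fun n : ℕ => r / 3 * Real.log n) atTop atTop :=
    tendsto_log_natCast.const_mul_atTop (by positivity)
  have h2 := (Real.tendsto_pow_mul_exp_neg_atTop_nhds_zero p).comp h1
  have h3 := h2.const_mul (|M| * (r / 3)⁻¹ ^ p)
  rw [mul_zero] at h3
  filter_upwards [h3.eventually_le_const one_pos, eventually_log_le_log_dn,
    tendsto_dn.eventually_gt_atTop 0, tendsto_log_natCast.eventually_ge_atTop 0]
    with n hn hlog hd hl
  have h4 : dn n ^ (-r) ≤ Real.exp (-(r / 3 * Real.log n)) := by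
    rw [Real.rpow_def_of_pos hd]
    refine Real.exp_le_exp.2 ?_
    nlinarith
  calc M * Real.log n ^ p * dn n ^ (-r) ≤
        |M| * Real.log n ^ p * Real.exp (-(r / 3 * Real.log n)) := by
        gcongr
        exact le_abs_self M
    _ = |M| * (r / 3)⁻¹ ^ p *
        ((r / 3 * Real.log n) ^ p * Real.exp (-(r / 3 * Real.log n))) := by
        rw [mul_pow (r / 3), inv_pow]
        field_simp
    _ ≤ 1 := hn

/-- Since 2β + 1 ≤ 5, the decay is uniform over the scale of regularities. -/
lemma bandwidth_rpow_le {n : ℕ} {β c : ℝ} (hd : 1 ≤ dn n) (hβ : 0 < β) (hβ2 : β ≤ 2)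
    (hc : 0 ≤ c) : bandwidth n β ^ c ≤ dn n ^ (-(c / 5)) := by
  rw [bandwidth_rpow (by linarith)]
  refine Real.rpow_le_rpow_of_exponent_le hd (neg_le_neg ?_)
  exact div_le_div_of_nonneg_left hc (by linarith) (by linarith)

/-- The threshold used for the innovations. -/
def noiseBound (n : ℕ) : ℝ := Real.sqrt (8 * Real.log n)

/-- The resulting bound for the path. -/
def pathBound (n : ℕ) (y₀ ε : ℝ) : ℝ := |y₀| + noiseBound n / ε

lemma pathBound_sq_le {n : ℕ} {y₀ ε : ℝ} (hl : 1 ≤ Real.log n) :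
    pathBound n y₀ ε ^ 2 ≤ (2 * y₀ ^ 2 + 16 / ε ^ 2) * Real.log n := by
  have h1 : noiseBound n ^ 2 = 8 * Real.log n := Real.sq_sqrt (by linarith)
  have h2 : pathBound n y₀ ε ^ 2 ≤ 2 * |y₀| ^ 2 + 2 * (noiseBound n / ε) ^ 2 := by
    unfold pathBound
    nlinarith [sq_nonneg (|y₀| - noiseBound n / ε)]
  rw [sq_abs, div_pow, h1] at h2
  have h3 : y₀ ^ 2 ≤ y₀ ^ 2 * Real.log n := le_mul_of_one_le_right (sq_nonneg _) hl
  calc _ ≤ _ := h2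
    _ ≤ 2 * (y₀ ^ 2 * Real.log n) + 2 * (8 * Real.log n / ε ^ 2) := by linarith
    _ = _ := by ring

/-- Relations between the bandwidth and the other quantities in terms of `u = h ^ (β - 1)`. -/
lemma bandwidth_relations {n : ℕ} {β : ℝ} (hd : 0 < dn n) (hn : 1 < n) (hβ : 0 < β) :
    bandwidth n β = bandwidth n β ^ (β - 1) * bandwidth n β ^ (2 - β) ∧
    n * bandwidth n β = Real.log n / ((bandwidth n β ^ (β - 1)) ^ 2 * bandwidth n β ^ 2) := by
  have hb := bandwidth_pos (n := n) (β := β) hd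
  have h1 := mul_bandwidth_rpow hd hn hβ
  constructor
  · rw [← Real.rpow_add hb]
    conv_lhs => rw [← Real.rpow_one (bandwidth n β)]
    congr 1
    ring
  · rw [eq_div_iff (by positivity), ← h1]
    have h2 : bandwidth n β ^ (2 * β + 1) =
        (bandwidth n β ^ (β - 1)) ^ 2 * bandwidth n β ^ 2 * bandwidth n β := by
      rw [← Real.rpow_natCast, ← Real.rpow_natCast, ← Real.rpow_mul hb.le, ← Real.rpow_add hb]
      conv_rhs => rw [mul_comm, ← Real.rpow_one_add' hb.le (by push_cast; linarith)]
      congr 1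
      push_cast
      ring
    rw [h2]
    ring

/-- The conditions on the bandwidth follow from the smallness of `h ^ (2 - β)`. -/
lemma admissible_of_small {n : ℕ} {z₀ ε L h u q ℓ Y K M : ℝ} (hn : 0 < n)
    (hz₀ : z₀ ∈ Set.Ioo (0 : ℝ) 1) (hε : ε ∈ Set.Ioo (0 : ℝ) 1) (hL : 0 ≤ L) (hh : 0 < h)
    (hh1 : h ≤ 1) (hu : 0 < u) (hu1 : u ≤ 1) (hℓ : 2 ≤ ℓ) (hhu : h = u * q)
    (hnh : n * h = ℓ / (u ^ 2 * h ^ 2)) (hY : Y ^ 2 ≤ K * ℓ) (hK : 0 ≤ K)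
    (hM : 2 / z₀ + 2 / (1 - z₀) + 24 / ε + 32 * L / ε ^ 2 + 256 * K / ε + 192 * L * K / ε ≤ M)
    (hq : M * ℓ ^ 5 * q ≤ 1) : Admissible n z₀ ε L h (u / ℓ) Y := by
  obtain ⟨hz0, hz1⟩ := hz₀
  obtain ⟨hε0, hε1⟩ := hε
  have hq0 : 0 < q := by
    by_contra hcon
    have : u * q ≤ 0 := mul_nonpos_of_nonneg_of_nonpos hu.le (not_lt.1 hcon)
    linarith
  have hℓ0 : 0 < ℓ := by linarith
  have hz1' : 0 < 1 - z₀ := by linarith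
  have t1 : 0 ≤ 2 / z₀ := by positivity
  have t2 : 0 ≤ 2 / (1 - z₀) := by positivity
  have t3 : 0 ≤ 24 / ε := by positivity
  have t4 : 0 ≤ 32 * L / ε ^ 2 := by positivity
  have t5 : 0 ≤ 256 * K / ε := by positivity
  have t6 : 0 ≤ 192 * L * K / ε := by positivity
  -- All conditions reduce to one smallness assumption on q = h^(2-β); `M` collects the constants
  -- they need.
  have key : ∀ (c : ℝ) (p : ℕ), 0 ≤ c → c ≤ M → p ≤ 5 → c * ℓ ^ p * q ≤ 1 := by
    intro c p hc hcM hp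
    have h1 : ℓ ^ p ≤ ℓ ^ 5 := pow_le_pow_right₀ (by linarith) hp
    have hM0 : 0 ≤ M := hc.trans hcM
    calc c * ℓ ^ p * q ≤ M * ℓ ^ 5 * q := by gcongr
      _ ≤ 1 := hq
  have hhq : h ≤ q := by rw [hhu]; exact mul_le_of_le_one_left hq0.le hu1
  have heB : u / ℓ * (n * h) = 1 / (u * h ^ 2) := by rw [hnh]; field_simp
  have huh : u * h ^ 2 ≤ q := by
    calc u * h ^ 2 ≤ 1 * (h * 1) := by
          rw [pow_two]; gcongr
      _ ≤ q := by linarith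
  have huh0 : 0 < u * h ^ 2 := by positivity
  refine ⟨hn, hh, ?_, ?_, by positivity, ?_, ?_, hL, ?_, ?_, ?_⟩
  · have := key (2 / z₀) 0 t1 (by linarith) (by norm_num)
    rw [pow_zero, mul_one, div_mul_eq_mul_div, div_le_one hz0] at this
    linarith
  · have := key (2 / (1 - z₀)) 0 t2 (by linarith) (by norm_num)
    rw [pow_zero, mul_one, div_mul_eq_mul_div, div_le_one hz1'] at this
    linarith
  · rw [div_le_iff₀ hℓ0]; linarith
  · rw [heB, le_div_iff₀ huh0]
    have := key (24 / ε) 0 t3 (by linarith) (by norm_num)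
    rw [pow_zero, mul_one] at this
    exact (mul_le_mul_of_nonneg_left huh t3).trans this
  -- The variation Lh of S over the window must be small compared with ε̃ = u/ℓ; as h = uq, this is
  -- smallness of ℓq.
  · have := key (32 * L / ε ^ 2) 1 t4 (by linarith) (by norm_num)
    rw [pow_one, div_mul_eq_mul_div, div_mul_eq_mul_div, div_le_one (by positivity)] at this
    rw [hhu, le_div_iff₀ (by norm_num), mul_div_assoc', le_div_iff₀ hℓ0]
    calc L * (u * q) * 32 * ℓ = u * (32 * L * ℓ * q) := by ring
      _ ≤ u * ε ^ 2 := by gcongr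
      _ = ε ^ 2 * u := by ring
  · have := key (256 * K / ε) 1 t5 (by linarith) (by norm_num)
    rw [pow_one, div_mul_eq_mul_div, div_mul_eq_mul_div, div_le_one hε0] at this
    rw [heB, le_div_iff₀ (by norm_num), mul_one_div, le_div_iff₀ huh0]
    calc 8 * Y ^ 2 * 32 * (u * h ^ 2) ≤ 8 * (K * ℓ) * 32 * q := by gcongr
      _ = 256 * K * ℓ * q := by ring
      _ ≤ ε := this
  · have := key (192 * L * K / ε) 2 t6 (by linarith) (by norm_num)
    rw [div_mul_eq_mul_div, div_mul_eq_mul_div, div_le_one hε0] at this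
    rw [hhu, le_div_iff₀ (by norm_num), mul_div_assoc', le_div_iff₀ hℓ0]
    calc 6 * L * (u * q) * Y ^ 2 * 32 * ℓ ≤ 6 * L * (u * q) * (K * ℓ) * 32 * ℓ := by gcongr
      _ = u * (192 * L * K * ℓ ^ 2 * q) := by ring
      _ ≤ u * ε := by gcongr
      _ = ε * u := by ring

/-- The bound for the probability of the bad event in terms of the bandwidth. -/
lemma bad_probability_le {n : ℕ} {ε h u q ℓ Y K M κ X : ℝ} (hn : (n : ℝ) = Real.exp ℓ)
    (hε : ε ∈ Set.Ioo (0 : ℝ) 1) (hh : 0 < h)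
    (hh1 : h ≤ 1) (hu : 0 < u) (hu1 : u ≤ 1) (hℓ : 2 ≤ ℓ) (hhu : h = u * q)
    (hnh : n * h = ℓ / (u ^ 2 * h ^ 2)) (hY0 : 0 < Y) (hY : Y ^ 2 ≤ K * ℓ) (hK : 0 < K)
    (hX : X ^ 2 = 8 * ℓ) (hκ : 0 < κ)
    (hM : 1 + 180000 * K / ε ^ 2 + 73728 * K / ε ^ 4 ≤ M)
    (hq : M * ℓ ^ 5 * q ≤ 1) :
    2 * n * Real.exp (-(X ^ 2 / 2)) +
      6 * Real.exp (-((ε * (u / ℓ * (n * h)) / 100) ^ 2 / (6 * (n * h) * Y ^ 2))) +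
      2 * Real.exp (-((ε ^ 2 * (u / ℓ) * (u / ℓ * (n * h)) / 64) ^ 2 /
        (6 * (n * h) * Y ^ 2))) +
      9 * κ * (n * h) / (ε * (u / ℓ * (n * h)) / 100) ^ 2 ≤
      (10 + 90000 * κ / ε ^ 2) * (ℓ * h ^ 2) := by
  obtain ⟨hε0, hε1⟩ := hε
  have hq0 : 0 < q := by
    by_contra hcon
    have : u * q ≤ 0 := mul_nonpos_of_nonneg_of_nonpos hu.le (not_lt.1 hcon)
    linarith
  have hℓ0 : 0 < ℓ := by linarith
  have t1 : 0 ≤ 180000 * K / ε ^ 2 := by positivity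
  have t2 : 0 ≤ 73728 * K / ε ^ 4 := by positivity
  have key : ∀ (c : ℝ) (p : ℕ), 0 ≤ c → c ≤ M → p ≤ 5 → c * ℓ ^ p * q ≤ 1 := by
    intro c p hc hcM hp
    have h1 : ℓ ^ p ≤ ℓ ^ 5 := pow_le_pow_right₀ (by linarith) hp
    have hM0 : 0 ≤ M := hc.trans hcM
    calc c * ℓ ^ p * q ≤ M * ℓ ^ 5 * q := by gcongr
      _ ≤ 1 := hq
  have hq1 : q ≤ 1 := by
    have := key 1 0 zero_le_one (by linarith) (by norm_num)
    simpa using this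
  have hhq : h ≤ q := by rw [hhu]; exact mul_le_of_le_one_left hq0.le hu1
  have hh2q : h ^ 2 ≤ q := by nlinarith
  have heB : u / ℓ * (n * h) = 1 / (u * h ^ 2) := by rw [hnh]; field_simp
  -- Here ℓ/n = u²h³ ≤ h², so any n⁻³ term is negligible and each exponential term below only needs
  -- its exponent to reach 3ℓ.
  have hsmall : Real.exp (-(3 * ℓ)) ≤ ℓ * h ^ 2 := by
    have h1 : n * (h * (u ^ 2 * h ^ 2)) = ℓ := by
      rw [← mul_assoc, hnh]; field_simp
    have h2 : h * (u ^ 2 * h ^ 2) ≤ h ^ 2 := by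
      have : h * (u ^ 2 * h ^ 2) ≤ 1 * (1 ^ 2 * h ^ 2) := by gcongr
      linarith
    have h3 : ℓ * Real.exp (-ℓ) ≤ h ^ 2 := by
      have h4 : ℓ * Real.exp (-ℓ) = h * (u ^ 2 * h ^ 2) := by
        rw [Real.exp_neg, ← hn, ← div_eq_mul_inv, div_eq_iff (hn ▸ (Real.exp_pos _).ne'), mul_comm]
        exact h1.symm
      rw [h4]; exact h2
    have h5 : Real.exp (-(3 * ℓ)) ≤ Real.exp (-ℓ) := Real.exp_le_exp.2 (by linarith)
    have h6 : Real.exp (-ℓ) ≤ ℓ * Real.exp (-ℓ) :=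
      le_mul_of_one_le_left (Real.exp_nonneg _) (by linarith)
    have h7 : h ^ 2 ≤ ℓ * h ^ 2 := le_mul_of_one_le_left (sq_nonneg _) (by linarith)
    linarith
  have s0 : n * Real.exp (-(X ^ 2 / 2)) ≤ ℓ * h ^ 2 := by
    refine le_trans (le_of_eq ?_) hsmall
    rw [hX, hn, ← Real.exp_add]
    congr 1
    ring
  have hV : 6 * (n * h) * Y ^ 2 ≤ 6 * K * ℓ ^ 2 / (u ^ 2 * h ^ 2) := by
    rw [hnh]
    calc 6 * (ℓ / (u ^ 2 * h ^ 2)) * Y ^ 2 ≤ 6 * (ℓ / (u ^ 2 * h ^ 2)) * (K * ℓ) := by gcongr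
      _ = _ := by ring
  have hV0 : 0 < 6 * (n * h) * Y ^ 2 := by rw [hnh]; positivity
  have s1 : Real.exp (-((ε * (u / ℓ * (n * h)) / 100) ^ 2 / (6 * (n * h) * Y ^ 2))) ≤
      ℓ * h ^ 2 := by
    refine le_trans (Real.exp_le_exp.2 (neg_le_neg ?_)) hsmall
    rw [le_div_iff₀ hV0, heB]
    have h1 := key (180000 * K / ε ^ 2) 3 t1 (by linarith) (by norm_num)
    rw [div_mul_eq_mul_div, div_mul_eq_mul_div, div_le_one (by positivity)] at h1
    calc 3 * ℓ * (6 * (n * h) * Y ^ 2) ≤ 3 * ℓ * (6 * K * ℓ ^ 2 / (u ^ 2 * h ^ 2)) := by gcongr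
      _ = 180000 * K * ℓ ^ 3 * h ^ 2 / (10000 * u ^ 2 * h ^ 4) := by field_simp; ring
      _ ≤ ε ^ 2 / (10000 * u ^ 2 * h ^ 4) := by
          gcongr
          exact le_trans (by gcongr) h1
      _ = _ := by field_simp; ring
  -- The pilot noise is the most demanding term because of its extra factor u/ℓ; it is what requires
  -- the power ℓ⁵.
  have s2 : Real.exp (-((ε ^ 2 * (u / ℓ) * (u / ℓ * (n * h)) / 64) ^ 2 /
      (6 * (n * h) * Y ^ 2))) ≤ ℓ * h ^ 2 := by
    refine le_trans (Real.exp_le_exp.2 (neg_le_neg ?_)) hsmall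
    rw [le_div_iff₀ hV0, heB]
    have h1 := key (73728 * K / ε ^ 4) 5 t2 (by linarith) (by norm_num)
    rw [div_mul_eq_mul_div, div_mul_eq_mul_div, div_le_one (by positivity)] at h1
    calc 3 * ℓ * (6 * (n * h) * Y ^ 2) ≤ 3 * ℓ * (6 * K * ℓ ^ 2 / (u ^ 2 * h ^ 2)) := by gcongr
      _ = 73728 * K * ℓ ^ 5 * (q * q) / (4096 * ℓ ^ 2 * h ^ 4) := by
          rw [hhu]; field_simp; ring
      _ ≤ ε ^ 4 / (4096 * ℓ ^ 2 * h ^ 4) := by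
          gcongr
          refine le_trans ?_ h1
          gcongr
          nlinarith
      _ = _ := by field_simp; ring
  -- The Chebyshev term equals a constant times ℓh² and sets the order of the bound.
  have s3 : 9 * κ * (n * h) / (ε * (u / ℓ * (n * h)) / 100) ^ 2 =
      90000 * κ / ε ^ 2 * (ℓ * h ^ 2) := by
    rw [heB, hnh]
    field_simp
    ring
  rw [s3]
  linarith

/-- Uniform control of the sequential estimators for the sample size `n`. -/
def UniformControl (n : ℕ) (z₀ y₀ ε L βlow βup C : ℝ) : Prop :=
  ∀ β ∈ Set.Icc βlow βup,
    Admissible n z₀ ε L (bandwidth n β) (epsTilde n (bandwidth n β) (β - 1)) (pathBound n y₀ ε) ∧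
    Real.log n * bandwidth n β ^ (2 - β) ≤ 1 ∧
    ∀ S : ℝ → ℝ, (∀ x ∈ Set.Icc (0 : ℝ) 1, |S x| ≤ 1 - ε) →
      noiseLaw (goodEvent n z₀ ε (bandwidth n β) (β - 1) (pathBound n y₀ ε) S y₀)ᶜ ≤
        ENNReal.ofReal (C * (Real.log n * bandwidth n β ^ 2))

/-- The sequential estimators are under control uniformly over the scale of regularities. -/
theorem exists_uniform_control {z₀ ε L βlow βup : ℝ} (y₀ : ℝ) (hz₀ : z₀ ∈ Set.Ioo (0 : ℝ) 1)
    (hε : ε ∈ Set.Ioo (0 : ℝ) 1) (hβlow : 1 < βlow) (hβup : βup < 2) (hL : 0 < L) :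
    ∃ C : ℝ, 0 < C ∧ ∀ᶠ n : ℕ in atTop, UniformControl n z₀ y₀ ε L βlow βup C := by
  obtain ⟨κ, hκ, hbad⟩ := exists_measure_compl_goodEvent_le
  have hε0 := hε.1
  set K : ℝ := 2 * y₀ ^ 2 + 16 / ε ^ 2 with hK
  have hK0 : 0 < K := by positivity
  have hz1' : 0 < 1 - z₀ := by linarith [hz₀.2]
  have hz0' := hz₀.1
  set M₁ : ℝ := 2 / z₀ + 2 / (1 - z₀) + 24 / ε + 32 * L / ε ^ 2 + 256 * K / ε +
    192 * L * K / ε with hM₁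
  set M₂ : ℝ := 1 + 180000 * K / ε ^ 2 + 73728 * K / ε ^ 4 with hM₂
  have hM₁0 : 0 ≤ M₁ := by positivity
  have hM₂1 : 1 ≤ M₂ := by
    have : 0 ≤ 180000 * K / ε ^ 2 := by positivity
    have : 0 ≤ 73728 * K / ε ^ 4 := by positivity
    linarith
  refine ⟨10 + 90000 * κ / ε ^ 2, by positivity, ?_⟩
  -- Uniformity over β uses h^(2-β) ≤ d_n^(-(2-βup)/5), which decays because βup < 2.
  filter_upwards [eventually_log_pow_mul_dn_rpow_le 5
      (show 0 < (2 - βup) / 5 by linarith) (M₁ + M₂),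
    tendsto_dn.eventually_ge_atTop 1, eventually_gt_atTop 1,
    tendsto_log_natCast.eventually_ge_atTop 2] with n hq hd1 hn1 hℓ β hβ
  have hd : 0 < dn n := by linarith
  have hβ0 : 0 < β := by linarith [hβ.1]
  have hh := bandwidth_pos (n := n) (β := β) hd
  have hh1 := bandwidth_le_one hd1 hβ0
  obtain ⟨hhu, hnh⟩ := bandwidth_relations (β := β) hd hn1 hβ0
  have hu : 0 < bandwidth n β ^ (β - 1) := by positivity
  have hu1 : bandwidth n β ^ (β - 1) ≤ 1 := Real.rpow_le_one hh.le hh1 (by linarith [hβ.1])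
  have hq' : (M₁ + M₂) * Real.log n ^ 5 * bandwidth n β ^ (2 - β) ≤ 1 := by
    refine le_trans (mul_le_mul_of_nonneg_left ?_ (by positivity)) hq
    refine (bandwidth_rpow_le hd1 hβ0 (by linarith [hβ.2]) (by linarith [hβ.2])).trans ?_
    exact Real.rpow_le_rpow_of_exponent_le hd1 (by linarith [hβ.2])
  have hY := pathBound_sq_le (n := n) (y₀ := y₀) (ε := ε) (by linarith)
  have hX0 : 0 < noiseBound n := Real.sqrt_pos.2 (by linarith)
  have hX : noiseBound n ^ 2 = 8 * Real.log n := Real.sq_sqrt (by linarith)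
  have hY0 : 0 < pathBound n y₀ ε := by
    have := abs_nonneg y₀
    have := div_pos hX0 hε0
    unfold pathBound
    linarith
  have hA : Admissible n z₀ ε L (bandwidth n β) (epsTilde n (bandwidth n β) (β - 1))
      (pathBound n y₀ ε) :=
    admissible_of_small (by omega) hz₀ hε hL.le hh hh1 hu hu1 hℓ hhu hnh hY hK0.le
      (by linarith) hq'
  refine ⟨hA, ?_, fun S hS => ?_⟩
  · refine le_trans ?_ hq'
    have hq0 : 0 < bandwidth n β ^ (2 - β) := by positivity
    have h1 : Real.log n ≤ Real.log n ^ 5 := le_self_pow₀ (by linarith) (by norm_num)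
    have h2 : Real.log n ^ 5 ≤ (M₁ + M₂) * Real.log n ^ 5 :=
      le_mul_of_one_le_left (by positivity) (by linarith)
    exact mul_le_mul_of_nonneg_right (h1.trans h2) hq0.le
  · refine (hbad n z₀ ε L (bandwidth n β) (β - 1) (noiseBound n) y₀ S hε hX0 hA hS).trans
      (ENNReal.ofReal_le_ofReal ?_)
    exact bad_probability_le (by rw [Real.exp_log]; positivity) hε hh hh1 hu hu1 hℓ hhu hnh hY0
      hY hK0 hX hκ (by linarith) hq'

/-! ### Errors of the sequential estimators at a given regularity -/

section ErrorBounds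

variable {n : ℕ} {z₀ ε L Lstar β γ y₀ h α Y : ℝ} {S : ℝ → ℝ} {ξ : ℕ → ℝ}

lemma div_mem_unitInterval {j : ℕ} (hj : j ∈ Finset.Ioc 0 n) :
    (j : ℝ) / n ∈ Set.Icc (0 : ℝ) 1 := by
  have hj' := Finset.mem_Ioc.1 hj
  have hn : (0 : ℝ) < n := by exact_mod_cast (by omega : 0 < n)
  have hjn : (j : ℝ) ≤ n := by exact_mod_cast hj'.2
  exact ⟨by positivity, (div_le_one hn).2 hjn⟩

lemma Admissible.abs_seqEst_obsPath_sub_le_two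
    (hA : Admissible n z₀ ε L h (epsTilde n h α) Y) (hz₀ : z₀ ∈ Set.Ioo (0 : ℝ) 1)
    (hε : ε ∈ Set.Ioo (0 : ℝ) 1) (hS : S ∈ holderClass z₀ ε L Lstar β) :
    |seqEst n z₀ ε h α (obsPath n S y₀ ξ) - S z₀| ≤ 2 + |noiseTerm n z₀ ε h α S y₀ ξ| :=
  hA.abs_seqEst_sub_le_two hε (hS.1.2.1 z₀ ⟨hz₀.1.le, hz₀.2.le⟩) (obsPath_rec n S y₀ ξ)
    fun j hj => (hS.1.2.1 _ (div_mem_unitInterval hj)).trans (by linarith [hε.1])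

lemma Admissible.abs_seqEst_obsPath_sub_le
    (hA : Admissible n z₀ ε L h (epsTilde n h α) Y) (hz₀ : z₀ ∈ Set.Ioo (0 : ℝ) 1)
    (hε : ε ∈ Set.Ioo (0 : ℝ) 1) (hLs : 0 ≤ Lstar) (hβ : 1 < β)
    (hS : S ∈ holderClass z₀ ε L Lstar β) (hξ : ξ ∈ goodEvent n z₀ ε h α Y S y₀) :
    |seqEst n z₀ ε h α (obsPath n S y₀ ξ) - S z₀| ≤
      Lstar * h ^ β + 5 * L / ε * (h * epsTilde n h α) + |noiseTerm n z₀ ε h α S y₀ ξ| := by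
  have hz₀' : z₀ ∈ Set.Icc (0 : ℝ) 1 := ⟨hz₀.1.le, hz₀.2.le⟩
  refine hA.abs_seqEst_sub_le (D := derivWithin S (Set.Icc 0 1) z₀) hε (hS.1.2.1 z₀ hz₀')
    (obsPath_rec n S y₀ ξ) hξ.1 (fun j hj => ?_) (fun j hj hw => ?_) hξ.2
    (hS.1.2.2 z₀ hz₀') fun j hj hw => ?_
  · exact (hS.1.2.1 _ (div_mem_unitInterval hj)).trans (by linarith [hε.1])
  · exact (abs_sub_le_of_mem hS hz₀' (div_mem_unitInterval hj)).trans
      (mul_le_mul_of_nonneg_left (hA.abs_point_sub_le hw) hA.L_nonneg)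
  · have h1 := abs_sub_sub_le_of_mem hS hLs hβ hz₀' (div_mem_unitInterval hj)
    have h2 : h * scaledPoint n z₀ h j = (j : ℝ) / n - z₀ := mul_div_cancel₀ _ hA.h_pos.ne'
    rw [h2]
    refine h1.trans (mul_le_mul_of_nonneg_left ?_ hLs)
    exact Real.rpow_le_rpow (abs_nonneg _) (hA.abs_point_sub_le hw) (by linarith)

/-- The bias of the estimator tuned to `γ`, relative to the rate at `γ`, when the regularity
is `β`. -/
def relBias (n : ℕ) (ε L Lstar β γ : ℝ) : ℝ :=
  Lstar * bandwidth n γ ^ (β - γ) + 5 * L / ε / Real.log n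

/-- Factoring out h^γ = 1/N(γ) leaves h^(β-γ) for the Taylor remainder, and 1/ln n for the linear
term because h·ε̃ = h^γ / ln n. -/
lemma abs_seqEst_bandwidth_sub_le (hd : 0 < dn n)
    (hA : Admissible n z₀ ε L (bandwidth n γ) (epsTilde n (bandwidth n γ) (γ - 1)) Y)
    (hz₀ : z₀ ∈ Set.Ioo (0 : ℝ) 1)
    (hε : ε ∈ Set.Ioo (0 : ℝ) 1) (hLs : 0 ≤ Lstar) (hβ : 1 < β)
    (hS : S ∈ holderClass z₀ ε L Lstar β)
    (hξ : ξ ∈ goodEvent n z₀ ε (bandwidth n γ) (γ - 1) Y S y₀) :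
    |seqEst n z₀ ε (bandwidth n γ) (γ - 1) (obsPath n S y₀ ξ) - S z₀| ≤
      relBias n ε L Lstar β γ / rate n γ +
        |noiseTerm n z₀ ε (bandwidth n γ) (γ - 1) S y₀ ξ| := by
  refine (hA.abs_seqEst_obsPath_sub_le hz₀ hε hLs hβ hS hξ).trans
    (add_le_add_left (le_of_eq ?_) _)
  have hb := bandwidth_pos (n := n) (β := γ) hd
  have e1 : bandwidth n γ ^ β = bandwidth n γ ^ (β - γ) * bandwidth n γ ^ γ := by
    rw [← Real.rpow_add hb, sub_add_cancel]
  have e2 : bandwidth n γ * bandwidth n γ ^ (γ - 1) = bandwidth n γ ^ γ := by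
    conv_lhs => enter [1]; rw [← Real.rpow_one (bandwidth n γ)]
    rw [← Real.rpow_add hb, add_sub_cancel]
  rw [relBias, rate_eq hd, div_inv_eq_mul, epsTilde, mul_div_assoc', e2, e1]
  ring

lemma relBias_le_of_le (hd : 1 ≤ dn n) (hl : 1 ≤ Real.log n) (hε : 0 < ε) (hL : 0 ≤ L)
    (hLs : 0 ≤ Lstar) (hγ : 0 < γ) (hγβ : γ ≤ β) :
    relBias n ε L Lstar β γ ≤ Lstar + 5 * L / ε := by
  refine add_le_add (mul_le_of_le_one_right hLs ?_) (div_le_self (by positivity) hl)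
  exact Real.rpow_le_one (bandwidth_pos (by linarith)).le (bandwidth_le_one hd hγ) (by linarith)

/-- A gap β - γ of at least 5c / ln d_n forces h^(β-γ) ≤ d_n^(-(β-γ)/5) ≤ e^(-c). This is how a
threshold independent of `L` and `Lstar` can dominate the bias. -/
lemma relBias_le_of_log {c lam : ℝ} (hd : 1 ≤ dn n) (hLs : 0 ≤ Lstar)
    (hγ : 0 < γ) (hγ2 : γ ≤ 2) (hcβ : 10 * c ≤ 2 * Real.log (dn n) * (β - γ))
    (hγβ : γ ≤ β)
    (h1 : Lstar * Real.exp (-c) ≤ lam / 4) (h2 : 5 * L / ε / Real.log n ≤ lam / 4) :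
    relBias n ε L Lstar β γ ≤ lam / 2 := by
  have h3 : bandwidth n γ ^ (β - γ) ≤ Real.exp (-c) := by
    refine (bandwidth_rpow_le hd hγ hγ2 (by linarith)).trans ?_
    rw [Real.rpow_def_of_pos (by linarith)]
    refine Real.exp_le_exp.2 ?_
    linarith
  have h4 := mul_le_mul_of_nonneg_left h3 hLs
  unfold relBias
  linarith

end ErrorBounds

/-! ### The selection rule -/

section Selection

variable {n : ℕ} {z₀ ε βlow βup lam θ : ℝ} {y : ℕ → ℝ}

lemma rate_mono {β γ : ℝ} (hd : 1 ≤ dn n) (hβ : 0 < β) (hβγ : β ≤ γ) : rate n β ≤ rate n γ := by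
  refine Real.rpow_le_rpow_of_exponent_le hd ?_
  rw [div_le_div_iff₀ (by linarith) (by linarith)]
  nlinarith

lemma gridBeta_mono (hβ : βlow ≤ βup) : Monotone (gridBeta n βlow βup) := by
  intro j k hjk
  have : (j : ℝ) ≤ k := by exact_mod_cast hjk
  have h2 : 0 ≤ βup - βlow := by linarith
  unfold gridBeta
  gcongr

lemma gridBeta_zero : gridBeta n βlow βup 0 = βlow := by simp [gridBeta]

lemma gridSize_pos : 0 < gridSize n := Nat.succ_pos _

lemma gridBeta_gridSize : gridBeta n βlow βup (gridSize n) = βup := by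
  have : (gridSize n : ℝ) ≠ 0 := by exact_mod_cast (gridSize_pos (n := n)).ne'
  rw [gridBeta, div_self this]
  ring

lemma gridBeta_mem (hβ : βlow ≤ βup) {k : ℕ} (hk : k ≤ gridSize n) :
    gridBeta n βlow βup k ∈ Set.Icc βlow βup := by
  refine ⟨?_, ?_⟩
  · conv_lhs => rw [← gridBeta_zero (n := n) (βlow := βlow) (βup := βup)]
    exact gridBeta_mono hβ (Nat.zero_le k)
  · conv_rhs => rw [← gridBeta_gridSize (n := n) (βlow := βlow) (βup := βup)]
    exact gridBeta_mono hβ hk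

lemma omega_le_iff {k : ℕ} {c : ℝ} : omega n z₀ ε βlow βup lam y k ≤ c ↔ ∀ j ≤ k,
    |gridEst n z₀ ε βlow βup y j - gridEst n z₀ ε βlow βup y k| -
      lam / rate n (gridBeta n βlow βup j) ≤ c := by
  unfold omega
  rw [Finset.sup'_le_iff]
  simp only [Finset.mem_range, Nat.lt_succ_iff]

lemma selectedIndex_le : selectedIndex n z₀ ε βlow βup lam y ≤ gridSize n :=
  Nat.findGreatest_le _

lemma omega_selectedIndex_le (hd : 0 < dn n) (hlam : 0 < lam) :
    omega n z₀ ε βlow βup lam y (selectedIndex n z₀ ε βlow βup lam y) ≤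
      lam / rate n (gridBeta n βlow βup (selectedIndex n z₀ ε βlow βup lam y)) := by
  classical
  have h0 : omega n z₀ ε βlow βup lam y 0 ≤ lam / rate n (gridBeta n βlow βup 0) := by
    rw [omega_le_iff]
    intro j hj
    obtain rfl : j = 0 := by omega
    have : 0 < rate n (gridBeta n βlow βup 0) := rate_pos hd
    have : 0 < lam / rate n (gridBeta n βlow βup 0) := by positivity
    rw [sub_self, abs_zero]
    linarith
  exact Nat.findGreatest_spec (P := fun k => omega n z₀ ε βlow βup lam y k ≤
    lam / rate n (gridBeta n βlow βup k)) (Nat.zero_le _) h0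

/-- If an index is not larger than the selected one, then its estimator is close to the selected
estimator. -/
lemma abs_gridEst_selectedIndex_sub_le (hd : 1 ≤ dn n) (hlam : 0 < lam) (hβlow : 0 < βlow)
    (hβ : βlow ≤ βup) {k : ℕ} (hk : k ≤ selectedIndex n z₀ ε βlow βup lam y) :
    |gridEst n z₀ ε βlow βup y (selectedIndex n z₀ ε βlow βup lam y) - θ| ≤
      2 * lam / rate n (gridBeta n βlow βup k) + |gridEst n z₀ ε βlow βup y k - θ| := by
  have h1 := (omega_le_iff.1 (omega_selectedIndex_le (z₀ := z₀) (ε := ε) (βlow := βlow)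
    (βup := βup) (y := y) (by linarith) hlam)) k hk
  set s := selectedIndex n z₀ ε βlow βup lam y
  have hkm := gridBeta_mem (n := n) hβ (hk.trans selectedIndex_le)
  have hN : 0 < rate n (gridBeta n βlow βup k) := rate_pos (by linarith)
  have h2 : lam / rate n (gridBeta n βlow βup s) ≤ lam / rate n (gridBeta n βlow βup k) :=
    div_le_div_of_nonneg_left hlam.le hN
      (rate_mono hd (by linarith [hkm.1]) (gridBeta_mono hβ hk))
  have h3 := abs_sub_le (gridEst n z₀ ε βlow βup y s) (gridEst n z₀ ε βlow βup y k) θ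
  rw [abs_sub_comm (gridEst n z₀ ε βlow βup y s) (gridEst n z₀ ε βlow βup y k)] at h3
  rw [mul_div_assoc]
  linarith

/-- If the selected index is smaller than `k`, then one of the first estimators is far from the
target. -/
lemma exists_le_abs_gridEst_sub {k : ℕ} (hkm : k ≤ gridSize n)
    (hk : selectedIndex n z₀ ε βlow βup lam y < k) :
    ∃ j ≤ k, lam / rate n (gridBeta n βlow βup j) ≤ |gridEst n z₀ ε βlow βup y j - θ| := by
  classical
  have h1 : ¬ omega n z₀ ε βlow βup lam y k ≤ lam / rate n (gridBeta n βlow βup k) :=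
    Nat.findGreatest_is_greatest (P := fun k => omega n z₀ ε βlow βup lam y k ≤
      lam / rate n (gridBeta n βlow βup k)) hk hkm
  by_contra! hcon
  refine h1 (omega_le_iff.2 fun j hj => ?_)
  have h2 := abs_sub_le (gridEst n z₀ ε βlow βup y j) θ (gridEst n z₀ ε βlow βup y k)
  rw [abs_sub_comm θ] at h2
  linarith [hcon j hj, hcon k le_rfl]

end Selection

/-- Expectation bound from a pointwise bound by squares and indicators. -/
lemma lintegral_ofReal_le_of_pointwise {Ω : Type*} [MeasurableSpace Ω] {μ : Measure Ω}
    [IsProbabilityMeasure μ] {X Z₁ Z₂ : Ω → ℝ} {U₁ U₂ F : Set Ω}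
    {A c₁ c₂ e₁ e₂ B v₁ v₂ p₁ p₂ q : ℝ} (hZ₁ : Measurable Z₁) (hZ₂ : Measurable Z₂)
    (hA : 0 ≤ A) (hc₁ : 0 ≤ c₁) (hc₂ : 0 ≤ c₂) (he₁ : 0 ≤ e₁) (he₂ : 0 ≤ e₂) (hB : 0 ≤ B)
    (hv₁ : 0 ≤ v₁) (hv₂ : 0 ≤ v₂) (hp₁ : 0 ≤ p₁) (hp₂ : 0 ≤ p₂) (hq : 0 ≤ q)
    (hX : ∀ ω, X ω ≤ A + c₁ * Z₁ ω ^ 2 + c₂ * Z₂ ω ^ 2 + U₁.indicator (fun _ => e₁) ω +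
      U₂.indicator (fun _ => e₂) ω + F.indicator (fun _ => B) ω)
    (hZv₁ : ∫⁻ ω, ENNReal.ofReal (Z₁ ω ^ 2) ∂μ ≤ ENNReal.ofReal v₁)
    (hZv₂ : ∫⁻ ω, ENNReal.ofReal (Z₂ ω ^ 2) ∂μ ≤ ENNReal.ofReal v₂)
    (hU₁ : μ U₁ ≤ ENNReal.ofReal p₁) (hU₂ : μ U₂ ≤ ENNReal.ofReal p₂)
    (hF : μ F ≤ ENNReal.ofReal q) :
    ∫⁻ ω, ENNReal.ofReal (X ω) ∂μ ≤
      ENNReal.ofReal (A + c₁ * v₁ + c₂ * v₂ + e₁ * p₁ + e₂ * p₂ + B * q) := by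
  -- Passing to measurable hulls avoids proving that the exceptional events are measurable.
  have hind : ∀ {U : Set Ω} {e : ℝ} {ω : Ω}, 0 ≤ e →
      ENNReal.ofReal (U.indicator (fun _ => e) ω) ≤
        (toMeasurable μ U).indicator (fun _ => ENNReal.ofReal e) ω := by
    intro U e ω _
    by_cases hω : ω ∈ U
    · simp [hω, subset_toMeasurable μ U hω]
    · simp [hω]
  have hpt : ∀ ω, ENNReal.ofReal (X ω) ≤ ENNReal.ofReal A + ENNReal.ofReal c₁ *
      ENNReal.ofReal (Z₁ ω ^ 2) + ENNReal.ofReal c₂ * ENNReal.ofReal (Z₂ ω ^ 2) +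
      (toMeasurable μ U₁).indicator (fun _ => ENNReal.ofReal e₁) ω +
      (toMeasurable μ U₂).indicator (fun _ => ENNReal.ofReal e₂) ω +
      (toMeasurable μ F).indicator (fun _ => ENNReal.ofReal B) ω := by
    intro ω
    refine (ENNReal.ofReal_le_ofReal (hX ω)).trans ?_
    rw [← ENNReal.ofReal_mul hc₁, ← ENNReal.ofReal_mul hc₂]
    refine ENNReal.ofReal_add_le.trans (add_le_add ?_ (hind hB))
    refine ENNReal.ofReal_add_le.trans (add_le_add ?_ (hind he₂))
    refine ENNReal.ofReal_add_le.trans (add_le_add ?_ (hind he₁))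
    exact ENNReal.ofReal_add_le.trans (add_le_add ENNReal.ofReal_add_le le_rfl)
  have hprod : ∀ {c v : ℝ} {x : ENNReal}, 0 ≤ c → x ≤ ENNReal.ofReal v →
      ENNReal.ofReal c * x ≤ ENNReal.ofReal (c * v) := by
    intro c v x hc hx
    rw [ENNReal.ofReal_mul hc]
    gcongr
  have hi : ∀ {U : Set Ω} {e p : ℝ}, 0 ≤ e → μ U ≤ ENNReal.ofReal p →
      ∫⁻ ω, (toMeasurable μ U).indicator (fun _ => ENNReal.ofReal e) ω ∂μ ≤
        ENNReal.ofReal (e * p) := fun {U _ _} he hU =>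
    (lintegral_indicator_const_le _ _).trans (hprod he ((measure_toMeasurable U).trans_le hU))
  have hm : ∀ (U : Set Ω) (e : ENNReal), Measurable ((toMeasurable μ U).indicator fun _ => e) :=
    fun U e => measurable_const.indicator (measurableSet_toMeasurable μ U)
  have m₁ : Measurable fun ω => ENNReal.ofReal (Z₁ ω ^ 2) := by fun_prop
  have m₂ : Measurable fun ω => ENNReal.ofReal (Z₂ ω ^ 2) := by fun_prop
  refine (lintegral_mono hpt).trans ?_
  rw [lintegral_add_right _ (hm _ _), lintegral_add_right _ (hm _ _),
    lintegral_add_right _ (hm _ _), lintegral_add_right _ (m₂.const_mul _),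
    lintegral_add_right _ (m₁.const_mul _), lintegral_const_mul _ m₁, lintegral_const_mul _ m₂,
    lintegral_const, measure_univ, mul_one, ENNReal.ofReal_add (by positivity) (by positivity),
    ENNReal.ofReal_add (by positivity) (by positivity),
    ENNReal.ofReal_add (by positivity) (by positivity),
    ENNReal.ofReal_add (by positivity) (by positivity),
    ENNReal.ofReal_add hA (by positivity)]
  exact add_le_add (add_le_add (add_le_add (add_le_add (add_le_add le_rfl (hprod hc₁ hZv₁))
    (hprod hc₂ hZv₂)) (hi he₁ hU₁)) (hi he₂ hU₂)) (hi hB hF)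

/-! ### Risk of the adaptive estimator -/

lemma log_dn_lt_gridSize {n : ℕ} : Real.log (dn n) < gridSize n := by
  unfold gridSize
  push_cast
  exact Nat.lt_floor_add_one _

lemma gridSize_le_log_dn_add_one {n : ℕ} (h : 0 ≤ Real.log (dn n)) :
    (gridSize n : ℝ) ≤ Real.log (dn n) + 1 := by
  have := Nat.floor_le h
  unfold gridSize
  push_cast
  linarith

/-- Every regularity is approximated from below by a point of the grid, which is either the first
one or leaves a prescribed gap. -/
lemma exists_gridBeta_le {n : ℕ} {βlow βup β r : ℝ} (hβ' : βlow < βup)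
    (hβ : β ∈ Set.Icc βlow βup) (hr : 0 ≤ r) : ∃ k ≤ gridSize n, gridBeta n βlow βup k ≤ β ∧
      β - gridBeta n βlow βup k ≤ (r + 1) * (βup - βlow) / gridSize n ∧
      (k ≠ 0 → r * (βup - βlow) / gridSize n ≤ β - gridBeta n βlow βup k) := by
  have hm : (0 : ℝ) < gridSize n := by exact_mod_cast gridSize_pos
  have hΔ : 0 < βup - βlow := by linarith
  set m : ℝ := (gridSize n : ℝ) with hmdef
  -- `t` is the position of β in grid steps and k = ⌊t - r⌋₊. If t < r the natural floor returns the
  -- first grid point, where no gap is claimed.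
  set t : ℝ := (β - βlow) * m / (βup - βlow) with ht
  have hβt : β = βlow + t / m * (βup - βlow) := by
    rw [ht]; field_simp; ring
  have ht0 : 0 ≤ t := div_nonneg (mul_nonneg (by linarith [hβ.1]) hm.le) hΔ.le
  have htm : t ≤ m := by
    rw [ht, div_le_iff₀ hΔ]
    nlinarith [hβ.2]
  have hgap : ∀ k : ℕ, β - gridBeta n βlow βup k = (t - k) * (βup - βlow) / m := by
    intro k
    rw [gridBeta, ← hmdef]
    conv_lhs => rw [hβt]
    ring
  have hk1 := Nat.lt_floor_add_one (t - r)
  have hkt : (⌊t - r⌋₊ : ℝ) ≤ t := by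
    rcases le_or_gt 0 (t - r) with h | h
    · linarith [Nat.floor_le h]
    · rw [Nat.floor_of_nonpos h.le]; simpa using ht0
  refine ⟨⌊t - r⌋₊, ?_, ?_, ?_, fun hk => ?_⟩
  · exact (Nat.cast_le (α := ℝ)).1 (hkt.trans htm)
  · rw [← sub_nonneg, hgap]
    have : 0 ≤ t - ⌊t - r⌋₊ := by linarith
    positivity
  · rw [hgap]
    gcongr
    linarith
  · rw [hgap]
    have h1 : 0 ≤ t - r := by
      by_contra! hcon
      exact hk (Nat.floor_of_nonpos hcon.le)
    have := Nat.floor_le h1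
    gcongr
    linarith

section Risk

variable {n : ℕ} {z₀ y₀ ε L Lstar βlow βup lam β C : ℝ} {S : ℝ → ℝ}

/-- The stochastic term of the estimator tuned to the `j`-th grid point. -/
def gridNoise (n : ℕ) (z₀ y₀ ε βlow βup : ℝ) (S : ℝ → ℝ) (j : ℕ) (ξ : ℕ → ℝ) : ℝ :=
  noiseTerm n z₀ ε (bandwidth n (gridBeta n βlow βup j)) (gridBeta n βlow βup j - 1) S y₀ ξ

/-- The event where the estimator tuned to the `j`-th grid point is under control. -/
def gridGood (n : ℕ) (z₀ y₀ ε βlow βup : ℝ) (S : ℝ → ℝ) (j : ℕ) : Set (ℕ → ℝ) :=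
  goodEvent n z₀ ε (bandwidth n (gridBeta n βlow βup j)) (gridBeta n βlow βup j - 1)
    (pathBound n y₀ ε) S y₀

/-- The event where one of the first estimators has a large stochastic error. -/
def gridDeviation (n : ℕ) (z₀ y₀ ε βlow βup lam : ℝ) (S : ℝ → ℝ) (k : ℕ) : Set (ℕ → ℝ) :=
  ⋃ j ∈ Finset.range (k + 1), ((gridGood n z₀ y₀ ε βlow βup S j)ᶜ ∪
    {ξ | lam / 2 / rate n (gridBeta n βlow βup j) ≤ |gridNoise n z₀ y₀ ε βlow βup S j ξ|})

lemma measurable_gridNoise (j : ℕ) : Measurable (gridNoise n z₀ y₀ ε βlow βup S j) :=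
  measurable_noiseTerm

/-- With nh = N_j² ln n the level λ/(2N_j) has Gaussian exponent (λ²/8) ln n, the same for every j;
a union bound over the k + 1 indices follows. -/
lemma measure_gridDeviation_le (hd : 0 < dn n) (hn : 1 < n) (hβlow : 0 < βlow)
    (hβ' : βlow ≤ βup) (hε : ε ∈ Set.Ioo (0 : ℝ) 1) (hlam : 0 ≤ lam)
    (hctl : UniformControl n z₀ y₀ ε L βlow βup C)
    (hS : ∀ x ∈ Set.Icc (0 : ℝ) 1, |S x| ≤ 1 - ε) {k : ℕ} (hk : k ≤ gridSize n) {q : ℝ}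
    (hq : ∀ j ≤ k, C * (Real.log n * bandwidth n (gridBeta n βlow βup j) ^ 2) +
      2 * Real.exp (-(lam ^ 2 / 8 * Real.log n)) ≤ q) (hC : 0 ≤ C) :
    noiseLaw (gridDeviation n z₀ y₀ ε βlow βup lam S k) ≤
      ENNReal.ofReal (((k : ℝ) + 1) * q) := by
  have hl : 0 ≤ Real.log n := Real.log_nonneg (by exact_mod_cast hn.le)
  have h1 : ∀ j ∈ Finset.range (k + 1), noiseLaw ((gridGood n z₀ y₀ ε βlow βup S j)ᶜ ∪
      {ξ | lam / 2 / rate n (gridBeta n βlow βup j) ≤ |gridNoise n z₀ y₀ ε βlow βup S j ξ|}) ≤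
      ENNReal.ofReal q := by
    intro j hj
    have hjk : j ≤ k := by have := Finset.mem_range.1 hj; omega
    have hmem := gridBeta_mem (n := n) hβ' (hjk.trans hk)
    obtain ⟨hA, -, hbad⟩ := hctl _ hmem
    have hγ : 0 < gridBeta n βlow βup j := by linarith [hmem.1]
    have hN : 0 < rate n (gridBeta n βlow βup j) := rate_pos hd
    refine (measure_union_le _ _).trans ?_
    refine le_trans (add_le_add (hbad S hS) (hA.measure_noiseTerm_ge_le hε (by positivity))) ?_
    rw [← ENNReal.ofReal_add (by positivity) (by positivity)]
    refine ENNReal.ofReal_le_ofReal (le_trans (le_of_eq ?_) (hq j hjk))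
    rw [mul_bandwidth_eq hd hn hγ]
    congr 3
    field_simp
    ring
  refine (measure_biUnion_finset_le _ _).trans ((Finset.sum_le_sum h1).trans_eq ?_)
  rw [Finset.sum_const, Finset.card_range, nsmul_eq_mul, ENNReal.ofReal_mul (by positivity)]
  congr 1
  rw [← Nat.cast_succ, ENNReal.ofReal_natCast]

lemma abs_gridEst_sub_le (hd : 0 < dn n) (hβ' : βlow ≤ βup) (hz₀ : z₀ ∈ Set.Ioo (0 : ℝ) 1)
    (hε : ε ∈ Set.Ioo (0 : ℝ) 1) (hLs : 0 ≤ Lstar) (hβ : 1 < β)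
    (hctl : UniformControl n z₀ y₀ ε L βlow βup C) (hS : S ∈ holderClass z₀ ε L Lstar β)
    {j : ℕ} (hj : j ≤ gridSize n) {ξ : ℕ → ℝ} (hξ : ξ ∈ gridGood n z₀ y₀ ε βlow βup S j) :
    |gridEst n z₀ ε βlow βup (obsPath n S y₀ ξ) j - S z₀| ≤
      relBias n ε L Lstar β (gridBeta n βlow βup j) / rate n (gridBeta n βlow βup j) +
        |gridNoise n z₀ y₀ ε βlow βup S j ξ| :=
  abs_seqEst_bandwidth_sub_le hd (hctl _ (gridBeta_mem hβ' hj)).1 hz₀ hε hLs hβ hS hξ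

/-- Off the good event the crude bound 2 + |noise| replaces the bias, so only the constant 2 needs
the indicator. -/
lemma abs_gridEst_sub_le_indicator (hd : 0 < dn n) (hβ' : βlow ≤ βup)
    (hz₀ : z₀ ∈ Set.Ioo (0 : ℝ) 1)
    (hε : ε ∈ Set.Ioo (0 : ℝ) 1) (hLs : 0 ≤ Lstar) (hβ : 1 < β)
    (hctl : UniformControl n z₀ y₀ ε L βlow βup C) (hS : S ∈ holderClass z₀ ε L Lstar β)
    {j : ℕ} (hj : j ≤ gridSize n) {b : ℝ} (hb0 : 0 ≤ b)
    (hb : relBias n ε L Lstar β (gridBeta n βlow βup j) ≤ b) (ξ : ℕ → ℝ) :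
    |gridEst n z₀ ε βlow βup (obsPath n S y₀ ξ) j - S z₀| ≤
      b / rate n (gridBeta n βlow βup j) + |gridNoise n z₀ y₀ ε βlow βup S j ξ| +
        (gridGood n z₀ y₀ ε βlow βup S j)ᶜ.indicator (fun _ => 2) ξ := by
  have hN : 0 < rate n (gridBeta n βlow βup j) := rate_pos hd
  by_cases hξ : ξ ∈ gridGood n z₀ y₀ ε βlow βup S j
  · rw [Set.indicator_of_notMem (by simpa using hξ), add_zero]
    refine (abs_gridEst_sub_le hd hβ' hz₀ hε hLs hβ hctl hS hj hξ).trans ?_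
    gcongr
  · rw [Set.indicator_of_mem (by simpa using hξ)]
    have h1 := (hctl _ (gridBeta_mem hβ' hj)).1.abs_seqEst_obsPath_sub_le_two (y₀ := y₀) (ξ := ξ)
      hz₀ hε hS
    have h2 : 0 ≤ b / rate n (gridBeta n βlow βup j) := by positivity
    unfold gridEst gridNoise
    linarith

/-- Pointwise bound for the error of the adaptive estimator. -/
lemma abs_gridEst_selectedIndex_sub_le_indicator (hd : 1 ≤ dn n) (hβlow : 0 < βlow)
    (hβ' : βlow ≤ βup) (hz₀ : z₀ ∈ Set.Ioo (0 : ℝ) 1)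
    (hε : ε ∈ Set.Ioo (0 : ℝ) 1) (hLs : 0 ≤ Lstar) (hβ : 1 < β) (hlam : 0 < lam)
    (hctl : UniformControl n z₀ y₀ ε L βlow βup C) (hS : S ∈ holderClass z₀ ε L Lstar β)
    {k : ℕ} (hk : k ≤ gridSize n)
    (hbias : k ≠ 0 → ∀ j ≤ k, relBias n ε L Lstar β (gridBeta n βlow βup j) ≤ lam / 2)
    (ξ : ℕ → ℝ) :
    |gridEst n z₀ ε βlow βup (obsPath n S y₀ ξ)
        (selectedIndex n z₀ ε βlow βup lam (obsPath n S y₀ ξ)) - S z₀| ≤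
      2 * lam / rate n (gridBeta n βlow βup k) +
        |gridEst n z₀ ε βlow βup (obsPath n S y₀ ξ) k - S z₀| +
      (gridDeviation n z₀ y₀ ε βlow βup lam S k).indicator (fun ξ =>
        2 * lam / rate n (gridBeta n βlow βup 0) +
        |gridEst n z₀ ε βlow βup (obsPath n S y₀ ξ) 0 - S z₀|) ξ := by
  have hN : ∀ j, 0 < rate n (gridBeta n βlow βup j) := fun j => rate_pos (by linarith)
  rcases le_or_gt k (selectedIndex n z₀ ε βlow βup lam (obsPath n S y₀ ξ)) with hks | hks
  · refine (abs_gridEst_selectedIndex_sub_le hd hlam hβlow hβ' hks).trans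
      (le_add_of_nonneg_right ?_)
    refine Set.indicator_nonneg (fun ξ _ => ?_) ξ
    have := hN 0
    positivity
  · have hmem : ξ ∈ gridDeviation n z₀ y₀ ε βlow βup lam S k := by
      obtain ⟨j, hjk, hj⟩ := exists_le_abs_gridEst_sub (θ := S z₀) hk hks
      unfold gridDeviation
      simp only [Set.mem_iUnion, Finset.mem_range]
      refine ⟨j, by omega, ?_⟩
      by_contra hcon
      rw [Set.mem_union, not_or, Set.mem_compl_iff, not_not, Set.mem_ofPred_eq, not_le] at hcon
      have h1 := abs_gridEst_sub_le (by linarith) hβ' hz₀ hε hLs hβ hctl hS (hjk.trans hk) hcon.1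
      have h2 : relBias n ε L Lstar β (gridBeta n βlow βup j) / rate n (gridBeta n βlow βup j) ≤
          lam / 2 / rate n (gridBeta n βlow βup j) :=
        div_le_div_of_nonneg_right (hbias (by omega) j hjk) (hN j).le
      have h3 : lam / rate n (gridBeta n βlow βup j) = lam / 2 / rate n (gridBeta n βlow βup j) +
          lam / 2 / rate n (gridBeta n βlow βup j) := by ring
      linarith [hcon.2]
    rw [Set.indicator_of_mem hmem]
    -- When too small an index is selected, the fallback is comparison with index 0, which never
    -- exceeds the selected one.
    have h1 := abs_gridEst_selectedIndex_sub_le (z₀ := z₀) (ε := ε) (θ := S z₀)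
      (y := obsPath n S y₀ ξ) hd hlam hβlow hβ' (Nat.zero_le _)
    have h2 : 0 ≤ 2 * lam / rate n (gridBeta n βlow βup k) := by
      have := hN k
      positivity
    have h3 := abs_nonneg (gridEst n z₀ ε βlow βup (obsPath n S y₀ ξ) k - S z₀)
    linarith

/-- Algebra behind the risk bound: `N`, `P`, `N₀` are rates, `X`, `E`, `E₀` errors. -/
lemma scaled_error_le {N P N₀ X E E₀ z w i u v lam b ρ D : ℝ} (hN : 0 ≤ N) (hP : 0 < P)
    (hN₀ : 0 < N₀) (hρ : N ≤ ρ * P) (hD : N ≤ D * N₀) (hlam : 0 ≤ lam) (hb : 0 ≤ b) (hD1 : 1 ≤ D)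
    (hi : i = 0 ∨ i = 1) (hv : 0 ≤ v)
    (hX : X ≤ 2 * lam / P + E + i * (2 * lam / N₀ + E₀)) (hE : E ≤ b / P + |z| + u)
    (hE₀ : E₀ ≤ b / N₀ + |w| + v) :
    N * X ≤ ρ * (2 * lam + b + 1 / 2) + ρ / 2 * P ^ 2 * z ^ 2 + 1 / 2 * N₀ ^ 2 * w ^ 2 + N * u +
      N * v + i * (D ^ 2 * (2 * lam + b + 1 / 2)) := by
  have hρ0 : 0 ≤ ρ := by
    by_contra! h
    nlinarith
  have h1 : N * (2 * lam / P + E) ≤ ρ * (2 * lam + b + 1 / 2) + ρ / 2 * P ^ 2 * z ^ 2 + N * u := by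
    have h2 : N * ((2 * lam + b) / P + |z|) ≤ ρ * P * ((2 * lam + b) / P + |z|) :=
      mul_le_mul_of_nonneg_right hρ (by positivity)
    have h3 : ρ * P * ((2 * lam + b) / P + |z|) = ρ * (2 * lam + b) + ρ * (P * |z|) := by
      field_simp
    have h4 : P * |z| ≤ 1 / 2 + 1 / 2 * P ^ 2 * z ^ 2 := by
      rw [← sq_abs z]
      nlinarith [sq_nonneg (P * |z| - 1)]
    have h5 := mul_le_mul_of_nonneg_left h4 hρ0
    have h6 : N * (2 * lam / P + E) ≤ N * ((2 * lam + b) / P + |z|) + N * u := by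
      rw [← mul_add]
      refine mul_le_mul_of_nonneg_left ?_ hN
      rw [add_div]
      linarith
    linarith
  have h7 : N * (i * (2 * lam / N₀ + E₀)) ≤ 1 / 2 * N₀ ^ 2 * w ^ 2 + N * v +
      i * (D ^ 2 * (2 * lam + b + 1 / 2)) := by
    have hv' : 0 ≤ N * v := mul_nonneg hN hv
    rcases hi with rfl | rfl
    · have : 0 ≤ 1 / 2 * N₀ ^ 2 * w ^ 2 := by positivity
      linarith
    · have h2 : N * ((2 * lam + b) / N₀ + |w|) ≤ D * N₀ * ((2 * lam + b) / N₀ + |w|) :=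
        mul_le_mul_of_nonneg_right hD (by positivity)
      have h3 : D * N₀ * ((2 * lam + b) / N₀ + |w|) = D * (2 * lam + b) + D * (N₀ * |w|) := by
        field_simp
      -- This plays the role of Cauchy–Schwarz: the loss D² multiplies only the deviation indicator,
      -- while the normalised noise keeps a bounded second moment.
      have h4 : D * (N₀ * |w|) ≤ 1 / 2 * D ^ 2 + 1 / 2 * N₀ ^ 2 * w ^ 2 := by
        rw [← sq_abs w]
        nlinarith [sq_nonneg (D - N₀ * |w|)]
      have h5 : D * (2 * lam + b) ≤ D ^ 2 * (2 * lam + b) := by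
        refine mul_le_mul_of_nonneg_right ?_ (by positivity)
        nlinarith
      have h6 : N * (2 * lam / N₀ + E₀) ≤ N * ((2 * lam + b) / N₀ + |w|) + N * v := by
        rw [← mul_add]
        refine mul_le_mul_of_nonneg_left ?_ hN
        rw [add_div]
        linarith
      linarith
  calc N * X ≤ N * (2 * lam / P + E + i * (2 * lam / N₀ + E₀)) :=
        mul_le_mul_of_nonneg_left hX hN
    _ = N * (2 * lam / P + E) + N * (i * (2 * lam / N₀ + E₀)) := by ring
    _ ≤ _ := by linarith

/-- Risk bound for the adaptive estimator at a fixed sample size. -/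
lemma rate_mul_lintegral_le {b ρ D q : ℝ} (hd : 1 ≤ dn n) (hn : 1 < n) (hl : 1 ≤ Real.log n)
    (hβlow : 1 < βlow) (hβ' : βlow ≤ βup) (hz₀ : z₀ ∈ Set.Ioo (0 : ℝ) 1)
    (hε : ε ∈ Set.Ioo (0 : ℝ) 1) (hLs : 0 ≤ Lstar) (hβ : 1 < β) (hlam : 0 < lam) (hC : 0 ≤ C)
    (hctl : UniformControl n z₀ y₀ ε L βlow βup C) (hS : S ∈ holderClass z₀ ε L Lstar β)
    {k : ℕ} (hk : k ≤ gridSize n)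
    (hbias : k ≠ 0 → ∀ j ≤ k, relBias n ε L Lstar β (gridBeta n βlow βup j) ≤ lam / 2)
    (hb : ∀ j ≤ k, relBias n ε L Lstar β (gridBeta n βlow βup j) ≤ b) (hb0 : 0 ≤ b)
    (hρ : rate n β ≤ ρ * rate n (gridBeta n βlow βup k)) (hD : rate n β ≤ D * rate n βlow)
    (hD1 : 1 ≤ D) (hNh : rate n β * (Real.log n * bandwidth n βlow ^ 2) ≤ 1)
    (hq : ∀ j ≤ k, C * (Real.log n * bandwidth n (gridBeta n βlow βup j) ^ 2) +
      2 * Real.exp (-(lam ^ 2 / 8 * Real.log n)) ≤ q) (hDq : D ^ 2 * ((k + 1) * q) ≤ 2) :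
    ENNReal.ofReal (rate n β) * ∫⁻ ξ, ENNReal.ofReal |gridEst n z₀ ε βlow βup (obsPath n S y₀ ξ)
        (selectedIndex n z₀ ε βlow βup lam (obsPath n S y₀ ξ)) - S z₀| ∂noiseLaw ≤
      ENNReal.ofReal (ρ * (2 * lam + b + 1 / 2) + 4 * ρ + 4 + 2 * ρ * C + 2 * C +
        2 * (2 * lam + b + 1 / 2)) := by
  have hd0 : 0 < dn n := by linarith
  have hN : 0 < rate n β := rate_pos hd0
  have hρ0 : 0 < ρ := by
    by_contra! h
    nlinarith [rate_pos (β := gridBeta n βlow βup k) hd0]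
  have hγ : ∀ j ≤ k, 0 < gridBeta n βlow βup j := fun j hj => by
    linarith [(gridBeta_mem (n := n) hβ' (hj.trans hk)).1]
  have hq0 : 0 ≤ q := le_trans (by positivity) (hq 0 (Nat.zero_le k))
  have hvar : ∀ j ≤ k, ∫⁻ ξ, ENNReal.ofReal (gridNoise n z₀ y₀ ε βlow βup S j ξ ^ 2) ∂noiseLaw ≤
      ENNReal.ofReal (8 / (rate n (gridBeta n βlow βup j) ^ 2 * Real.log n)) := by
    intro j hj
    rw [← mul_bandwidth_eq hd0 hn (hγ j hj)]
    exact (hctl _ (gridBeta_mem hβ' (hj.trans hk))).1.lintegral_noiseTerm_sq_le hε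
  have hbad : ∀ j ≤ k, noiseLaw (gridGood n z₀ y₀ ε βlow βup S j)ᶜ ≤
      ENNReal.ofReal (C * (Real.log n * bandwidth n (gridBeta n βlow βup j) ^ 2)) := fun j hj =>
    (hctl _ (gridBeta_mem hβ' (hj.trans hk))).2.2 S hS.1.2.1
  have hdev := measure_gridDeviation_le hd0 hn (by linarith) hβ' hε hlam.le hctl hS.1.2.1 hk hq hC
  have hP : 0 < rate n (gridBeta n βlow βup k) := rate_pos hd0
  have hN₀ : 0 < rate n (gridBeta n βlow βup 0) := rate_pos hd0
  have hpt : ∀ ξ : ℕ → ℝ, rate n β * |gridEst n z₀ ε βlow βup (obsPath n S y₀ ξ)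
      (selectedIndex n z₀ ε βlow βup lam (obsPath n S y₀ ξ)) - S z₀| ≤
      ρ * (2 * lam + b + 1 / 2) +
      ρ / 2 * rate n (gridBeta n βlow βup k) ^ 2 * gridNoise n z₀ y₀ ε βlow βup S k ξ ^ 2 +
      1 / 2 * rate n (gridBeta n βlow βup 0) ^ 2 * gridNoise n z₀ y₀ ε βlow βup S 0 ξ ^ 2 +
      (gridGood n z₀ y₀ ε βlow βup S k)ᶜ.indicator (fun _ => rate n β * 2) ξ +
      (gridGood n z₀ y₀ ε βlow βup S 0)ᶜ.indicator (fun _ => rate n β * 2) ξ +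
      (gridDeviation n z₀ y₀ ε βlow βup lam S k).indicator
        (fun _ => D ^ 2 * (2 * lam + b + 1 / 2)) ξ := by
    intro ξ
    have h1 := abs_gridEst_selectedIndex_sub_le_indicator hd (by linarith) hβ' hz₀ hε hLs hβ hlam
      hctl hS hk hbias ξ
    have h2 := abs_gridEst_sub_le_indicator hd0 hβ' hz₀ hε hLs hβ hctl hS hk hb0 (hb k le_rfl) ξ
    have h3 := abs_gridEst_sub_le_indicator hd0 hβ' hz₀ hε hLs hβ hctl hS (Nat.zero_le _) hb0
      (hb 0 (Nat.zero_le k)) ξ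
    have e1 : ∀ (U : Set (ℕ → ℝ)), U.indicator (fun _ => rate n β * 2) ξ =
        rate n β * U.indicator (fun _ => (2 : ℝ)) ξ := by
      intro U
      by_cases hU : ξ ∈ U <;> simp [hU]
    have e2 : ∀ (U : Set (ℕ → ℝ)) (f : (ℕ → ℝ) → ℝ), U.indicator f ξ =
        U.indicator (fun _ => (1 : ℝ)) ξ * f ξ := by
      intro U f
      by_cases hU : ξ ∈ U <;> simp [hU]
    rw [e1, e1, e2 (gridDeviation n z₀ y₀ ε βlow βup lam S k)]
    rw [e2 (gridDeviation n z₀ y₀ ε βlow βup lam S k)] at h1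
    refine scaled_error_le hN.le hP hN₀ hρ (by rwa [gridBeta_zero]) hlam.le hb0 hD1 ?_
      (Set.indicator_nonneg (fun _ _ => zero_le_two) _) h1 h2 h3
    by_cases hU : ξ ∈ gridDeviation n z₀ y₀ ε βlow βup lam S k <;> simp [hU]
  rw [← lintegral_const_mul' _ _ ENNReal.ofReal_ne_top]
  simp only [← ENNReal.ofReal_mul hN.le]
  refine (lintegral_ofReal_le_of_pointwise (measurable_gridNoise k) (measurable_gridNoise 0)
    (by positivity) (by positivity) (by positivity) (by positivity) (by positivity)
    (by positivity) (by positivity) (by positivity) (by positivity) (by positivity)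
    (by positivity) hpt (hvar k le_rfl) (hvar 0 (Nat.zero_le k)) (hbad k le_rfl)
    (hbad 0 (Nat.zero_le k)) hdev).trans (ENNReal.ofReal_le_ofReal ?_)
  have t1 : ρ / 2 * rate n (gridBeta n βlow βup k) ^ 2 *
      (8 / (rate n (gridBeta n βlow βup k) ^ 2 * Real.log n)) ≤ 4 * ρ := by
    have : ρ / 2 * rate n (gridBeta n βlow βup k) ^ 2 *
      (8 / (rate n (gridBeta n βlow βup k) ^ 2 * Real.log n)) = 4 * ρ / Real.log n := by
      field_simp; ring
    rw [this]
    exact div_le_self (by positivity) hl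
  have t2 : 1 / 2 * rate n (gridBeta n βlow βup 0) ^ 2 *
      (8 / (rate n (gridBeta n βlow βup 0) ^ 2 * Real.log n)) ≤ 4 := by
    have : 1 / 2 * rate n (gridBeta n βlow βup 0) ^ 2 *
      (8 / (rate n (gridBeta n βlow βup 0) ^ 2 * Real.log n)) = 4 / Real.log n := by
      field_simp; ring
    rw [this]
    exact div_le_self (by positivity) hl
  have t3 : rate n β * 2 * (C * (Real.log n * bandwidth n (gridBeta n βlow βup k) ^ 2)) ≤
      2 * ρ * C := by
    have h1 := (hctl _ (gridBeta_mem hβ' hk)).2.1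
    have hh := bandwidth_pos (n := n) (β := gridBeta n βlow βup k) hd0
    -- The rate times the bad-event order h² ln n is h^(2-β_k) ln n, which the uniform control keeps
    -- below 1.
    have h2 : rate n (gridBeta n βlow βup k) * bandwidth n (gridBeta n βlow βup k) ^ 2 =
        bandwidth n (gridBeta n βlow βup k) ^ (2 - gridBeta n βlow βup k) := by
      rw [rate_eq hd0, Real.rpow_sub hh, inv_mul_eq_div, Real.rpow_two]
    calc _ = rate n β * (2 * C * Real.log n * bandwidth n (gridBeta n βlow βup k) ^ 2) := by ring
      _ ≤ ρ * rate n (gridBeta n βlow βup k) *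
          (2 * C * Real.log n * bandwidth n (gridBeta n βlow βup k) ^ 2) :=
          mul_le_mul_of_nonneg_right hρ (by positivity)
      _ = 2 * ρ * C * (Real.log n * (rate n (gridBeta n βlow βup k) *
          bandwidth n (gridBeta n βlow βup k) ^ 2)) := by ring
      _ ≤ 2 * ρ * C * 1 := by rw [h2]; gcongr
      _ = _ := mul_one _
  have t4 : rate n β * 2 * (C * (Real.log n * bandwidth n (gridBeta n βlow βup 0) ^ 2)) ≤
      2 * C := by
    rw [gridBeta_zero]
    calc _ = 2 * C * (rate n β * (Real.log n * bandwidth n βlow ^ 2)) := by ring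
      _ ≤ 2 * C * 1 := by gcongr
      _ = _ := mul_one _
  have t5 : D ^ 2 * (2 * lam + b + 1 / 2) * ((k + 1) * q) ≤ 2 * (2 * lam + b + 1 / 2) := by
    calc _ = D ^ 2 * ((k + 1) * q) * (2 * lam + b + 1 / 2) := by ring
      _ ≤ _ := by gcongr
  linarith

end Risk

/-! ### The upper bound -/

lemma dn_le_natCast {n : ℕ} (hl : 1 ≤ Real.log n) : dn n ≤ n :=
  div_le_self (Nat.cast_nonneg n) hl

lemma lamStar_sq {βlow βup : ℝ} (hβlow : 0 < βlow) (hβ : βlow ≤ βup) :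
    lamStar βlow βup ^ 2 = 32 * ((βup - βlow) / ((2 * βlow + 1) * (2 * βup + 1))) := by
  have h1 : 0 ≤ (βup - βlow) / ((2 * βlow + 1) * (2 * βup + 1)) :=
    div_nonneg (by linarith) (mul_nonneg (by linarith) (by linarith))
  rw [lamStar, mul_pow, mul_pow, Real.sq_sqrt h1, Real.sq_sqrt zero_le_two]
  ring

/-- Uniform bound for the relative rate of a regularity and a neighbouring grid point. -/
lemma rate_le_exp_mul_rate {n : ℕ} {β γ c : ℝ} (hd : 1 ≤ dn n) (hγ : 0 < γ) (hγβ : γ ≤ β)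
    (hc : Real.log (dn n) * (β - γ) ≤ c) : rate n β ≤ Real.exp c * rate n γ := by
  have hd0 : 0 < dn n := by linarith
  rw [← div_le_iff₀ (rate_pos hd0), rate_div_rate hd0 hγ (by linarith),
    Real.rpow_def_of_pos hd0]
  refine Real.exp_le_exp.2 (le_trans (mul_le_mul_of_nonneg_left ?_ (Real.log_nonneg hd)) hc)
  exact div_le_self (by linarith) (by nlinarith)

/-- Index 0 is used with the rate of a possibly much larger β. The product still decays: the rate
exponent is at most βup/(2βlow + 1), against 2/(2βlow + 1) from h². -/
lemma rate_mul_bandwidth_sq_le {n : ℕ} {βlow βup β : ℝ} (hd : 1 ≤ dn n) (hβlow : 0 < βlow)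
    (hβ : β ∈ Set.Icc βlow βup) (hβup : βup < 2) :
    rate n β * bandwidth n βlow ^ 2 ≤ dn n ^ (-((2 - βup) / 5)) := by
  have hd0 : 0 < dn n := by linarith
  have h1 : rate n β ≤ dn n ^ (βup / (2 * βlow + 1)) := by
    refine Real.rpow_le_rpow_of_exponent_le hd ?_
    have := hβ.1
    have := hβ.2
    exact div_le_div₀ (by linarith) (by linarith) (by linarith) (by linarith)
  rw [← Real.rpow_two, bandwidth_rpow hd0]
  refine (mul_le_mul_of_nonneg_right h1 (by positivity)).trans ?_
  rw [← Real.rpow_add hd0]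
  refine Real.rpow_le_rpow_of_exponent_le hd ?_
  have h2 : (2 - βup) / 5 ≤ (2 - βup) / (2 * βlow + 1) :=
    div_le_div_of_nonneg_left (by linarith) (by linarith) (by linarith [hβ.1, hβ.2])
  have h3 : βup / (2 * βlow + 1) + -(2 / (2 * βlow + 1)) = -((2 - βup) / (2 * βlow + 1)) := by
    ring
  linarith

theorem upper_bound {z₀ ε L Lstar βlow βup lam : ℝ} (y₀ : ℝ) (hz₀ : z₀ ∈ Set.Ioo (0 : ℝ) 1)
    (hε : ε ∈ Set.Ioo (0 : ℝ) 1) (hβlow : 1 < βlow) (hβ' : βlow < βup) (hβup : βup < 2)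
    (hlam : lamStar βlow βup < lam) (hL : 0 < L) (hLs : 0 < Lstar) :
    limsup (fun n : ℕ => adaptiveRisk z₀ y₀ ε L Lstar βlow βup n
      (adaptiveEst z₀ y₀ ε βlow βup lam n)) atTop < ⊤ := by
  have hε0 := hε.1
  have hΔ : 0 < βup - βlow := by linarith
  obtain ⟨C, hC, hctl⟩ := exists_uniform_control (L := L) y₀ hz₀ hε hβlow hβup hL
  set δ : ℝ := (βup - βlow) / ((2 * βlow + 1) * (2 * βup + 1)) with hδ
  have hδ0 : 0 < δ := div_pos hΔ (mul_pos (by linarith) (by linarith))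
  -- This gives 2δ < 2/5, so the bad events, of probability O(d_n^(-2/5) ln n), survive
  -- multiplication by d_n^(2δ).
  have hδ1 : δ < 1 / 9 := by
    rw [hδ, div_lt_iff₀ (mul_pos (by linarith) (by linarith))]
    nlinarith
  have hlamS : 0 ≤ lamStar βlow βup := by unfold lamStar; positivity
  have hlam0 : 0 < lam := by linarith
  have hlamδ : 32 * δ < lam ^ 2 := by
    rw [← lamStar_sq (by linarith) hβ'.le]
    gcongr
  obtain ⟨c, hc0, hc⟩ : ∃ c : ℝ, 0 ≤ c ∧ Lstar * Real.exp (-c) ≤ lam / 4 := by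
    have h1 := Real.tendsto_exp_neg_atTop_nhds_zero.const_mul Lstar
    rw [mul_zero] at h1
    exact ((eventually_ge_atTop 0).and
      (h1.eventually_le_const (show 0 < lam / 4 by linarith))).exists
  -- A gap of r grid steps is 10c/m; since m ≤ 2 ln d_n, it is at least 5c / ln d_n, as the bias
  -- bound requires.
  set r : ℝ := 10 * c / (βup - βlow) with hr
  have hr0 : 0 ≤ r := by positivity
  have hrΔ : r * (βup - βlow) = 10 * c := div_mul_cancel₀ _ hΔ.ne'
  set b : ℝ := Lstar + 5 * L / ε with hb
  have hb0 : 0 ≤ b := by positivity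
  set ρ : ℝ := Real.exp ((r + 1) * (βup - βlow)) with hρ
  have hev : ∀ᶠ n : ℕ in atTop, adaptiveRisk z₀ y₀ ε L Lstar βlow βup n
      (adaptiveEst z₀ y₀ ε βlow βup lam n) ≤ ENNReal.ofReal (ρ * (2 * lam + b + 1 / 2) +
        4 * ρ + 4 + 2 * ρ * C + 2 * C + 2 * (2 * lam + b + 1 / 2)) := by
    filter_upwards [hctl, tendsto_dn.eventually_ge_atTop (Real.exp 1), eventually_gt_atTop 1,
      tendsto_log_natCast.eventually_ge_atTop 2,
      tendsto_log_natCast.eventually_ge_atTop (5 * L / ε / (lam / 4)),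
      eventually_log_pow_mul_dn_rpow_le 2 (show 0 < 2 / 5 - 2 * δ by linarith) (2 * C),
      -- The only place where the size of λ matters: λ² > 16δ would suffice here.
      eventually_log_pow_mul_dn_rpow_le 1 (show 0 < lam ^ 2 / 8 - 2 * δ by linarith) 4,
      eventually_log_pow_mul_dn_rpow_le 1 (show 0 < (2 - βup) / 5 by linarith) 1]
      with n hctl hde hn hl hl2 hq1 hq2 hq3
    rw [pow_one] at hq2 hq3
    have hd : 1 ≤ dn n := (Real.one_le_exp zero_le_one).trans hde
    have hd0 : 0 < dn n := by linarith
    have hld : 1 ≤ Real.log (dn n) := (Real.le_log_iff_exp_le hd0).2 hde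
    have hldl : Real.log (dn n) ≤ Real.log n :=
      Real.log_le_log hd0 (dn_le_natCast (by linarith))
    have hm0 : (0 : ℝ) < gridSize n := by exact_mod_cast gridSize_pos
    have hm1 := log_dn_lt_gridSize (n := n)
    have hm2 := gridSize_le_log_dn_add_one (n := n) (by linarith)
    have h5 : 5 * L / ε / Real.log n ≤ lam / 4 := by
      rw [div_le_iff₀ (by linarith)]
      rwa [div_le_iff₀' (by linarith)] at hl2
    refine iSup₂_le fun β hβ => iSup₂_le fun S hS => ?_
    have hmeas : Measurable fun y : Fin n → ℝ =>
        ENNReal.ofReal |adaptiveEst z₀ y₀ ε βlow βup lam n y - S z₀| :=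
      ((measurable_adaptiveEst z₀ y₀ ε βlow βup lam n).sub_const _).abs.ennreal_ofReal
    rw [obsLaw, lintegral_map hmeas (measurable_observations n S y₀)]
    obtain ⟨k, hkm, hkβ, hkup, hklow⟩ := exists_gridBeta_le (n := n) hβ' hβ hr0
    have hγ : ∀ j ≤ k, gridBeta n βlow βup j ∈ Set.Icc βlow βup :=
      fun j hj => gridBeta_mem hβ'.le (hj.trans hkm)
    have hγβ : ∀ j ≤ k, gridBeta n βlow βup j ≤ β :=
      fun j hj => (gridBeta_mono hβ'.le hj).trans hkβ
    -- `D` is the ratio of the extreme rates; `q` bounds the probability of each exceptional event,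
    -- using h² ≤ d_n^(-2/5) and d_n ≤ n.
    refine rate_mul_lintegral_le (D := dn n ^ δ)
      (q := C * (Real.log n * dn n ^ (-(2 / 5 : ℝ))) + 2 * dn n ^ (-(lam ^ 2 / 8)))
      hd hn (by linarith) hβlow hβ'.le hz₀ hε hLs.le (by linarith [hβ.1]) hlam0 hC.le hctl hS hkm
      (fun hk0 j hj => ?_) (fun j hj => ?_) hb0 ?_ ?_ (Real.one_le_rpow hd hδ0.le) ?_
      (fun j hj => ?_) ?_
    · refine relBias_le_of_log hd hLs.le (by linarith [(hγ j hj).1]) (by linarith [(hγ j hj).2])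
        ?_ (hγβ j hj) hc h5
      have h1 := hklow hk0
      rw [div_le_iff₀ hm0, hrΔ] at h1
      have h2 := gridBeta_mono (n := n) hβ'.le hj
      have h3 : (β - gridBeta n βlow βup k) * gridSize n ≤
          (β - gridBeta n βlow βup j) * (2 * Real.log (dn n)) :=
        mul_le_mul (by linarith) (by linarith) hm0.le (by linarith [hγβ j hj])
      linarith
    · exact relBias_le_of_le hd (by linarith) hε0 hL.le hLs.le (by linarith [(hγ j hj).1])
        (hγβ j hj)
    · refine rate_le_exp_mul_rate hd (by linarith [(hγ k le_rfl).1]) hkβ ?_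
      rw [le_div_iff₀ hm0] at hkup
      refine le_trans ?_ hkup
      rw [mul_comm]
      exact mul_le_mul_of_nonneg_left hm1.le (by linarith)
    · rw [← rate_div_rate hd0 (by linarith) (by linarith),
        div_mul_cancel₀ _ (rate_pos hd0).ne']
      exact rate_mono hd (by linarith [hβ.1]) hβ.2
    · calc _ = Real.log n * (rate n β * bandwidth n βlow ^ 2) := by ring
        _ ≤ Real.log n * dn n ^ (-((2 - βup) / 5)) :=
          mul_le_mul_of_nonneg_left (rate_mul_bandwidth_sq_le hd (by linarith) hβ hβup)
            (by linarith)
        _ ≤ 1 := by linarith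
    · have h1 := bandwidth_rpow_le (n := n) (β := gridBeta n βlow βup j) hd
        (by linarith [(hγ j hj).1]) (by linarith [(hγ j hj).2]) zero_le_two
      rw [Real.rpow_two] at h1
      have h2 : Real.exp (-(lam ^ 2 / 8 * Real.log n)) ≤ dn n ^ (-(lam ^ 2 / 8)) := by
        rw [Real.rpow_def_of_pos hd0]
        refine Real.exp_le_exp.2 ?_
        have := mul_le_mul_of_nonneg_left hldl (show 0 ≤ lam ^ 2 / 8 by positivity)
        linarith
      gcongr
    · have hk2 : (k : ℝ) + 1 ≤ 2 * Real.log n := by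
        have : (k : ℝ) ≤ gridSize n := by exact_mod_cast hkm
        linarith
      have e0 : (dn n ^ δ) ^ 2 = dn n ^ (2 * δ) := by
        rw [← Real.rpow_natCast, ← Real.rpow_mul hd0.le]
        congr 1
        push_cast
        ring
      have e1 : dn n ^ (2 * δ) * dn n ^ (-(2 / 5 : ℝ)) = dn n ^ (-(2 / 5 - 2 * δ)) := by
        rw [← Real.rpow_add hd0]; congr 1; ring
      have e2 : dn n ^ (2 * δ) * dn n ^ (-(lam ^ 2 / 8)) = dn n ^ (-(lam ^ 2 / 8 - 2 * δ)) := by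
        rw [← Real.rpow_add hd0]; congr 1; ring
      rw [e0]
      calc _ ≤ dn n ^ (2 * δ) * (2 * Real.log n *
            (C * (Real.log n * dn n ^ (-(2 / 5 : ℝ))) + 2 * dn n ^ (-(lam ^ 2 / 8)))) := by
            gcongr
        _ = 2 * C * Real.log n ^ 2 * (dn n ^ (2 * δ) * dn n ^ (-(2 / 5 : ℝ))) +
            4 * Real.log n * (dn n ^ (2 * δ) * dn n ^ (-(lam ^ 2 / 8))) := by ring
        _ ≤ 2 := by rw [e1, e2]; linarith
  exact (limsup_le_of_le (by isBoundedDefault) hev).trans_lt ENNReal.ofReal_lt_top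

end

end SeqAR

theorem theorem3p5 (z₀ y₀ ε βlow βup lam : ℝ)
    (hz₀ : z₀ ∈ Set.Ioo (0 : ℝ) 1) (hε : ε ∈ Set.Ioo (0 : ℝ) 1)
    (hβlow : 1 < βlow) (hβ : βlow < βup) (hβup : βup < 2)
    (hlam : SeqAR.lamStar βlow βup < lam) :
    (∀ n : ℕ, Measurable (SeqAR.adaptiveEst z₀ y₀ ε βlow βup lam n)) ∧
    (∀ L Lstar : ℝ, 0 < L → 0 < Lstar →
      limsup (fun n : ℕ => SeqAR.adaptiveRisk z₀ y₀ ε L Lstar βlow βup n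
        (SeqAR.adaptiveEst z₀ y₀ ε βlow βup lam n)) atTop < ⊤) ∧
    (∀ L : ℝ, 0 < L → ∃ L₀ : ℝ, 0 < L₀ ∧ ∀ Lstar : ℝ, L₀ < Lstar →
      0 < liminf (fun n : ℕ => ⨅ (T : (Fin n → ℝ) → ℝ) (_ : Measurable T),
        SeqAR.adaptiveRisk z₀ y₀ ε L Lstar βlow βup n T) atTop) :=
  ⟨SeqAR.measurable_adaptiveEst z₀ y₀ ε βlow βup lam,
    fun _ _ hL hLs => SeqAR.upper_bound y₀ hz₀ hε hβlow hβ hβup hlam hL hLs,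
    -- The lower bound holds for every positive `Lstar`, since the bump can be flattened through c;
    -- the threshold 1 is arbitrary.
    fun _ hL => ⟨1, one_pos, fun _ hLs => SeqAR.lower_bound y₀ hz₀ hε hβlow hβ hβup hL
      (one_pos.trans hLs)⟩⟩
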